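/- Let $F_0,\dots,F_3:\mathbb{R}^2\to\mathbb{R}^2$ be the contractions $$F_0(x,y)=\left(\tfrac29x+\tfrac{8}{9\sqrt3}y,\tfrac23y\right),\quad F_1(x,y)=\left(\tfrac29x-\tfrac{8}{9\sqrt3}y,\tfrac23y\right),$$ $$F_2(x,y)=\left(\tfrac13x-\tfrac23,\tfrac13y-\tfrac1{\sqrt3}\right),\quad F_3(x,y)=\left(\tfrac13x+\tfrac23,\tfrac13y-\tfrac1{\sqrt3}\right),$$ and let $K$ be the unique nonempty compact set with $K=\bigcup_{i=0}^3F_i(K)$. Put $q_1=(0,0)$, $q_2=(-1,-\frac{\sqrt3}2)$, $q_3=(1,-\frac{\sqrt3}2)$ (the fixed points of $F_0$ and $F_1$, of $F_2$, and of $F_3$), $q_0=F_2(q_1)=F_0(q_2)$, $\mathcal{C}=\{(x,y)\in K:y=-\frac{\sqrt3}2\}$, and $F_{i_1\cdots i_n}=F_{i_1}\circ\cdots\circ F_{i_n}$. For $u:K\to\mathbb{R}$ let $E_0(u)=(u(q_1)-u(q_2))^2+(u(q_1)-u(q_3))^2$ and $E_{n+1}(u)=\sum_{i=0}^32\,E_n(u\circ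 F_i)$. Let $\mathcal{E}(u)=\lim_{n\to\infty}E_n(u)$ for $u\in C(K)$, let $\mathcal{F}=\{u\in C(K):\mathcal{E}(u)<\infty\}$, and let $\mathcal{E}(u,v)$ be the associated bilinear form on $\mathcal{F}$ (the self-similar Dirichlet form on $K$ with all resistance scaling factors equal to $\frac12$). Equip $K$ with the resistance metric $R(x,y)=1/\inf\{\mathcal{E}(u):u\in\mathcal{F},\,u(x)=0,\,u(y)=1\}$ for $x\ne y$ (and $R(x,x)=0$), and let $B(x,r)$ be its open balls; for $B=B(x,r)$ write $\varepsilon B=B(x,\varepsilon r)$. Let $\mu$ be a finite Borel measure of full support on $K$. For $U\subset K$ open, $\mathcal{F}(U)$ denotes the closure of $\{\varphi\in\mathcal{F}:\operatorname{supp}\varphi\subset U\}$ in $\mathcal{F}$ with respect to the norm $(\mathcal{E}(u)+\|u\|_{L^2(\mu)}^2)^{1/2}$, and $u\in\mathcal{F}$ is called harmonic in $U$ if $\mathcal{E}(u,\varphi)=0$ for all $\varphi\in\mathcal{F}(U)$. The strong elliptic Harnack inequality (EHI) for $\mu$ says: there are $\varepsilon\in(0,1)$ and $C\ge1$ such that for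 every ball $B=B(x,r)$ with $r>0$ and every $u\in\mathcal{F}$ that is harmonic in $B$ and non-negative $\mu$-a.e. on $B$, $$\operatorname*{ess\,sup}_{\varepsilon B}u\le C\operatorname*{ess\,inf}_{\varepsilon B}u .$$ **Theorem.** 1. (EHI) fails for every finite Borel measure $\mu$ of full support on $K$. 2. Let $B_n=B(q_0,2^{-n})$. There is a constant $C\ge1$ such that for every finite Borel measure $\mu$ of full support on $K$, all integers $n,k\ge1$ and every word $\omega\in\{0,1\}^{n-1}$ there is a function $\phi'_{n,\omega,k}\in\mathcal{F}$, non-negative on $K$, which is harmonic in $B_n$ and equal to the indicator function of $F_{2\omega2^k}(\mathcal{C})$ on $\partial B_n$ (where $2^k$ denotes the digit $2$ repeated $k$ times); any function in $\mathcal{F}$ with the last two properties (harmonicity in $B_n$ and these boundary values) agrees with it on $B_n$; and for all $0<\varepsilon\le\frac12$, $$\frac{C^{-1}}{2^n\varepsilon+1}\le\frac{\inf_{\varepsilon B_n}\phi'_{n,\omega,k}}{\sup_{\varepsilon B_n}\phi'_{n,\omega,k}}\le\frac{C}{2^n\varepsilon+1}$$ (so that for fixed $\varepsilon$ the ratio tends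 to $0$ as $n\to\infty$). -/

import Mathlib

open Real Set Filter Topology MeasureTheory
open scoped ENNReal

namespace TreeFractal

noncomputable section

/-! ## The fractal -/

/-- The four affine contractions of the plane. (`ℝ × ℝ` is used for the plane; only its topology
matters below.) -/
def F : Fin 4 → ℝ × ℝ → ℝ × ℝ
  | 0, p => (2 / 9 * p.1 + 8 / (9 * √3) * p.2, 2 / 3 * p.2)
  | 1, p => (2 / 9 * p.1 - 8 / (9 * √3) * p.2, 2 / 3 * p.2)
  | 2, p => (1 / 3 * p.1 - 2 / 3, 1 / 3 * p.2 - 1 / √3)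
  | 3, p => (1 / 3 * p.1 + 2 / 3, 1 / 3 * p.2 - 1 / √3)

/-- The fixed point of `F 0` and of `F 1`. -/
def p₁ : ℝ × ℝ := (0, 0)

/-- The fixed point of `F 2`. -/
def p₂ : ℝ × ℝ := (-1, -(√3 / 2))

/-- The fixed point of `F 3`. -/
def p₃ : ℝ × ℝ := (1, -(√3 / 2))

/-- The vertex sets `V₀ = {p₁, p₂, p₃}`, `V_{n+1} = ⋃ i, F i (V_n)`. -/
def V : ℕ → Set (ℝ × ℝ)
  | 0 => {p₁, p₂, p₃}
  | n + 1 => ⋃ i, F i '' V n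

/-- The tree-like fractal, as the closure of `V_* = ⋃ n, V_n`. By `treeSet_invariant` and
`eq_treeSet` below it is the unique nonempty compact set `A` with `A = ⋃ i, F i (A)`. -/
def treeSet : Set (ℝ × ℝ) := closure (⋃ n, V n)

lemma F_continuous (i : Fin 4) : Continuous (F i) := by
  fin_cases i <;> unfold F <;> fun_prop

lemma F_zero_p₁ : F 0 p₁ = p₁ := by simp [F, p₁]

lemma F_two_p₂ : F 2 p₂ = p₂ := by
  have h : √3 * √3 = 3 := Real.mul_self_sqrt (by norm_num)
  have h0 : √3 ≠ 0 := by positivity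
  ext
  · simp [F, p₂]; norm_num
  · simp only [F, p₂]; field_simp; nlinarith

lemma F_three_p₃ : F 3 p₃ = p₃ := by
  have h : √3 * √3 = 3 := Real.mul_self_sqrt (by norm_num)
  have h0 : √3 ≠ 0 := by positivity
  ext
  · simp [F, p₃]; norm_num
  · simp only [F, p₃]; field_simp; nlinarith

lemma V_zero_subset : V 0 ⊆ V 1 := by
  rintro x (rfl | rfl | rfl)
  · exact mem_iUnion.2 ⟨0, _, by simp [V], F_zero_p₁⟩
  · exact mem_iUnion.2 ⟨2, _, by simp [V], F_two_p₂⟩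
  · exact mem_iUnion.2 ⟨3, _, by simp [V], F_three_p₃⟩

lemma V_bounded (n : ℕ) : V n ⊆ Icc (-1) 1 ×ˢ Icc (-(√3 / 2)) 0 := by
  have h : √3 * √3 = 3 := Real.mul_self_sqrt (by norm_num)
  have h0 : 0 < √3 := by positivity
  have e1 : 8 / (9 * √3) = 8 / 27 * √3 := by field_simp; nlinarith
  have e2 : 1 / √3 = √3 / 3 := by field_simp; nlinarith
  induction n with
  | zero =>
    rintro x (rfl | rfl | rfl) <;> simp [p₁, p₂, p₃] <;> positivity
  | succ n ih =>
    rintro x hx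
    obtain ⟨i, p, hp, rfl⟩ := mem_iUnion.1 hx
    obtain ⟨⟨a1, a2⟩, b1, b2⟩ := ih hp
    fin_cases i <;> simp only [F, mem_prod, mem_Icc, e1, e2] <;> refine ⟨⟨?_, ?_⟩, ?_, ?_⟩ <;> nlinarith

lemma treeSet_compact : IsCompact treeSet := by
  refine IsCompact.closure_of_subset (isCompact_Icc.prod isCompact_Icc)
    (iUnion_subset V_bounded)

lemma treeSet_nonempty : treeSet.Nonempty :=
  ⟨p₁, subset_closure (mem_iUnion.2 ⟨0, by simp [V]⟩)⟩

theorem treeSet_invariant :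
    treeSet.Nonempty ∧ IsCompact treeSet ∧ treeSet = ⋃ i, F i '' treeSet := by
  refine ⟨treeSet_nonempty, treeSet_compact, subset_antisymm ?_ ?_⟩
  · refine closure_minimal (iUnion_subset fun n => ?_) ?_
    · have key : ∀ m, V (m + 1) ⊆ ⋃ i, F i '' treeSet := fun m =>
        iUnion_mono fun i => image_mono ((subset_iUnion V m).trans subset_closure)
      cases n with
      | zero => exact V_zero_subset.trans (key 0)
      | succ m => exact key m
    · exact (isCompact_iUnion fun i => treeSet_compact.image (F_continuous i)).isClosed
  · refine iUnion_subset fun i => (image_closure_subset_closure_image (F_continuous i)).trans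
      (closure_mono ?_)
    rw [image_iUnion]
    exact iUnion_subset fun n x hx => mem_iUnion.2 ⟨n + 1, mem_iUnion.2 ⟨i, hx⟩⟩

lemma F_dist_le (i : Fin 4) (p q : ℝ × ℝ) : dist (F i p) (F i q) ≤ 3 / 4 * dist p q := by
  have h : √3 * √3 = 3 := Real.mul_self_sqrt (by norm_num)
  have h0 : 0 < √3 := by positivity
  have e1 : 8 / (9 * √3) = 8 / 27 * √3 := by field_simp; nlinarith
  have h1 : √3 ≤ 1.78 := by nlinarith
  have hx : |p.1 - q.1| ≤ dist p q := by
    rw [Prod.dist_eq, ← Real.dist_eq]; exact le_max_left _ _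
  have hy : |p.2 - q.2| ≤ dist p q := by
    rw [Prod.dist_eq, ← Real.dist_eq]; exact le_max_right _ _
  have hd : 0 ≤ dist p q := dist_nonneg
  generalize dist p q = d at hx hy hd ⊢
  rw [abs_le] at hx hy
  obtain ⟨x1, x2⟩ := hx
  obtain ⟨y1, y2⟩ := hy
  have s1 : √3 * (p.2 - q.2) ≤ √3 * d := by gcongr
  have s2 : √3 * (-d) ≤ √3 * (p.2 - q.2) := by gcongr
  have s3 : √3 * d ≤ 1.78 * d := by gcongr
  rw [Prod.dist_eq, Real.dist_eq, Real.dist_eq]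
  refine max_le ?_ ?_ <;> rw [abs_le] <;> fin_cases i <;>
    simp only [F, e1] <;>
    constructor <;> linarith

lemma subset_of_invariant {A B : Set (ℝ × ℝ)} (hA : IsCompact A) (hAF : A = ⋃ i, F i '' A)
    (hB : IsCompact B) (hB0 : B.Nonempty) (hBF : B = ⋃ i, F i '' B) : A ⊆ B := by
  intro x hx
  obtain ⟨a, ha, hmax⟩ := hA.exists_isMaxOn ⟨x, hx⟩ (Metric.continuous_infDist_pt B).continuousOn
  have h1 : Metric.infDist a B ≤ 3 / 4 * Metric.infDist a B := by
    have ha' := ha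
    rw [hAF] at ha'
    obtain ⟨i, c, hc, hca⟩ := mem_iUnion.1 ha'
    obtain ⟨b, hb, hcb⟩ := hB.exists_infDist_eq_dist hB0 c
    have hFb : F i b ∈ B := by
      rw [hBF]; exact mem_iUnion.2 ⟨i, b, hb, rfl⟩
    calc Metric.infDist a B ≤ dist a (F i b) := Metric.infDist_le_dist_of_mem hFb
      _ ≤ 3 / 4 * dist c b := by rw [← hca]; exact F_dist_le i c b
      _ = 3 / 4 * Metric.infDist c B := by rw [hcb]
      _ ≤ 3 / 4 * Metric.infDist a B := by
        have := hmax hc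
        simp only [mem_ofPred_eq] at this
        linarith
  have h2 : Metric.infDist x B ≤ Metric.infDist a B := hmax hx
  have h3 : Metric.infDist x B = 0 := by
    have := Metric.infDist_nonneg (x := x) (s := B)
    linarith
  exact (hB.isClosed.mem_iff_infDist_zero hB0).2 h3

theorem eq_treeSet {A : Set (ℝ × ℝ)} (hA0 : A.Nonempty) (hA : IsCompact A)
    (hAF : A = ⋃ i, F i '' A) : A = treeSet :=
  subset_antisymm
    (subset_of_invariant hA hAF treeSet_compact treeSet_nonempty treeSet_invariant.2.2)
    (subset_of_invariant treeSet_compact treeSet_invariant.2.2 hA hA0 hAF)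

/-- The fractal `K` as a space, with the topology and Borel σ-algebra induced from the plane. -/
abbrev K : Type := treeSet

lemma F_mem (i : Fin 4) (x : K) : F i x ∈ treeSet := by
  exact treeSet_invariant.2.2.symm.subset (mem_iUnion.2 ⟨i, x, x.2, rfl⟩)

/-- The contractions as self-maps of `K`. -/
def cellMap (i : Fin 4) (x : K) : K := ⟨F i x, F_mem i x⟩

/-- `F_ω = F_{i₁} ∘ ⋯ ∘ F_{iₙ}` for a finite word `ω = i₁ ⋯ iₙ`. -/
def wordMap : List (Fin 4) → K → K
  | [] => id
  | i :: ω => cellMap i ∘ wordMap ω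

def q₁ : K := ⟨p₁, subset_closure (mem_iUnion.2 ⟨0, by simp [V]⟩)⟩

def q₂ : K := ⟨p₂, subset_closure (mem_iUnion.2 ⟨0, by simp [V]⟩)⟩

def q₃ : K := ⟨p₃, subset_closure (mem_iUnion.2 ⟨0, by simp [V]⟩)⟩

/-- The point `q₀ = F₂(q₁)`, which is also `F₀(q₂)`. -/
def q₀ : K := cellMap 2 q₁

lemma q₀_eq : q₀ = cellMap 0 q₂ := by
  have h : √3 * √3 = 3 := Real.mul_self_sqrt (by norm_num)
  have h0 : √3 ≠ 0 := by positivity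
  apply Subtype.ext
  ext
  · simp only [q₀, cellMap, F, q₁, q₂, p₁, p₂]; field_simp; nlinarith
  · simp only [q₀, cellMap, F, q₁, q₂, p₁, p₂]; field_simp; nlinarith

/-- The Cantor set at the bottom of `K`. -/
def cantor : Set K := {x | x.1.2 = -(√3 / 2)}

/-! ## The self-similar Dirichlet form with all resistance scaling factors `1 / 2` -/

/-- `E₀(u, v) = (u(q₁)-u(q₂))(v(q₁)-v(q₂)) + (u(q₁)-u(q₃))(v(q₁)-v(q₃))` and
`E_{n+1}(u, v) = ∑ i, (1 / 2)⁻¹ E_n(u ∘ F i, v ∘ F i)`. -/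
def E : ℕ → (K → ℝ) → (K → ℝ) → ℝ
  | 0, u, v => (u q₁ - u q₂) * (v q₁ - v q₂) + (u q₁ - u q₃) * (v q₁ - v q₃)
  | n + 1, u, v => ∑ i, (1 / 2 : ℝ)⁻¹ * E n (u ∘ cellMap i) (v ∘ cellMap i)

/-- The domain `𝓕`: continuous functions whose energies `E_n(u, u)` have a finite limit. (The
sequence is nondecreasing.) -/
def domain : Set C(K, ℝ) := {u | ∃ L : ℝ, Tendsto (fun n => E n u u) atTop (𝓝 L)}

/-- The form `𝓔(u, v) = lim E_n(u, v)`, meaningful for `u, v ∈ domain`. -/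
def energy (u v : C(K, ℝ)) : ℝ := limUnder atTop (fun n => E n u v)

/-- The effective resistance
`R(x, y) = 1 / inf {𝓔(u) : u ∈ 𝓕, u(x) = 0, u(y) = 1}`, which is `0` if `x = y`. -/
def resist (x y : K) : ℝ≥0∞ :=
  (⨅ u ∈ {u : C(K, ℝ) | u ∈ domain ∧ u x = 0 ∧ u y = 1}, ENNReal.ofReal (energy u u))⁻¹

/-- The open ball of the resistance metric. -/
def ball (x : K) (r : ℝ) : Set K := {y | resist x y < ENNReal.ofReal r}

/-! ## Harmonic functions and the strong elliptic Harnack inequality -/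

/-- `𝓕(U)`: the closure, in the norm `(𝓔(u) + ‖u‖²_{L²(μ)})^{1/2}` of `𝓕`, of the set of those
functions in `𝓕` whose support is contained in `U`. -/
def domainIn (μ : Measure K) (U : Set K) : Set C(K, ℝ) :=
  {φ | φ ∈ domain ∧ ∀ δ > 0, ∃ ψ ∈ domain, tsupport ψ ⊆ U ∧
    energy (φ - ψ) (φ - ψ) + ∫ x, (φ x - ψ x) ^ 2 ∂μ < δ}

/-- `u ∈ 𝓕` is harmonic in `U`. -/
def Harmonic (μ : Measure K) (U : Set K) (u : C(K, ℝ)) : Prop :=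
  u ∈ domain ∧ ∀ φ ∈ domainIn μ U, energy u φ = 0

/-- The strong elliptic Harnack inequality of `(𝓔, 𝓕)` on `L²(K, μ)`, with respect to the balls of
the resistance metric. -/
def EHI (μ : Measure K) : Prop :=
  ∃ ε : ℝ, 0 < ε ∧ ε < 1 ∧ ∃ C : ℝ, 1 ≤ C ∧
    ∀ (x : K) (r : ℝ), 0 < r → ∀ u : C(K, ℝ), Harmonic μ (ball x r) u →
      (∀ᵐ y ∂(μ.restrict (ball x r)), 0 ≤ u y) →
      essSup u (μ.restrict (ball x (ε * r))) ≤ C * essInf u (μ.restrict (ball x (ε * r)))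

/-- The ball `B_n = B(q₀, 2⁻ⁿ)`, dilated by the factor `ε`. -/
def dilatedB (ε : ℝ) (n : ℕ) : Set K := ball q₀ (ε * (1 / 2) ^ n)

/-- `φ ∈ 𝓕` is harmonic in `B_n`, and on the boundary of `B_n` it equals the indicator function of
the Cantor set `F_{2 ω 2ᵏ}(cantor)`. -/
def IsPhi' (μ : Measure K) (n : ℕ) (ω : List (Fin 4)) (k : ℕ) (φ : C(K, ℝ)) : Prop :=
  Harmonic μ (dilatedB 1 n) φ ∧
    ∀ x ∈ frontier (dilatedB 1 n),
      φ x = (wordMap (2 :: (ω ++ List.replicate k 2)) '' cantor).indicator 1 x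

end

end TreeFractal

open TreeFractal

/-!
The proof is explicit. The set `K` is a tree: its four cells meet only at the junctions `q₁`,
`q₀ = F₀(q₂) = F₂(q₁)` and `F₁(q₃) = F₃(q₁)`, so functions on the cells can be glued
(`exists_glue`), and the resistance is additive along paths. With resistance scaling `1/2` the point
`q₁` has resistance exactly `1` to every point of the bottom Cantor set.

A ball `B(q₀, 2⁻ⁿ)` consists of one cell above `q₀`, in which it is a copy of `B(q₂, 1)`, and of
`2ⁿ⁻¹` cells `F_{2ω}(K)` below `q₀`, each without its Cantor set. The equilibrium potentials in these
pieces are self-similar: `H` for a lower cell (conductance `3`) and `W` for the upper cell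
(conductance `3/2`); `ballPot` is assembled from their copies, and `res_q₀_lt_iff` identifies the
ball with the set where it is positive. The function `φ'` is the sum of `a · ballPot` and of a
potential supported near one lower cell (`branchPot`, carried there by `lift`) which vanishes at
`q₀`, has boundary value `1` on `F_{2ω2ᵏ}(cantor)` and whose current at `q₀` is proportional to
`2⁻ᵏ`. Kirchhoff's law at `q₀` gives `a = 2¹⁻ᵏ / (2ⁿ + 1)`. Since the current is shared by `2ⁿ⁻¹`
branches, `φ'` is of order `a` on all of `εBₙ` except in one branch, where it rises linearly up to
order `2⁻ᵏ ε`. This gives the two-sided bound `ratio_bounds` for the ratio, and it contradicts (EHI)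
as `n → ∞` (`not_EHI`).

Gauss–Green formulas such as `energy_H` and `energy_W`, which evaluate `𝓔(H, v)` as a multiple of a
single value of `v`, follow from self-similarity: the defect between both sides is reproduced on
subcells with a smaller constant, hence vanishes (`eq_zero_of_contraction`). Uniqueness in the
Dirichlet problem is `eqOn_of_harmonic`.
-/

namespace TreeFractal

noncomputable section

/-! ### Geometry of the cells -/

lemma sqrt_three_mul_self : √3 * √3 = 3 := Real.mul_self_sqrt (by norm_num)

lemma sqrt_three_pos : 0 < √3 := by positivity

lemma eight_div_eq : 8 / (9 * √3) = 8 / 27 * √3 := by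
  have := sqrt_three_mul_self
  have := sqrt_three_pos
  field_simp; nlinarith

lemma one_div_sqrt_three : 1 / √3 = √3 / 3 := by
  have := sqrt_three_mul_self
  have := sqrt_three_pos
  field_simp; nlinarith

/-- `K` lies in the triangle with vertices `q₁, q₂, q₃`. -/
lemma mem_triangle (x : K) : √3 * |x.1.1| ≤ -2 * x.1.2 ∧ -(√3 / 2) ≤ x.1.2 := by
  have h := sqrt_three_mul_self
  have h0 := sqrt_three_pos
  have hc : IsClosed {p : ℝ × ℝ | √3 * |p.1| ≤ -2 * p.2 ∧ -(√3 / 2) ≤ p.2} := by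
    rw [ofPred_and]
    exact (isClosed_le (by fun_prop) (by fun_prop)).inter (isClosed_le (by fun_prop) (by fun_prop))
  refine closure_minimal (iUnion_subset fun n => ?_) hc x.2
  induction n with
  | zero =>
    rintro p (rfl | rfl | rfl) <;> simp [p₁, p₂, p₃] <;> linarith
  | succ n ih =>
    rintro p hp
    obtain ⟨i, q, hq, rfl⟩ := mem_iUnion.1 hp
    obtain ⟨a, b⟩ := ih hq
    have c : |√3 * q.1| ≤ -2 * q.2 := by rwa [abs_mul, abs_of_pos h0]
    rw [abs_le] at c
    have e : √3 * |(F i q).1| = |√3 * (F i q).1| := by rw [abs_mul, abs_of_pos h0]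
    rw [mem_ofPred_eq, e, abs_le]
    fin_cases i <;> simp only [F, eight_div_eq, one_div_sqrt_three] <;>
      refine ⟨⟨?_, ?_⟩, ?_⟩ <;> nlinarith

lemma snd_le_zero (x : K) : x.1.2 ≤ 0 := by
  have := (mem_triangle x).1
  have : 0 ≤ √3 * |x.1.1| := by positivity
  linarith

lemma eq_q₁_of_snd (x : K) (hx : x.1.2 = 0) : x = q₁ := by
  have h := (mem_triangle x).1
  have h0 := sqrt_three_pos
  have : |x.1.1| = 0 := by
    have := abs_nonneg x.1.1
    nlinarith
  exact Subtype.ext (Prod.ext (by simpa [q₁, p₁] using this) (by simpa [q₁, p₁] using hx))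

lemma cellMap_continuous (i : Fin 4) : Continuous (cellMap i) :=
  ((F_continuous i).comp continuous_subtype_val).subtype_mk _

/-- `cellMap i` as a bundled continuous map. -/
def cell (i : Fin 4) : C(K, K) := ⟨cellMap i, cellMap_continuous i⟩

lemma cellMap_dist_le (i : Fin 4) (x y : K) :
    dist (cellMap i x) (cellMap i y) ≤ 3 / 4 * dist x y := F_dist_le i x y

lemma cellMap_injective (i : Fin 4) : Function.Injective (cellMap i) := by
  intro x y h
  have h1 : (F i x).1 = (F i y).1 := congrArg (fun z : K => z.1.1) h
  have h2 : (F i x).2 = (F i y).2 := congrArg (fun z : K => z.1.2) h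
  have e : x.1.2 = y.1.2 := by
    fin_cases i <;> simp only [F] at h2 <;> linarith
  refine Subtype.ext (Prod.ext ?_ e)
  fin_cases i <;> simp only [F, e] at h1 <;> linarith

lemma exists_cell (x : K) : ∃ i y, cellMap i y = x := by
  obtain ⟨i, p, hp, h⟩ := mem_iUnion.1 (treeSet_invariant.2.2.subset x.2)
  exact ⟨i, ⟨p, hp⟩, Subtype.ext h⟩

lemma forall_cell {P : K → Prop} (h : ∀ i y, P (cellMap i y)) (x : K) : P x := by
  obtain ⟨i, y, rfl⟩ := exists_cell x
  exact h i y

@[simp] lemma cellMap_zero_q₁ : cellMap 0 q₁ = q₁ := Subtype.ext F_zero_p₁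

@[simp] lemma cellMap_one_q₁ : cellMap 1 q₁ = q₁ := Subtype.ext (by simp [cellMap, q₁, F, p₁])

@[simp] lemma cellMap_two_q₂ : cellMap 2 q₂ = q₂ := Subtype.ext F_two_p₂

@[simp] lemma cellMap_three_q₃ : cellMap 3 q₃ = q₃ := Subtype.ext F_three_p₃

lemma cellMap_zero_q₂ : cellMap 0 q₂ = cellMap 2 q₁ := q₀_eq.symm

lemma cellMap_one_q₃ : cellMap 1 q₃ = cellMap 3 q₁ := by
  have h := sqrt_three_mul_self
  refine Subtype.ext (Prod.ext ?_ ?_) <;>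
    simp only [cellMap, F, q₁, q₃, p₁, p₃, eight_div_eq, one_div_sqrt_three] <;> nlinarith

lemma snd_cellMap (i : Fin 4) (x : K) : (cellMap i x).1.2 =
    if i = 0 ∨ i = 1 then 2 / 3 * x.1.2 else 1 / 3 * x.1.2 - √3 / 3 := by
  fin_cases i <;> simp [cellMap, F, div_eq_mul_inv] <;> rw [← one_div, one_div_sqrt_three] <;> ring

lemma cell_zero_one {x y : K} (h : cellMap 0 x = cellMap 1 y) : x = q₁ ∧ y = q₁ := by
  have h3 := sqrt_three_mul_self
  have h0 := sqrt_three_pos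
  have h1 : (F 0 x).1 = (F 1 y).1 := congrArg (fun z : K => z.1.1) h
  have h2 : (F 0 x).2 = (F 1 y).2 := congrArg (fun z : K => z.1.2) h
  simp only [F, eight_div_eq] at h1 h2
  have tx := (mem_triangle x).1
  have ty := (mem_triangle y).1
  have ax := neg_abs_le x.1.1
  have ay := neg_abs_le y.1.1
  have bx := le_abs_self x.1.1
  have e : x.1.2 = y.1.2 := by linarith
  have hx := snd_le_zero x
  have : x.1.2 = 0 := by
    rw [← e] at h1 ty
    -- the horizontal distance of preimages, `8|y|/√3`, exceeds the width `4|y|/√3` of the triangle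
    have k : √3 * (x.1.1 - y.1.1) = -8 * x.1.2 := by
      have : x.1.1 - y.1.1 = -(8 / 3 * √3 * x.1.2) := by linarith
      rw [this]; linear_combination (-8 / 3 * x.1.2) * h3
    have k2 : √3 * (x.1.1 - y.1.1) ≤ √3 * |x.1.1| + √3 * |y.1.1| := by
      rw [← mul_add]; gcongr; linarith
    linarith
  exact ⟨eq_q₁_of_snd x this, eq_q₁_of_snd y (by linarith)⟩

lemma q₁_of_cell_upper_lower {i j : Fin 4} (hi : i = 0 ∨ i = 1) (hj : ¬(j = 0 ∨ j = 1)) {x y : K}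
    (h : cellMap i x = cellMap j y) : y = q₁ := by
  have h2 : (cellMap i x).1.2 = (cellMap j y).1.2 := by rw [h]
  rw [snd_cellMap, snd_cellMap, if_pos hi, if_neg hj] at h2
  have := (mem_triangle x).2
  have := snd_le_zero y
  exact eq_q₁_of_snd y (by linarith)

lemma cell_zero_two {x y : K} (h : cellMap 0 x = cellMap 2 y) : x = q₂ ∧ y = q₁ := by
  have e := q₁_of_cell_upper_lower (by simp) (by simp) h
  subst e
  rw [← cellMap_zero_q₂] at h
  exact ⟨cellMap_injective _ h, rfl⟩

lemma cell_one_three {x y : K} (h : cellMap 1 x = cellMap 3 y) : x = q₃ ∧ y = q₁ := by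
  have e := q₁_of_cell_upper_lower (by simp) (by simp) h
  subst e
  rw [← cellMap_one_q₃] at h
  exact ⟨cellMap_injective _ h, rfl⟩

lemma fst_le_one (x : K) : |x.1.1| ≤ 1 := by
  have h := mem_triangle x
  have h0 := sqrt_three_pos
  nlinarith [h.1, h.2]

lemma cell_zero_three {x y : K} (h : cellMap 0 x = cellMap 3 y) : False := by
  have e := q₁_of_cell_upper_lower (by simp) (by simp) h
  subst e
  have h1 : (F 0 x).1 = (F 3 q₁).1 := congrArg (fun z : K => z.1.1) h
  have h2 : (F 0 x).2 = (F 3 q₁).2 := congrArg (fun z : K => z.1.2) h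
  simp only [F, eight_div_eq, one_div_sqrt_three, q₁, p₁] at h1 h2
  have := abs_le.1 (fst_le_one x)
  have h0 := sqrt_three_pos
  have := snd_le_zero x
  nlinarith

lemma cell_one_two {x y : K} (h : cellMap 1 x = cellMap 2 y) : False := by
  have e := q₁_of_cell_upper_lower (by simp) (by simp) h
  subst e
  have h1 : (F 1 x).1 = (F 2 q₁).1 := congrArg (fun z : K => z.1.1) h
  have h2 : (F 1 x).2 = (F 2 q₁).2 := congrArg (fun z : K => z.1.2) h
  simp only [F, eight_div_eq, one_div_sqrt_three, q₁, p₁] at h1 h2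
  have := abs_le.1 (fst_le_one x)
  have h0 := sqrt_three_pos
  have := snd_le_zero x
  nlinarith

lemma cell_two_three {x y : K} (h : cellMap 2 x = cellMap 3 y) : False := by
  have h1 : (F 2 x).1 = (F 3 y).1 := congrArg (fun z : K => z.1.1) h
  simp only [F] at h1
  have := abs_le.1 (fst_le_one x)
  have := abs_le.1 (fst_le_one y)
  linarith

/-! ### Functions glued from their restrictions to the cells -/

/-- `K` is the quotient of four copies of itself by the identifications at the three junctions, so
continuous functions on the cells which agree there have a common extension. -/
theorem exists_glue (f : Fin 4 → C(K, ℝ)) (h01 : f 0 q₁ = f 1 q₁) (h02 : f 0 q₂ = f 2 q₁)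
    (h13 : f 1 q₃ = f 3 q₁) : ∃ g : C(K, ℝ), ∀ i x, g (cellMap i x) = f i x := by
  have : CompactSpace K := isCompact_iff_compactSpace.1 treeSet_compact
  let p : Fin 4 × K → K := fun z => cellMap z.1 z.2
  have hp : Continuous p := continuous_prod_of_discrete_left.2 cellMap_continuous
  have hs : Function.Surjective p := fun x => by
    obtain ⟨i, y, h⟩ := exists_cell x
    exact ⟨(i, y), h⟩
  have hq : IsQuotientMap p := hp.isClosedMap.isQuotientMap hp hs
  let F' : C(Fin 4 × K, ℝ) :=
    ⟨fun z => f z.1 z.2, continuous_prod_of_discrete_left.2 fun i => (f i).continuous⟩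
  have key : ∀ i j x y, cellMap i x = cellMap j y → f i x = f j y := by
    have aux : ∀ i j x y, i < j → cellMap i x = cellMap j y → f i x = f j y := by
      intro i j x y hij h
      fin_cases i <;> fin_cases j <;> simp at hij
      · obtain ⟨rfl, rfl⟩ := cell_zero_one h
        exact h01
      · obtain ⟨rfl, rfl⟩ := cell_zero_two h
        exact h02
      · exact (cell_zero_three h).elim
      · exact (cell_one_two h).elim
      · obtain ⟨rfl, rfl⟩ := cell_one_three h
        exact h13
      · exact (cell_two_three h).elim
    intro i j x y h
    rcases lt_trichotomy i j with l | l | l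
    · exact aux i j x y l h
    · subst l
      rw [cellMap_injective i h]
    · exact (aux j i y x l h.symm).symm
  have hF : Function.FactorsThrough F' p := fun a b hab => key _ _ _ _ hab
  exact ⟨hq.lift (f := ⟨p, hp⟩) F' hF,
    fun i x => DFunLike.congr_fun (hq.lift_comp (f := ⟨p, hp⟩) F' hF) (i, x)⟩

open Classical in
/-- The function with given restrictions to the four cells (`0` if these do not match). -/
def glue (f₀ f₁ f₂ f₃ : C(K, ℝ)) : C(K, ℝ) :=
  if h : ∃ g : C(K, ℝ), ∀ i x, g (cellMap i x) = ![f₀, f₁, f₂, f₃] i x then h.choose else 0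

lemma glue_apply {f₀ f₁ f₂ f₃ : C(K, ℝ)} (h01 : f₀ q₁ = f₁ q₁) (h02 : f₀ q₂ = f₂ q₁)
    (h13 : f₁ q₃ = f₃ q₁) (i : Fin 4) (x : K) :
    glue f₀ f₁ f₂ f₃ (cellMap i x) = ![f₀, f₁, f₂, f₃] i x := by
  have h := exists_glue ![f₀, f₁, f₂, f₃] h01 h02 h13
  rw [glue, dif_pos h]
  exact h.choose_spec i x

/-- Self-similar functions: the equations `f ∘ F_i = α_i f + c_i` with `|α_i| ≤ 1/2` have a
solution with prescribed values at `q₁, q₂, q₃` and `0 ≤ f ≤ 1` if the data are consistent, by the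
contraction principle. -/
theorem exists_selfSimilar (α : Fin 4 → ℝ) (c : Fin 4 → C(K, ℝ)) (v₁ v₂ v₃ : ℝ)
    (hα : ∀ i, |α i| ≤ 1 / 2)
    (hc : ∀ i x t, 0 ≤ t → t ≤ 1 → 0 ≤ α i * t + c i x ∧ α i * t + c i x ≤ 1)
    (h₁ : 0 ≤ v₁ ∧ v₁ ≤ 1) (h₂ : 0 ≤ v₂ ∧ v₂ ≤ 1) (h₃ : 0 ≤ v₃ ∧ v₃ ≤ 1)
    (e₀ : α 0 * v₁ + c 0 q₁ = v₁) (e₁ : α 1 * v₁ + c 1 q₁ = v₁) (e₂ : α 2 * v₂ + c 2 q₂ = v₂)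
    (e₃ : α 3 * v₃ + c 3 q₃ = v₃) (e₀₂ : α 0 * v₂ + c 0 q₂ = α 2 * v₁ + c 2 q₁)
    (e₁₃ : α 1 * v₃ + c 1 q₃ = α 3 * v₁ + c 3 q₁) :
    ∃ f : C(K, ℝ), f q₁ = v₁ ∧ f q₂ = v₂ ∧ f q₃ = v₃ ∧ (∀ x, 0 ≤ f x ∧ f x ≤ 1) ∧
      ∀ i x, f (cellMap i x) = α i * f x + c i x := by
  have : CompactSpace K := isCompact_iff_compactSpace.1 treeSet_compact
  let S : Set C(K, ℝ) :=
    {f | f q₁ = v₁} ∩ ({f | f q₂ = v₂} ∩ ({f | f q₃ = v₃} ∩ {f | ∀ x, 0 ≤ f x ∧ f x ≤ 1}))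
  have hS : IsClosed S := by
    have ev : ∀ x : K, Continuous fun f : C(K, ℝ) => f x := fun x => by fun_prop
    refine (isClosed_eq (ev _) continuous_const).inter ((isClosed_eq (ev _) continuous_const).inter
      ((isClosed_eq (ev _) continuous_const).inter ?_))
    have : {f : C(K, ℝ) | ∀ x, 0 ≤ f x ∧ f x ≤ 1} = ⋂ x, ({f | 0 ≤ f x} ∩ {f | f x ≤ 1}) := by
      ext; simp
    rw [this]
    exact isClosed_iInter fun x =>
      (isClosed_le continuous_const (ev x)).inter (isClosed_le (ev x) continuous_const)
  have : CompleteSpace S := hS.completeSpace_coe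
  have hne : Nonempty S := by
    have hp := sqrt_three_pos
    -- the affine function with the prescribed values, truncated to `[0, 1]`
    let a : K → ℝ := fun x => v₁ + (v₃ - v₂) / 2 * x.1.1 - (v₂ + v₃ - 2 * v₁) / √3 * x.1.2
    have ha : Continuous a := by fun_prop
    refine ⟨⟨⟨fun x => max 0 (min 1 (a x)), by fun_prop⟩, ?_, ?_, ?_, fun x => ?_⟩⟩
    · have : a q₁ = v₁ := by simp [a, q₁, p₁]
      simp [this, h₁]
    · have : a q₂ = v₂ := by simp only [a, q₂, p₂]; field_simp; ring
      simp [this, h₂]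
    · have : a q₃ = v₃ := by simp only [a, q₃, p₃]; field_simp; ring
      simp [this, h₃]
    · simp
  have hT : ∀ f : S, ∃ g : S, ∀ i x, g.1 (cellMap i x) = α i * f.1 x + c i x := by
    rintro ⟨f, f₁, f₂, f₃, hf⟩
    rw [mem_ofPred_eq] at f₁ f₂ f₃ hf
    obtain ⟨g, hg⟩ := exists_glue (fun i => α i • f + c i) (by simp [f₁, e₀, e₁])
      (by simp [f₁, f₂, e₀₂]) (by simp [f₁, f₃, e₁₃])
    have hg : ∀ i x, g (cellMap i x) = α i * f x + c i x := fun i x => by simp [hg]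
    refine ⟨⟨g, ?_, ?_, ?_, ?_⟩, hg⟩
    · have := hg 0 q₁
      rwa [f₁, e₀, cellMap_zero_q₁] at this
    · have := hg 2 q₂
      rwa [f₂, e₂, cellMap_two_q₂] at this
    · have := hg 3 q₃
      rwa [f₃, e₃, cellMap_three_q₃] at this
    · refine forall_cell fun i x => ?_
      rw [hg]
      exact hc i x _ (hf x).1 (hf x).2
  choose T hT using hT
  have hcontr : ContractingWith (1 / 2) T := by
    refine ⟨by norm_num, LipschitzWith.of_dist_le_mul fun f g => ?_⟩
    refine (ContinuousMap.dist_le (by positivity)).2 (forall_cell fun i x => ?_)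
    rw [hT, hT, Real.dist_eq]
    have h : |f.1 x - g.1 x| ≤ dist f g := ContinuousMap.dist_apply_le_dist (f := f.1) (g := g.1) x
    calc |α i * f.1 x + c i x - (α i * g.1 x + c i x)| = |α i| * |f.1 x - g.1 x| := by
          rw [← abs_mul]; congr 1; ring
      _ ≤ 1 / 2 * dist f g := by gcongr; exact hα i
      _ = _ := by simp
  obtain ⟨f, hf⟩ : ∃ f : S, T f = f := ⟨_, hcontr.fixedPoint_isFixedPt⟩
  obtain ⟨k₁, k₂, k₃, k⟩ := f.2
  refine ⟨f, k₁, k₂, k₃, k, fun i x => ?_⟩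
  conv_lhs => rw [← hf]
  exact hT f i x

/-! ### The bottom Cantor set -/

lemma not_mem_cantor_upper {i : Fin 4} (hi : i = 0 ∨ i = 1) (x : K) : cellMap i x ∉ cantor := by
  intro h
  have h : (cellMap i x).1.2 = -(√3 / 2) := h
  rw [snd_cellMap, if_pos hi] at h
  have := (mem_triangle x).2
  have := sqrt_three_pos
  linarith

lemma mem_cantor_lower {i : Fin 4} (hi : ¬(i = 0 ∨ i = 1)) (x : K) :
    cellMap i x ∈ cantor ↔ x ∈ cantor := by
  change (cellMap i x).1.2 = -(√3 / 2) ↔ x.1.2 = -(√3 / 2)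
  rw [snd_cellMap, if_neg hi]
  constructor <;> intro h <;> linarith

lemma q₂_mem_cantor : q₂ ∈ cantor := rfl

lemma eq_zero_or_one_or (i : Fin 4) : (i = 0 ∨ i = 1) ∨ (i = 2 ∨ i = 3) := by
  fin_cases i <;> simp

lemma not_upper {i : Fin 4} (h : i = 2 ∨ i = 3) : ¬(i = 0 ∨ i = 1) := by
  rcases h with rfl | rfl <;> decide

/-- Points off the Cantor set leave the lower cells `F₂, F₃` after finitely many zooms. -/
lemma cantor_induction {P : K → Prop} (hC : ∀ x ∈ cantor, P x)
    (hu : ∀ i, i = 0 ∨ i = 1 → ∀ x, P (cellMap i x))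
    (hl : ∀ i, i = 2 ∨ i = 3 → ∀ x, P x → P (cellMap i x)) (x : K) : P x := by
  have key : ∀ m : ℕ, ∀ x : K, (1 / 3 : ℝ) ^ m < x.1.2 + √3 / 2 → P x := by
    intro m
    induction m with
    | zero =>
      intro x h
      have := snd_le_zero x
      have := sqrt_three_mul_self
      have := sqrt_three_pos
      rw [pow_zero] at h
      nlinarith
    | succ m ih =>
      refine forall_cell fun i x h => ?_
      rcases eq_zero_or_one_or i with hi | hi
      · exact hu i hi x
      · refine hl i hi x (ih x ?_)
        rw [snd_cellMap, if_neg (not_upper hi), pow_succ] at h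
        linarith
  by_cases hx : x ∈ cantor
  · exact hC x hx
  · have h : 0 < x.1.2 + √3 / 2 := by
      have := (mem_triangle x).2
      have : x.1.2 ≠ -(√3 / 2) := hx
      rcases (mem_triangle x).2.lt_or_eq with h | h
      · linarith
      · exact (this h.symm).elim
    obtain ⟨m, hm⟩ := exists_pow_lt_of_lt_one h (by norm_num : (1 / 3 : ℝ) < 1)
    exact key m x hm

/-- Points other than `q₁` leave the cell `F₀` after finitely many zooms. -/
lemma q₁_induction {P : K → Prop} (h₁ : P q₁) (hne : ∀ i, i ≠ 0 → ∀ x, P (cellMap i x))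
    (h₀ : ∀ x, P x → P (cellMap 0 x)) (x : K) : P x := by
  have key : ∀ m : ℕ, ∀ x : K, (2 / 3 : ℝ) ^ m < -x.1.2 → P x := by
    intro m
    induction m with
    | zero =>
      intro x h
      have := (mem_triangle x).2
      have := sqrt_three_mul_self
      have := sqrt_three_pos
      rw [pow_zero] at h
      nlinarith
    | succ m ih =>
      refine forall_cell fun i x h => ?_
      by_cases hi : i = 0
      · subst hi
        refine h₀ x (ih x ?_)
        rw [snd_cellMap, if_pos (by simp), pow_succ] at h
        linarith
      · exact hne i hi x
  rcases (snd_le_zero x).lt_or_eq with h | h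
  · obtain ⟨m, hm⟩ := exists_pow_lt_of_lt_one (neg_pos.2 h) (by norm_num : (2 / 3 : ℝ) < 1)
    exact key m x hm
  · rw [eq_q₁_of_snd x h]
    exact h₁

/-! ### The approximating energies -/

lemma E_comm (n : ℕ) (u v : K → ℝ) : E n u v = E n v u := by
  induction n generalizing u v with
  | zero => simp only [E]; ring
  | succ n ih => simp only [E]; exact Finset.sum_congr rfl fun i _ => by rw [ih]

lemma E_add_left (n : ℕ) (u u' v : K → ℝ) : E n (u + u') v = E n u v + E n u' v := by
  induction n generalizing u u' v with
  | zero => simp only [E, Pi.add_apply]; ring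
  | succ n ih =>
    have : ∀ i, (u + u') ∘ cellMap i = u ∘ cellMap i + u' ∘ cellMap i := fun _ => rfl
    simp only [E, this, ih, mul_add, Finset.sum_add_distrib]

lemma E_smul_left (n : ℕ) (c : ℝ) (u v : K → ℝ) : E n (c • u) v = c * E n u v := by
  induction n generalizing u v with
  | zero => simp only [E, Pi.smul_apply, smul_eq_mul]; ring
  | succ n ih =>
    have : ∀ i, (c • u) ∘ cellMap i = c • (u ∘ cellMap i) := fun _ => rfl
    simp only [E, this, ih, Finset.mul_sum]
    exact Finset.sum_congr rfl fun i _ => by ring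

lemma E_const_left (n : ℕ) (c : ℝ) (v : K → ℝ) : E n (fun _ => c) v = 0 := by
  induction n generalizing v with
  | zero => simp [E]
  | succ n ih =>
    have : ∀ i, (fun _ : K => c) ∘ cellMap i = fun _ => c := fun _ => rfl
    simp [E, this, ih]

lemma E_nonneg (n : ℕ) (u : K → ℝ) : 0 ≤ E n u u := by
  induction n generalizing u with
  | zero => exact add_nonneg (mul_self_nonneg _) (mul_self_nonneg _)
  | succ n ih => exact Finset.sum_nonneg fun i _ => mul_nonneg (by norm_num) (ih _)

lemma E_succ (n : ℕ) (u v : K → ℝ) : E (n + 1) u v =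
    2 * (E n (u ∘ cellMap 0) (v ∘ cellMap 0) + E n (u ∘ cellMap 1) (v ∘ cellMap 1) +
      E n (u ∘ cellMap 2) (v ∘ cellMap 2) + E n (u ∘ cellMap 3) (v ∘ cellMap 3)) := by
  simp only [E, Fin.sum_univ_four]
  ring

/-- The energies increase: subdivision replaces an edge of resistance `1` by two edges of resistance
`1 / 2` in series, and the other new edges only add energy. -/
lemma E_le_succ (n : ℕ) (u : K → ℝ) : E n u u ≤ E (n + 1) u u := by
  induction n generalizing u with
  | zero =>
    rw [E_succ]
    simp only [E, Function.comp, cellMap_zero_q₁, cellMap_one_q₁, cellMap_two_q₂,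
      cellMap_three_q₃, cellMap_zero_q₂, cellMap_one_q₃]
    have h2 := sq_nonneg (u q₁ - u (cellMap 2 q₁) - (u (cellMap 2 q₁) - u q₂))
    have h3 := sq_nonneg (u q₁ - u (cellMap 3 q₁) - (u (cellMap 3 q₁) - u q₃))
    have a := sq_nonneg (u q₁ - u (cellMap 0 q₃))
    have b := sq_nonneg (u q₁ - u (cellMap 1 q₂))
    have c := sq_nonneg (u (cellMap 2 q₁) - u (cellMap 2 q₃))
    have d := sq_nonneg (u (cellMap 3 q₁) - u (cellMap 3 q₂))
    nlinarith
  | succ n ih =>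
    rw [E_succ, E_succ]
    have := ih (u ∘ cellMap 0)
    have := ih (u ∘ cellMap 1)
    have := ih (u ∘ cellMap 2)
    have := ih (u ∘ cellMap 3)
    linarith

lemma E_monotone (u : K → ℝ) : Monotone fun n => E n u u :=
  monotone_nat_of_le_succ fun n => E_le_succ n u

/-- Comparison of energies edge by edge. -/
lemma E_le_of_edges (n : ℕ) (u v u' v' : K → ℝ)
    (h : ∀ w : List (Fin 4), w.length = n → ∀ x y : K,
      (u (wordMap w x) - u (wordMap w y)) * (v (wordMap w x) - v (wordMap w y)) ≤
        (u' (wordMap w x) - u' (wordMap w y)) * (v' (wordMap w x) - v' (wordMap w y))) :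
    E n u v ≤ E n u' v' := by
  induction n generalizing u v u' v' with
  | zero =>
    have := h [] rfl
    exact add_le_add (this _ _) (this _ _)
  | succ n ih =>
    refine Finset.sum_le_sum fun i _ => mul_le_mul_of_nonneg_left (ih _ _ _ _ ?_) (by norm_num)
    intro w hw x y
    exact h (i :: w) (by simp [hw]) x y

/-! ### The limiting form -/

lemma mem_domain_of_le {u : C(K, ℝ)} {M : ℝ} (h : ∀ n, E n u u ≤ M) : u ∈ domain :=
  ⟨_, tendsto_atTop_ciSup (E_monotone u) ⟨M, by rintro _ ⟨n, rfl⟩; exact h n⟩⟩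

lemma tendsto_energy_self {u : C(K, ℝ)} (hu : u ∈ domain) :
    Tendsto (fun n => E n u u) atTop (𝓝 (energy u u)) :=
  tendsto_nhds_limUnder hu

lemma E_le_energy {u : C(K, ℝ)} (hu : u ∈ domain) (n : ℕ) : E n u u ≤ energy u u :=
  (E_monotone u).ge_of_tendsto (tendsto_energy_self hu) n

lemma E_add_smul_self (n : ℕ) (c : ℝ) (u v : K → ℝ) :
    E n (u + c • v) (u + c • v) = E n u u + 2 * c * E n u v + c ^ 2 * E n v v := by
  rw [E_add_left, E_smul_left, E_comm n u, E_comm n v, E_add_left, E_add_left, E_smul_left,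
    E_smul_left, E_comm n v u]
  ring

lemma E_add_self_le (n : ℕ) (u v : K → ℝ) :
    E n (u + v) (u + v) ≤ 2 * E n u u + 2 * E n v v := by
  have h := E_nonneg n (u + (-1 : ℝ) • v)
  have h1 := E_add_smul_self n 1 u v
  rw [one_smul] at h1
  rw [E_add_smul_self] at h
  rw [h1]
  linarith

lemma add_mem_domain {u v : C(K, ℝ)} (hu : u ∈ domain) (hv : v ∈ domain) : u + v ∈ domain := by
  refine mem_domain_of_le (M := 2 * energy u u + 2 * energy v v) fun n => ?_
  refine (E_add_self_le n u v).trans ?_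
  have := E_le_energy hu n
  have := E_le_energy hv n
  linarith

lemma smul_mem_domain (c : ℝ) {u : C(K, ℝ)} (hu : u ∈ domain) : c • u ∈ domain := by
  refine mem_domain_of_le (M := c * (c * energy u u)) fun n => ?_
  rw [ContinuousMap.coe_smul, E_smul_left, E_comm, E_smul_left, ← mul_assoc, ← mul_assoc]
  exact mul_le_mul_of_nonneg_left (E_le_energy hu n) (mul_self_nonneg c)

lemma const_mem_domain (c : ℝ) : ContinuousMap.const K c ∈ domain :=
  mem_domain_of_le (M := 0) fun n => (E_const_left n c _).le

lemma sub_mem_domain {u v : C(K, ℝ)} (hu : u ∈ domain) (hv : v ∈ domain) : u - v ∈ domain := by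
  have := add_mem_domain hu (smul_mem_domain (-1) hv)
  rwa [neg_smul, one_smul, ← sub_eq_add_neg] at this

lemma tendsto_energy {u v : C(K, ℝ)} (hu : u ∈ domain) (hv : v ∈ domain) :
    Tendsto (fun n => E n u v) atTop (𝓝 (energy u v)) := by
  refine tendsto_nhds_limUnder ⟨(energy (u + v) (u + v) - energy u u - energy v v) / 2, ?_⟩
  refine ((((tendsto_energy_self (add_mem_domain hu hv)).sub (tendsto_energy_self hu)).sub
    (tendsto_energy_self hv)).div_const 2).congr fun n => ?_
  simp only [ContinuousMap.coe_add, E_add_left, E_comm n _ (⇑u + ⇑v)]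
  linarith [E_comm n u v]

lemma energy_eq_of_tendsto {u v : C(K, ℝ)} {a : ℝ} (h : Tendsto (fun n => E n u v) atTop (𝓝 a)) :
    energy u v = a := h.limUnder_eq

lemma energy_comm (u v : C(K, ℝ)) : energy u v = energy v u := by
  simp only [energy, E_comm _ u v]

lemma energy_add_left {u u' v : C(K, ℝ)} (hu : u ∈ domain) (hu' : u' ∈ domain) (hv : v ∈ domain) :
    energy (u + u') v = energy u v + energy u' v := by
  refine energy_eq_of_tendsto (((tendsto_energy hu hv).add (tendsto_energy hu' hv)).congr ?_)
  exact fun n => (E_add_left n _ _ _).symm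

lemma energy_smul_left (c : ℝ) {u v : C(K, ℝ)} (hu : u ∈ domain) (hv : v ∈ domain) :
    energy (c • u) v = c * energy u v :=
  energy_eq_of_tendsto (((tendsto_energy hu hv).const_mul c).congr
    fun n => (E_smul_left n _ _ _).symm)

lemma energy_sub_left {u u' v : C(K, ℝ)} (hu : u ∈ domain) (hu' : u' ∈ domain) (hv : v ∈ domain) :
    energy (u - u') v = energy u v - energy u' v := by
  have : u - u' = u + (-1 : ℝ) • u' := by rw [neg_smul, one_smul, ← sub_eq_add_neg]
  rw [this, energy_add_left hu (smul_mem_domain _ hu') hv, energy_smul_left _ hu' hv]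
  ring

@[simp] lemma energy_const_left (c : ℝ) (v : C(K, ℝ)) : energy (ContinuousMap.const K c) v = 0 :=
  energy_eq_of_tendsto (tendsto_const_nhds.congr fun n => (E_const_left n c v).symm)

@[simp] lemma energy_zero_left (v : C(K, ℝ)) : energy 0 v = 0 := energy_const_left 0 v

lemma zero_mem_domain : (0 : C(K, ℝ)) ∈ domain := const_mem_domain 0

lemma energy_nonneg {u : C(K, ℝ)} (hu : u ∈ domain) : 0 ≤ energy u u :=
  ge_of_tendsto' (tendsto_energy_self hu) fun n => E_nonneg n u

lemma energy_smul_self (c : ℝ) {u : C(K, ℝ)} (hu : u ∈ domain) :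
    energy (c • u) (c • u) = c ^ 2 * energy u u := by
  rw [energy_smul_left c hu (smul_mem_domain c hu), energy_comm, energy_smul_left c hu hu]
  ring

lemma energy_add_self {u v : C(K, ℝ)} (hu : u ∈ domain) (hv : v ∈ domain) :
    energy (u + v) (u + v) = energy u u + 2 * energy u v + energy v v := by
  rw [energy_add_left hu hv (add_mem_domain hu hv), energy_comm u, energy_comm v,
    energy_add_left hu hv hu, energy_add_left hu hv hv, energy_comm v u]
  ring

lemma energy_const_add (c : ℝ) {u : C(K, ℝ)} (hu : u ∈ domain) :
    energy (ContinuousMap.const K c + u) (ContinuousMap.const K c + u) = energy u u := by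
  rw [energy_add_self (const_mem_domain c) hu]; simp

/-- The Cauchy–Schwarz inequality. -/
lemma energy_sq_le {u v : C(K, ℝ)} (hu : u ∈ domain) (hv : v ∈ domain) :
    energy u v ^ 2 ≤ energy u u * energy v v := by
  have h : ∀ t : ℝ, 0 ≤ energy v v * (t * t) + 2 * energy u v * t + energy u u := by
    intro t
    have := energy_nonneg (add_mem_domain hu (smul_mem_domain t hv))
    rw [energy_add_self hu (smul_mem_domain t hv), energy_comm u (t • v), energy_smul_left t hv hu,
      energy_smul_self t hv, energy_comm v u] at this
    linarith
  have := discrim_le_zero h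
  rw [discrim] at this
  linarith

/-! ### Self-similarity -/

lemma comp_mem_domain {u : C(K, ℝ)} (hu : u ∈ domain) (i : Fin 4) : u.comp (cell i) ∈ domain := by
  refine mem_domain_of_le (M := energy u u) fun n => ?_
  have h : (1 / 2 : ℝ)⁻¹ * E n (u ∘ cellMap i) (u ∘ cellMap i) ≤ E (n + 1) u u :=
    Finset.single_le_sum (f := fun i => (1 / 2 : ℝ)⁻¹ * E n (u ∘ cellMap i) (u ∘ cellMap i))
      (fun j _ => mul_nonneg (by norm_num) (E_nonneg _ _)) (Finset.mem_univ i)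
  have := E_le_energy hu (n + 1)
  have := E_nonneg n (u ∘ cellMap i)
  change E n (u ∘ cellMap i) (u ∘ cellMap i) ≤ _
  norm_num at h
  linarith

lemma mem_domain_of_comp {u : C(K, ℝ)} (h : ∀ i, u.comp (cell i) ∈ domain) : u ∈ domain := by
  refine mem_domain_of_le
    (M := ∑ i, (1 / 2 : ℝ)⁻¹ * energy (u.comp (cell i)) (u.comp (cell i))) fun n => ?_
  refine (E_le_succ n u).trans ?_
  exact Finset.sum_le_sum fun i _ =>
    mul_le_mul_of_nonneg_left (E_le_energy (h i) n) (by norm_num)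

lemma energy_eq_cells {u v : C(K, ℝ)} (hu : u ∈ domain) (hv : v ∈ domain) :
    energy u v = 2 * (energy (u.comp (cell 0)) (v.comp (cell 0)) +
      energy (u.comp (cell 1)) (v.comp (cell 1)) + energy (u.comp (cell 2)) (v.comp (cell 2)) +
      energy (u.comp (cell 3)) (v.comp (cell 3))) := by
  have h := fun i => tendsto_energy (comp_mem_domain hu i) (comp_mem_domain hv i)
  refine tendsto_nhds_unique ((tendsto_energy hu hv).comp (tendsto_add_atTop_nat 1)) ?_
  exact (((((h 0).add (h 1)).add (h 2)).add (h 3)).const_mul 2).congr fun n =>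
    (E_succ n _ _).symm

lemma sq_sub_q₂_le {u : C(K, ℝ)} (hu : u ∈ domain) : (u q₁ - u q₂) ^ 2 ≤ energy u u := by
  have h : E 0 u u ≤ energy u u := E_le_energy hu 0
  simp only [E] at h
  nlinarith [sq_nonneg (u q₁ - u q₃)]

lemma sq_sub_q₃_le {u : C(K, ℝ)} (hu : u ∈ domain) : (u q₁ - u q₃) ^ 2 ≤ energy u u := by
  have h : E 0 u u ≤ energy u u := E_le_energy hu 0
  simp only [E] at h
  nlinarith [sq_nonneg (u q₁ - u q₂)]

/-- Splitting an increment over two cells in series. -/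
lemma sq_le_series {a b c r s e f : ℝ} (h₁ : (a - b) ^ 2 ≤ r * e) (h₂ : (b - c) ^ 2 ≤ s * f)
    (hr : 0 ≤ r) (hs : 0 ≤ s) (he : 0 ≤ e) (hf : 0 ≤ f) :
    (a - c) ^ 2 ≤ (r + s) * (e + f) := by
  have h : ((a - b) * (b - c)) ^ 2 ≤ ((r * f + s * e) / 2) ^ 2 := by
    rw [mul_pow]
    calc (a - b) ^ 2 * (b - c) ^ 2 ≤ (r * e) * (s * f) := by gcongr
      _ ≤ _ := by nlinarith [sq_nonneg (r * f - s * e)]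
  have := abs_le_of_sq_le_sq' h (by positivity)
  nlinarith

lemma wordMap_dist_le (w : List (Fin 4)) (x y : K) :
    dist (wordMap w x) (wordMap w y) ≤ (3 / 4) ^ w.length * dist x y := by
  induction w with
  | nil => simp [wordMap]
  | cons i w ih =>
    refine (cellMap_dist_le i _ _).trans ?_
    rw [List.length_cons, pow_succ]
    linarith

lemma exists_word (n : ℕ) (x : K) : ∃ w : List (Fin 4), w.length = n ∧ ∃ y, wordMap w y = x := by
  induction n generalizing x with
  | zero => exact ⟨[], rfl, x, rfl⟩
  | succ n ih =>
    obtain ⟨i, y, rfl⟩ := exists_cell x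
    obtain ⟨w, hw, z, rfl⟩ := ih y
    exact ⟨i :: w, by simp [hw], z, rfl⟩

lemma dist_le_diam (x y : K) : dist x y ≤ 2 := by
  have hx := abs_le.1 (fst_le_one x)
  have hy := abs_le.1 (fst_le_one y)
  have := (mem_triangle x).2
  have := (mem_triangle y).2
  have := snd_le_zero x
  have := snd_le_zero y
  have := sqrt_three_mul_self
  have := sqrt_three_pos
  change dist x.1 y.1 ≤ 2
  rw [Prod.dist_eq, Real.dist_eq, Real.dist_eq]
  refine max_le ?_ ?_ <;> rw [abs_le] <;> constructor <;> nlinarith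

lemma energy_cells_nonneg {u : C(K, ℝ)} (hu : u ∈ domain) (i : Fin 4) :
    0 ≤ energy (u.comp (cell i)) (u.comp (cell i)) := energy_nonneg (comp_mem_domain hu i)

/-- The bound at the vertices `F_w(q₁)`, which are dense. -/
lemma sq_sub_wordMap_le (w : List (Fin 4)) {u : C(K, ℝ)} (hu : u ∈ domain) :
    (u q₁ - u (wordMap w q₁)) ^ 2 ≤ energy u u := by
  induction w generalizing u with
  | nil => simpa [wordMap] using energy_nonneg hu
  | cons i w ih =>
    have h := ih (comp_mem_domain hu i)
    have e := energy_eq_cells hu hu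
    have n0 := energy_cells_nonneg hu 0
    have n1 := energy_cells_nonneg hu 1
    have n2 := energy_cells_nonneg hu 2
    have n3 := energy_cells_nonneg hu 3
    change (u (cellMap i q₁) - u (wordMap (i :: w) q₁)) ^ 2 ≤ _ at h
    rw [← one_mul (energy _ _)] at h
    rcases eq_zero_or_one_or i with (rfl | rfl) | (rfl | rfl)
    · rw [cellMap_zero_q₁] at h; linarith
    · rw [cellMap_one_q₁] at h; linarith
    · have k := sq_sub_q₂_le (comp_mem_domain hu 0)
      change (u (cellMap 0 q₁) - u (cellMap 0 q₂)) ^ 2 ≤ _ at k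
      rw [cellMap_zero_q₁, cellMap_zero_q₂, ← one_mul (energy _ _)] at k
      have := sq_le_series k h (by simp) (by simp) n0 n2
      linarith
    · have k := sq_sub_q₃_le (comp_mem_domain hu 1)
      change (u (cellMap 1 q₁) - u (cellMap 1 q₃)) ^ 2 ≤ _ at k
      rw [cellMap_one_q₁, cellMap_one_q₃, ← one_mul (energy _ _)] at k
      have := sq_le_series k h (by simp) (by simp) n1 n3
      linarith

/-- The resistance between `q₁` and any other point is at most `1`. -/
lemma sq_sub_q₁_le {u : C(K, ℝ)} (hu : u ∈ domain) (x : K) :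
    (u q₁ - u x) ^ 2 ≤ energy u u := by
  choose w hw y hy using fun n => exists_word n x
  have h : Tendsto (fun n => wordMap (w n) q₁) atTop (𝓝 x) := by
    have h0 : Tendsto (fun n : ℕ => (3 / 4 : ℝ) ^ n * 2) atTop (𝓝 0) := by
      simpa using (tendsto_pow_atTop_nhds_zero_of_lt_one (r := (3 / 4 : ℝ)) (by norm_num)
        (by norm_num)).mul_const 2
    refine tendsto_iff_dist_tendsto_zero.2 (squeeze_zero (fun _ => dist_nonneg) (fun n => ?_) h0)
    calc dist (wordMap (w n) q₁) x = dist (wordMap (w n) q₁) (wordMap (w n) (y n)) := by rw [hy]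
      _ ≤ (3 / 4) ^ (w n).length * dist q₁ (y n) := wordMap_dist_le _ _ _
      _ ≤ (3 / 4) ^ n * 2 := by rw [hw]; gcongr; exact dist_le_diam _ _
  refine le_of_tendsto' ((((u.continuous.tendsto x).comp h).const_sub (u q₁)).pow 2) fun n => ?_
  exact sq_sub_wordMap_le (w n) hu

/-! ### Harmonic functions -/

lemma mem_domainIn_of_tsupport (μ : Measure K) {U : Set K} {φ : C(K, ℝ)} (hφ : φ ∈ domain)
    (h : tsupport φ ⊆ U) : φ ∈ domainIn μ U :=
  ⟨hφ, fun δ hδ => ⟨φ, hφ, h, by simpa⟩⟩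

/-- Harmonicity may be tested on functions vanishing off the set. -/
lemma harmonic_of_forall (μ : Measure K) {U : Set K} {u : C(K, ℝ)} (hu : u ∈ domain)
    (h : ∀ v ∈ domain, (∀ x ∉ U, v x = 0) → energy u v = 0) : Harmonic μ U u := by
  refine ⟨hu, fun φ hφ => ?_⟩
  have key : ∀ δ > 0, energy u φ ^ 2 ≤ energy u u * δ := by
    intro δ hδ
    obtain ⟨ψ, hψ, hs, hlt⟩ := hφ.2 δ hδ
    have h0 : energy u ψ = 0 := h ψ hψ fun x hx => by
      by_contra hne
      exact hx (hs (subset_tsupport _ hne))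
    have e : energy u φ = energy u (φ - ψ) := by
      rw [energy_comm u (φ - ψ), energy_sub_left hφ.1 hψ hu, energy_comm ψ, h0, sub_zero,
        energy_comm]
    rw [e]
    refine (energy_sq_le hu (sub_mem_domain hφ.1 hψ)).trans ?_
    have : 0 ≤ ∫ x, (φ x - ψ x) ^ 2 ∂μ := integral_nonneg fun x => sq_nonneg _
    exact mul_le_mul_of_nonneg_left (by linarith) (energy_nonneg hu)
  by_contra hne
  have hpos : 0 < energy u φ ^ 2 := by positivity
  have hE : 0 < energy u u := by
    have := key 1 one_pos
    linarith
  have := key (energy u φ ^ 2 / (2 * energy u u)) (by positivity)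
  have e : energy u u * (energy u φ ^ 2 / (2 * energy u u)) = energy u φ ^ 2 / 2 := by field_simp
  linarith

/-- The part of `t` exceeding the threshold `δ` in absolute value. -/
def softThreshold (δ t : ℝ) : ℝ := t - max (-δ) (min δ t)

lemma softThreshold_of_le {δ t : ℝ} (h : |t| ≤ δ) : softThreshold δ t = 0 := by
  rw [abs_le] at h
  rw [softThreshold, min_eq_right h.2, max_eq_right h.1, sub_self]

lemma softThreshold_contraction {δ : ℝ} (s t : ℝ) :
    (softThreshold δ s - softThreshold δ t) * (softThreshold δ s - softThreshold δ t) ≤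
      (s - t) * (softThreshold δ s - softThreshold δ t) := by
  have mono : ∀ {s t : ℝ}, s ≤ t → 0 ≤ softThreshold δ t - softThreshold δ s ∧
      softThreshold δ t - softThreshold δ s ≤ t - s := by
    intro s t h
    have a : max (-δ) (min δ s) ≤ max (-δ) (min δ t) := by gcongr
    have b : max (-δ) (min δ t) ≤ max (-δ) (min δ s) + (t - s) := by
      refine max_le (by linarith [le_max_left (-δ) (min δ s)]) ?_
      rcases le_total δ s with k | k
      · rw [min_eq_left k, min_eq_left (k.trans h)]; linarith [le_max_right (-δ) δ]
      · rw [min_eq_right k]; linarith [le_max_right (-δ) s, min_le_right δ t]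
    unfold softThreshold
    constructor <;> linarith
  rcases le_total s t with h | h
  · obtain ⟨a, b⟩ := mono h
    nlinarith
  · obtain ⟨a, b⟩ := mono h
    nlinarith

/-- Uniqueness in the Dirichlet problem on a proper open set. The difference `d`, cut off at a small
level `δ`, is an admissible test function; by locality its energy is at most its pairing with `d`,
which vanishes. -/
theorem eqOn_of_harmonic (μ : Measure K) {B : Set K} (hB : IsOpen B) (hne : Bᶜ.Nonempty)
    {u v : C(K, ℝ)} (hu : Harmonic μ B u) (hv : Harmonic μ B v) (h : EqOn u v (frontier B)) :
    EqOn u v B := by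
  classical
  have : CompactSpace K := isCompact_iff_compactSpace.1 treeSet_compact
  have hd : u - v ∈ domain := sub_mem_domain hu.1 hv.1
  set d := u - v with hdef
  have hd0 : ∀ x ∈ frontier B, d x = 0 := fun x hx => by simp [hdef, h hx]
  have key : ∀ δ > 0, ∀ x ∈ B, |d x| ≤ δ := by
    intro δ hδ
    have hsc : Continuous fun x => softThreshold δ (d x) := by unfold softThreshold; fun_prop
    let f : C(K, ℝ) := ⟨B.piecewise (fun x => softThreshold δ (d x)) (fun _ => 0),
      Continuous.piecewise (fun a ha => by
        rw [hd0 a ha]; exact softThreshold_of_le (by simpa using hδ.le)) hsc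
        continuous_const⟩
    have fB : ∀ x ∈ B, f x = softThreshold δ (d x) := fun x hx =>
      piecewise_eq_of_mem B (fun x => softThreshold δ (d x)) (fun _ => 0) hx
    have fB' : ∀ x ∉ B, f x = 0 := fun x hx =>
      piecewise_eq_of_notMem B (fun x => softThreshold δ (d x)) (fun _ => 0) hx
    have hsupp : tsupport f ⊆ B := by
      have hc : IsClosed (closure B ∩ {x | δ ≤ |d x|}) :=
        isClosed_closure.inter (isClosed_le continuous_const (by fun_prop))
      have h1 : tsupport f ⊆ closure B ∩ {x | δ ≤ |d x|} := by
        refine closure_minimal (fun x hx => ?_) hc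
        have hxB : x ∈ B := by
          by_contra hxB
          exact hx (fB' x hxB)
        refine ⟨subset_closure hxB, ?_⟩
        by_contra hlt
        rw [mem_ofPred_eq, not_le] at hlt
        exact hx ((fB x hxB).trans (softThreshold_of_le hlt.le))
      intro x hx
      by_contra hxB
      obtain ⟨hx1, hx2⟩ := h1 hx
      have hfr : x ∈ frontier B := ⟨hx1, by rwa [hB.interior_eq]⟩
      rw [mem_ofPred_eq, hd0 x hfr, abs_zero] at hx2
      linarith
    obtain ⟨η, hη, hth⟩ := (isClosed_tsupport f).isCompact.exists_thickening_subset_open hB hsupp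
    obtain ⟨N, hN⟩ := exists_pow_lt_of_lt_one (half_pos hη) (by norm_num : (3 / 4 : ℝ) < 1)
    -- for `n ≥ N` no edge of level `n` joins the support of `f` to the complement of `B`
    have hEle : ∀ n, N ≤ n → E n f f ≤ E n d f := by
      intro n hn
      refine E_le_of_edges n _ _ _ _ fun w hw x y => ?_
      have hdist : dist (wordMap w x) (wordMap w y) < η := by
        calc _ ≤ (3 / 4) ^ w.length * dist x y := wordMap_dist_le w x y
          _ ≤ (3 / 4) ^ N * 2 := by
            rw [hw]
            gcongr (?_ * ?_)
            · exact pow_le_pow_of_le_one (by norm_num) (by norm_num) hn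
            · exact dist_le_diam x y
          _ < η := by linarith
      generalize wordMap w x = x at hdist
      generalize wordMap w y = y at hdist
      have aux : ∀ x y : K, dist x y < η → f x ≠ 0 → x ∈ B ∧ y ∈ B := by
        intro x y hxy hx
        have hx' : x ∈ tsupport f := subset_tsupport _ hx
        refine ⟨hsupp hx', hth (Metric.mem_thickening_iff.2 ⟨x, hx', ?_⟩)⟩
        rwa [dist_comm]
      by_cases hxy : f x = 0 ∧ f y = 0
      · simp [hxy.1, hxy.2]
      · have hxB : x ∈ B ∧ y ∈ B := by
          by_cases hx : f x = 0
          · exact (aux y x (by rwa [dist_comm]) fun hy => hxy ⟨hx, hy⟩).symm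
          · exact aux x y hdist hx
        rw [fB x hxB.1, fB y hxB.2]
        exact softThreshold_contraction _ _
    have hEd : ∀ n, N ≤ n → E n f f ≤ E n d d := by
      intro n hn
      have h1 := hEle n hn
      have h2 := E_nonneg n (d + (-1 : ℝ) • f)
      rw [E_add_smul_self] at h2
      linarith
    have hf : f ∈ domain := by
      refine mem_domain_of_le (M := energy d d) fun n => ?_
      calc E n f f ≤ E (max n N) f f := E_monotone _ (le_max_left _ _)
        _ ≤ E (max n N) d d := hEd _ (le_max_right _ _)
        _ ≤ energy d d := E_le_energy hd _
    have hfe : energy f f ≤ 0 := by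
      have e0 : energy d f = 0 := by
        rw [hdef, energy_sub_left hu.1 hv.1 hf,
          hu.2 f (mem_domainIn_of_tsupport μ hf hsupp),
          hv.2 f (mem_domainIn_of_tsupport μ hf hsupp), sub_zero]
      rw [← e0]
      refine le_of_tendsto_of_tendsto (tendsto_energy_self hf) (tendsto_energy hd hf) ?_
      filter_upwards [eventually_ge_atTop N] with n hn using hEle n hn
    have hconst : ∀ x, f x = f q₁ := fun x => by
      have := sq_sub_q₁_le hf x
      have : (f q₁ - f x) ^ 2 = 0 := le_antisymm (by linarith) (sq_nonneg _)
      have := pow_eq_zero_iff (two_ne_zero) |>.1 this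
      linarith
    obtain ⟨z, hz⟩ := hne
    intro x hx
    have h0 : softThreshold δ (d x) = 0 := by
      rw [← fB x hx, hconst x, ← hconst z, fB' z hz]
    have : d x = max (-δ) (min δ (d x)) := by unfold softThreshold at h0; linarith
    rw [this, abs_le]
    exact ⟨le_max_left _ _, max_le (by linarith) (min_le_left _ _)⟩
  intro x hx
  have : |d x| ≤ 0 := le_of_forall_pos_le_add fun δ hδ => by simpa using key δ hδ x hx
  have : d x = 0 := abs_nonpos_iff.1 this
  rw [hdef, ContinuousMap.sub_apply] at this
  linarith

/-! ### Energies of glued functions -/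

/-- The values of four functions on the cells agree at the three junctions. -/
def Matches (f₀ f₁ f₂ f₃ : C(K, ℝ)) : Prop := f₀ q₁ = f₁ q₁ ∧ f₀ q₂ = f₂ q₁ ∧ f₁ q₃ = f₃ q₁

section Glue

variable {f₀ f₁ f₂ f₃ : C(K, ℝ)} (h : Matches f₀ f₁ f₂ f₃)

include h

lemma glue_zero (x : K) : glue f₀ f₁ f₂ f₃ (cellMap 0 x) = f₀ x := glue_apply h.1 h.2.1 h.2.2 0 x

lemma glue_one (x : K) : glue f₀ f₁ f₂ f₃ (cellMap 1 x) = f₁ x := glue_apply h.1 h.2.1 h.2.2 1 x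

lemma glue_two (x : K) : glue f₀ f₁ f₂ f₃ (cellMap 2 x) = f₂ x := glue_apply h.1 h.2.1 h.2.2 2 x

lemma glue_three (x : K) : glue f₀ f₁ f₂ f₃ (cellMap 3 x) = f₃ x := glue_apply h.1 h.2.1 h.2.2 3 x

lemma glue_q₁ : glue f₀ f₁ f₂ f₃ q₁ = f₀ q₁ := by
  simpa using glue_zero h q₁

lemma glue_q₂ : glue f₀ f₁ f₂ f₃ q₂ = f₂ q₂ := by
  simpa using glue_two h q₂

lemma glue_q₃ : glue f₀ f₁ f₂ f₃ q₃ = f₃ q₃ := by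
  simpa using glue_three h q₃

lemma glue_comp_zero : (glue f₀ f₁ f₂ f₃).comp (cell 0) = f₀ := ContinuousMap.ext (glue_zero h)

lemma glue_comp_one : (glue f₀ f₁ f₂ f₃).comp (cell 1) = f₁ := ContinuousMap.ext (glue_one h)

lemma glue_comp_two : (glue f₀ f₁ f₂ f₃).comp (cell 2) = f₂ := ContinuousMap.ext (glue_two h)

lemma glue_comp_three : (glue f₀ f₁ f₂ f₃).comp (cell 3) = f₃ := ContinuousMap.ext (glue_three h)

lemma glue_mem_domain (h₀ : f₀ ∈ domain) (h₁ : f₁ ∈ domain) (h₂ : f₂ ∈ domain)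
    (h₃ : f₃ ∈ domain) : glue f₀ f₁ f₂ f₃ ∈ domain := by
  refine mem_domain_of_comp fun i => ?_
  fin_cases i
  · exact mem_of_eq_of_mem (glue_comp_zero h) h₀
  · exact mem_of_eq_of_mem (glue_comp_one h) h₁
  · exact mem_of_eq_of_mem (glue_comp_two h) h₂
  · exact mem_of_eq_of_mem (glue_comp_three h) h₃

lemma energy_glue_left (h₀ : f₀ ∈ domain) (h₁ : f₁ ∈ domain) (h₂ : f₂ ∈ domain)
    (h₃ : f₃ ∈ domain) {v : C(K, ℝ)} (hv : v ∈ domain) :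
    energy (glue f₀ f₁ f₂ f₃) v = 2 * (energy f₀ (v.comp (cell 0)) + energy f₁ (v.comp (cell 1)) +
      energy f₂ (v.comp (cell 2)) + energy f₃ (v.comp (cell 3))) := by
  rw [energy_eq_cells (glue_mem_domain h h₀ h₁ h₂ h₃) hv, glue_comp_zero h, glue_comp_one h,
    glue_comp_two h, glue_comp_three h]

lemma energy_glue_self (h₀ : f₀ ∈ domain) (h₁ : f₁ ∈ domain) (h₂ : f₂ ∈ domain)
    (h₃ : f₃ ∈ domain) : energy (glue f₀ f₁ f₂ f₃) (glue f₀ f₁ f₂ f₃) =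
      2 * (energy f₀ f₀ + energy f₁ f₁ + energy f₂ f₂ + energy f₃ f₃) := by
  rw [energy_glue_left h h₀ h₁ h₂ h₃ (glue_mem_domain h h₀ h₁ h₂ h₃), glue_comp_zero h,
    glue_comp_one h, glue_comp_two h, glue_comp_three h]

end Glue

/-- The function `c + t u`. -/
def affine (c t : ℝ) (u : C(K, ℝ)) : C(K, ℝ) := ContinuousMap.const K c + t • u

@[simp] lemma affine_apply (c t : ℝ) (u : C(K, ℝ)) (x : K) : affine c t u x = c + t * u x := rfl

lemma affine_mem_domain (c t : ℝ) {u : C(K, ℝ)} (hu : u ∈ domain) : affine c t u ∈ domain :=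
  add_mem_domain (const_mem_domain c) (smul_mem_domain t hu)

lemma energy_affine_left (c t : ℝ) {u v : C(K, ℝ)} (hu : u ∈ domain) (hv : v ∈ domain) :
    energy (affine c t u) v = t * energy u v := by
  rw [affine, energy_add_left (const_mem_domain c) (smul_mem_domain t hu) hv, energy_const_left,
    energy_smul_left t hu hv, zero_add]

lemma energy_affine_self (c t : ℝ) {u : C(K, ℝ)} (hu : u ∈ domain) :
    energy (affine c t u) (affine c t u) = t ^ 2 * energy u u := by
  rw [affine, energy_const_add c (smul_mem_domain t hu), energy_smul_self t hu]

@[simp] lemma energy_one_left (v : C(K, ℝ)) : energy 1 v = 0 := energy_const_left 1 v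

/-! ### The potential along the left and right edge -/

lemma exists_leftPotential : ∃ f : C(K, ℝ), f q₁ = 0 ∧ f q₂ = 1 ∧ f q₃ = 0 ∧
    (∀ x, 0 ≤ f x ∧ f x ≤ 1) ∧
    ∀ i x, f (cellMap i x) = (![1 / 2, 0, 1 / 2, 0] : Fin 4 → ℝ) i * f x +
      (![0, 0, ContinuousMap.const K (1 / 2), 0] : Fin 4 → C(K, ℝ)) i x := by
  refine exists_selfSimilar _ _ _ _ _ (fun i => ?_) (fun i x t h0 h1 => ?_) (by simp) (by simp)
    (by simp) (by simp) (by simp) ?_ (by simp) ?_ (by simp)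
  · fin_cases i <;> norm_num [abs_le]
  · fin_cases i <;> simp <;> constructor <;> linarith
  · change (1 / 2 * 1 + 1 / 2 : ℝ) = 1
    norm_num
  · change (1 / 2 * 1 + 0 : ℝ) = 1 / 2 * 0 + 1 / 2
    norm_num

lemma exists_rightPotential : ∃ f : C(K, ℝ), f q₁ = 0 ∧ f q₂ = 0 ∧ f q₃ = 1 ∧
    (∀ x, 0 ≤ f x ∧ f x ≤ 1) ∧
    ∀ i x, f (cellMap i x) = (![0, 1 / 2, 0, 1 / 2] : Fin 4 → ℝ) i * f x +
      (![0, 0, 0, ContinuousMap.const K (1 / 2)] : Fin 4 → C(K, ℝ)) i x := by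
  refine exists_selfSimilar _ _ _ _ _ (fun i => ?_) (fun i x t h0 h1 => ?_) (by simp) (by simp)
    (by simp) (by simp) (by simp) (by simp) ?_ (by simp) ?_
  · fin_cases i <;> norm_num [abs_le]
  · fin_cases i <;> simp <;> constructor <;> linarith
  · change (1 / 2 * 1 + 1 / 2 : ℝ) = 1
    norm_num
  · change (1 / 2 * 1 + 0 : ℝ) = 1 / 2 * 0 + 1 / 2
    norm_num

/-- The harmonic function with values `0, 1, 0` at `q₁, q₂, q₃`. -/
def g₂ : C(K, ℝ) := exists_leftPotential.choose

/-- The harmonic function with values `0, 0, 1` at `q₁, q₂, q₃`. -/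
def g₃ : C(K, ℝ) := exists_rightPotential.choose

@[simp] lemma g₂_q₁ : g₂ q₁ = 0 := exists_leftPotential.choose_spec.1

@[simp] lemma g₂_q₂ : g₂ q₂ = 1 := exists_leftPotential.choose_spec.2.1

@[simp] lemma g₂_q₃ : g₂ q₃ = 0 := exists_leftPotential.choose_spec.2.2.1

lemma g₂_mem (x : K) : 0 ≤ g₂ x ∧ g₂ x ≤ 1 := exists_leftPotential.choose_spec.2.2.2.1 x

@[simp] lemma g₂_zero (x : K) : g₂ (cellMap 0 x) = g₂ x / 2 := by
  have := exists_leftPotential.choose_spec.2.2.2.2 0 x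
  change g₂ _ = 1 / 2 * g₂ x + 0 at this
  linarith

@[simp] lemma g₂_one (x : K) : g₂ (cellMap 1 x) = 0 := by
  have := exists_leftPotential.choose_spec.2.2.2.2 1 x
  change g₂ _ = 0 * g₂ x + 0 at this
  linarith

@[simp] lemma g₂_two (x : K) : g₂ (cellMap 2 x) = 1 / 2 + g₂ x / 2 := by
  have := exists_leftPotential.choose_spec.2.2.2.2 2 x
  change g₂ _ = 1 / 2 * g₂ x + 1 / 2 at this
  linarith

@[simp] lemma g₂_three (x : K) : g₂ (cellMap 3 x) = 0 := by
  have := exists_leftPotential.choose_spec.2.2.2.2 3 x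
  change g₂ _ = 0 * g₂ x + 0 at this
  linarith

@[simp] lemma g₃_q₁ : g₃ q₁ = 0 := exists_rightPotential.choose_spec.1

@[simp] lemma g₃_q₂ : g₃ q₂ = 0 := exists_rightPotential.choose_spec.2.1

@[simp] lemma g₃_q₃ : g₃ q₃ = 1 := exists_rightPotential.choose_spec.2.2.1

lemma g₃_mem (x : K) : 0 ≤ g₃ x ∧ g₃ x ≤ 1 := exists_rightPotential.choose_spec.2.2.2.1 x

lemma g₃_zero (x : K) : g₃ (cellMap 0 x) = 0 := by
  have := exists_rightPotential.choose_spec.2.2.2.2 0 x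
  change g₃ _ = 0 * g₃ x + 0 at this
  linarith

lemma g₃_one (x : K) : g₃ (cellMap 1 x) = g₃ x / 2 := by
  have := exists_rightPotential.choose_spec.2.2.2.2 1 x
  change g₃ _ = 1 / 2 * g₃ x + 0 at this
  linarith

lemma g₃_two (x : K) : g₃ (cellMap 2 x) = 0 := by
  have := exists_rightPotential.choose_spec.2.2.2.2 2 x
  change g₃ _ = 0 * g₃ x + 0 at this
  linarith

lemma g₃_three (x : K) : g₃ (cellMap 3 x) = 1 / 2 + g₃ x / 2 := by
  have := exists_rightPotential.choose_spec.2.2.2.2 3 x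
  change g₃ _ = 1 / 2 * g₃ x + 1 / 2 at this
  linarith

lemma E_g₂ (n : ℕ) (v : K → ℝ) : E n g₂ v = v q₂ - v q₁ := by
  induction n generalizing v with
  | zero => simp [E]
  | succ n ih =>
    have e0 : g₂ ∘ cellMap 0 = (1 / 2 : ℝ) • g₂ := by ext x; simp; ring
    have e1 : g₂ ∘ cellMap 1 = fun _ => 0 := by ext x; simp
    have e2 : g₂ ∘ cellMap 2 = (fun _ : K => (1 / 2 : ℝ)) + (1 / 2 : ℝ) • ⇑g₂ := by ext x; simp; ring
    have e3 : g₂ ∘ cellMap 3 = fun _ => 0 := by ext x; simp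
    rw [E_succ, e0, e1, e2, e3, E_add_left, E_smul_left, E_smul_left, E_const_left, E_const_left,
      E_const_left, ih, ih]
    simp only [Function.comp, cellMap_zero_q₁, cellMap_zero_q₂, cellMap_two_q₂]
    ring

lemma E_g₃ (n : ℕ) (v : K → ℝ) : E n g₃ v = v q₃ - v q₁ := by
  induction n generalizing v with
  | zero => simp [E]
  | succ n ih =>
    have e0 : g₃ ∘ cellMap 0 = fun _ => 0 := by ext x; simp [g₃_zero]
    have e1 : g₃ ∘ cellMap 1 = (1 / 2 : ℝ) • g₃ := by ext x; simp [g₃_one]; ring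
    have e2 : g₃ ∘ cellMap 2 = fun _ => 0 := by ext x; simp [g₃_two]
    have e3 : g₃ ∘ cellMap 3 = (fun _ : K => (1 / 2 : ℝ)) + (1 / 2 : ℝ) • ⇑g₃ := by
      ext x; simp [g₃_three]; ring
    rw [E_succ, e0, e1, e2, e3, E_add_left, E_smul_left, E_smul_left, E_const_left, E_const_left,
      E_const_left, ih, ih]
    simp only [Function.comp, cellMap_one_q₁, cellMap_one_q₃, cellMap_three_q₃]
    ring

lemma g₂_mem_domain : g₂ ∈ domain :=
  mem_domain_of_le (M := 1) fun n => by simp [E_g₂]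

lemma g₃_mem_domain : g₃ ∈ domain :=
  mem_domain_of_le (M := 1) fun n => by simp [E_g₃]

lemma energy_g₂ (v : C(K, ℝ)) : energy g₂ v = v q₂ - v q₁ :=
  energy_eq_of_tendsto (tendsto_const_nhds.congr fun n => (E_g₂ n v).symm)

lemma energy_g₃ (v : C(K, ℝ)) : energy g₃ v = v q₃ - v q₁ :=
  energy_eq_of_tendsto (tendsto_const_nhds.congr fun n => (E_g₃ n v).symm)

/-! ### The resistance metric -/

/-- The effective resistance as a real number: the best constant `r` in
`(u(x) - u(y))² ≤ r 𝓔(u)`. -/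
def res (x y : K) : ℝ := sInf {r | 0 ≤ r ∧ ∀ u ∈ domain, (u x - u y) ^ 2 ≤ r * energy u u}

lemma res_bddBelow (x y : K) :
    BddBelow {r | 0 ≤ r ∧ ∀ u ∈ domain, (u x - u y) ^ 2 ≤ r * energy u u} :=
  ⟨0, fun _ h => h.1⟩

lemma res_set_nonempty (x y : K) :
    {r | 0 ≤ r ∧ ∀ u ∈ domain, (u x - u y) ^ 2 ≤ r * energy u u}.Nonempty := by
  refine ⟨4, by norm_num, fun u hu => ?_⟩
  have h1 := sq_sub_q₁_le hu x
  have h2 := sq_sub_q₁_le hu y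
  nlinarith [sq_nonneg (u q₁ - u x + (u q₁ - u y))]

lemma res_le {x y : K} {r : ℝ} (hr : 0 ≤ r)
    (h : ∀ u ∈ domain, (u x - u y) ^ 2 ≤ r * energy u u) : res x y ≤ r :=
  csInf_le (res_bddBelow x y) ⟨hr, h⟩

lemma res_nonneg (x y : K) : 0 ≤ res x y := le_csInf (res_set_nonempty x y) fun _ h => h.1

lemma sq_sub_le_res (x y : K) {u : C(K, ℝ)} (hu : u ∈ domain) :
    (u x - u y) ^ 2 ≤ res x y * energy u u := by
  rcases (energy_nonneg hu).eq_or_lt with h | h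
  · obtain ⟨r, -, hr⟩ := res_set_nonempty x y
    have := hr u hu
    rw [← h, mul_zero] at this ⊢
    exact this
  · rw [← div_le_iff₀ h]
    exact le_csInf (res_set_nonempty x y) fun r hr => (div_le_iff₀ h).2 (hr.2 u hu)

lemma res_comm (x y : K) : res x y = res y x := by
  have : ∀ x y, res x y ≤ res y x := fun x y => res_le (res_nonneg _ _) fun u hu => by
    have := sq_sub_le_res y x hu
    linarith [sub_sq_comm (u x) (u y)]
  exact le_antisymm (this x y) (this y x)

lemma res_self (x : K) : res x x = 0 :=
  le_antisymm (res_le le_rfl fun u _ => by simp) (res_nonneg x x)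

lemma resist_eq (x y : K) : resist x y = ENNReal.ofReal (res x y) := by
  refine le_antisymm (ENNReal.inv_le_iff_inv_le.1 (le_iInf₂ fun u hu => ?_))
    (ENNReal.le_inv_iff_le_inv.2 ?_)
  · have h := sq_sub_le_res x y hu.1
    rw [hu.2.1, hu.2.2] at h
    have hpos : 0 < res x y := by
      rcases (res_nonneg x y).eq_or_lt with h0 | h0
      · rw [← h0] at h; norm_num at h
      · exact h0
    rw [← ENNReal.ofReal_inv_of_pos hpos]
    refine ENNReal.ofReal_le_ofReal ?_
    rw [inv_le_iff_one_le_mul₀ hpos]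
    linarith
  · rcases (res_nonneg x y).eq_or_lt with h0 | h0
    · simp [← h0]
    · rw [← ENNReal.ofReal_inv_of_pos h0]
      by_contra! hlt
      obtain ⟨t, ht1, ht2⟩ := ENNReal.lt_iff_exists_nnreal_btwn.1 hlt
      have ht : (res x y)⁻¹ < t := by
        rw [← ENNReal.ofReal_coe_nnreal] at ht1
        exact (ENNReal.ofReal_lt_ofReal_iff_of_nonneg (by positivity)).1 ht1
      have htpos : (0 : ℝ) < t := lt_trans (by positivity) ht
      have key : ∀ v ∈ domain, v x = 0 → v y = 1 → (t : ℝ) ≤ energy v v := by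
        intro v hv h1 h2
        have : (t : ℝ≥0∞) ≤ ENNReal.ofReal (energy v v) :=
          ht2.le.trans (iInf₂_le v ⟨hv, h1, h2⟩)
        rw [← ENNReal.ofReal_coe_nnreal] at this
        exact (ENNReal.ofReal_le_ofReal_iff (energy_nonneg hv)).1 this
      have hle : res x y ≤ (t : ℝ)⁻¹ := by
        refine res_le (by positivity) fun u hu => ?_
        rw [inv_mul_eq_div, le_div_iff₀ htpos]
        by_cases hxy : u x = u y
        · simpa [hxy] using energy_nonneg hu
        · have hne : u y - u x ≠ 0 := sub_ne_zero.2 (Ne.symm hxy)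
          have := key (affine (-u x / (u y - u x)) (u y - u x)⁻¹ u) (affine_mem_domain _ _ hu)
            (by simp; field_simp; ring) (by simp; field_simp; ring)
          rw [energy_affine_self _ _ hu, inv_pow, inv_mul_eq_div,
            le_div_iff₀ (by positivity)] at this
          linarith [sub_sq_comm (u x) (u y)]
      have := inv_lt_of_inv_lt₀ h0 ht
      linarith

lemma mem_ball_iff {x y : K} {r : ℝ} : y ∈ ball x r ↔ res x y < r := by
  change resist x y < _ ↔ _
  rw [resist_eq]
  exact ENNReal.ofReal_lt_ofReal_iff_of_nonneg (res_nonneg x y)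

/-- A lower bound for the resistance from one test function. -/
lemma le_res {x y : K} {u : C(K, ℝ)} (hu : u ∈ domain) {e : ℝ} (he : energy u u ≤ e) (hpos : 0 < e)
    (h : u x - u y = 1) : 1 / e ≤ res x y := by
  have := sq_sub_le_res x y hu
  rw [h] at this
  rw [div_le_iff₀ hpos]
  have := mul_le_mul_of_nonneg_left he (res_nonneg x y)
  linarith

/-- Any function on a cell extends to `K` by constants on the complementary components. -/
lemma exists_extension (i : Fin 4) {u : C(K, ℝ)} (hu : u ∈ domain) :
    ∃ v ∈ domain, (∀ x, v (cellMap i x) = u x) ∧ energy v v = 2 * energy u u := by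
  have c := const_mem_domain
  rcases eq_zero_or_one_or i with (rfl | rfl) | (rfl | rfl)
  · have h : Matches u (.const K (u q₁)) (.const K (u q₂)) (.const K (u q₁)) := by simp [Matches]
    exact ⟨_, glue_mem_domain h hu (c _) (c _) (c _), glue_zero h, by
      rw [energy_glue_self h hu (c _) (c _) (c _)]; simp⟩
  · have h : Matches (.const K (u q₁)) u (.const K (u q₁)) (.const K (u q₃)) := by simp [Matches]
    exact ⟨_, glue_mem_domain h (c _) hu (c _) (c _), glue_one h, by
      rw [energy_glue_self h (c _) hu (c _) (c _)]; simp⟩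
  · have h : Matches (.const K (u q₁)) (.const K (u q₁)) u (.const K (u q₁)) := by simp [Matches]
    exact ⟨_, glue_mem_domain h (c _) (c _) hu (c _), glue_two h, by
      rw [energy_glue_self h (c _) (c _) hu (c _)]; simp⟩
  · have h : Matches (.const K (u q₁)) (.const K (u q₁)) (.const K (u q₁)) u := by simp [Matches]
    exact ⟨_, glue_mem_domain h (c _) (c _) (c _) hu, glue_three h, by
      rw [energy_glue_self h (c _) (c _) (c _) hu]; simp⟩

lemma energy_comp_le {u : C(K, ℝ)} (hu : u ∈ domain) (i : Fin 4) :
    energy (u.comp (cell i)) (u.comp (cell i)) ≤ energy u u / 2 := by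
  have e := energy_eq_cells hu hu
  have n0 := energy_cells_nonneg hu 0
  have n1 := energy_cells_nonneg hu 1
  have n2 := energy_cells_nonneg hu 2
  have n3 := energy_cells_nonneg hu 3
  rcases eq_zero_or_one_or i with (rfl | rfl) | (rfl | rfl) <;> linarith

lemma res_cell (i : Fin 4) (x y : K) : res (cellMap i x) (cellMap i y) = res x y / 2 := by
  refine le_antisymm (res_le (by linarith [res_nonneg x y]) fun u hu => ?_) ?_
  · have h := sq_sub_le_res x y (comp_mem_domain hu i)
    have := mul_le_mul_of_nonneg_left (energy_comp_le hu i) (res_nonneg x y)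
    change (u (cellMap i x) - u (cellMap i y)) ^ 2 ≤ _ at h
    linarith
  · have : res x y ≤ 2 * res (cellMap i x) (cellMap i y) := by
      refine res_le (by linarith [res_nonneg (cellMap i x) (cellMap i y)]) fun u hu => ?_
      obtain ⟨v, hv, hvu, he⟩ := exists_extension i hu
      have := sq_sub_le_res (cellMap i x) (cellMap i y) hv
      rw [hvu, hvu, he] at this
      linarith
    linarith

lemma res_q₁_le (x : K) : res q₁ x ≤ 1 :=
  res_le zero_le_one fun u hu => by simpa using sq_sub_q₁_le hu x

/-- If the test functions obtained from `u` by inserting a path of resistance `c` (before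
rescaling by `1 / 2`) all obey the bound `s`, then `u` obeys the bound `2 s - c`. -/
lemma sq_le_of_forall_series {c d e s : ℝ} (hc : 0 < c) (he : 0 ≤ e)
    (h : ∀ t : ℝ, (c + t * d) ^ 2 ≤ s * (2 * (c + t ^ 2 * e))) : d ^ 2 ≤ (2 * s - c) * e := by
  rcases he.eq_or_lt with rfl | he
  · by_contra! hd
    have hd0 : d ≠ 0 := by rintro rfl; norm_num at hd
    -- without the term in `e` the right side stays bounded as `t` grows
    have h0 := h 0
    have h1 := h ((s * (2 * c) + 1) / d)
    rw [div_mul_cancel₀ _ hd0] at h1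
    nlinarith
  · -- `t = d / e` is optimal: it equates the currents in the two parts of the path
    have h1 := h (d / e)
    have e1 : c + d / e * d = c + d ^ 2 / e := by ring
    have e2 : c + (d / e) ^ 2 * e = c + d ^ 2 / e := by field_simp
    rw [e1, e2] at h1
    have hp : 0 < c + d ^ 2 / e := by positivity
    have h2 : c + d ^ 2 / e ≤ 2 * s := by
      by_contra! hlt
      nlinarith
    have h3 : d ^ 2 / e ≤ 2 * s - c := by linarith
    rwa [div_le_iff₀ he] at h3

/-- A lower bound for the resistance of a path: if every `u` extends, after rescaling by `t`, along
a path of resistance `c` to a function on a half-size copy, then `c + R(x, y) ≤ 2 R(z, w)`. -/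
lemma le_two_mul_sub {x y z w : K} {c : ℝ} (hc : 0 < c) (hs : c ≤ 2 * res z w)
    (h : ∀ u ∈ domain, ∀ t : ℝ, ∃ v ∈ domain, (v z - v w) ^ 2 = (c + t * (u x - u y)) ^ 2 ∧
      energy v v = 2 * (c + t ^ 2 * energy u u)) : res x y ≤ 2 * res z w - c := by
  refine res_le (by linarith) fun u hu => ?_
  refine sq_le_of_forall_series hc (energy_nonneg hu) fun t => ?_
  obtain ⟨v, hv, h1, h2⟩ := h u hu t
  rw [← h1, ← h2]
  exact sq_sub_le_res z w hv

lemma comp_cell_apply (u : C(K, ℝ)) (i : Fin 4) (x : K) : u.comp (cell i) x = u (cellMap i x) := rfl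

/-- Resistances from `q₁` add up along the path through `F₂ q₁`. -/
lemma res_q₁_two (x : K) : res q₁ (cellMap 2 x) = 1 / 2 + res q₁ x / 2 := by
  refine le_antisymm (res_le (by linarith [res_nonneg q₁ x]) fun u hu => ?_) ?_
  · have k := sq_sub_q₂_le (comp_mem_domain hu 0)
    have h := sq_sub_le_res q₁ x (comp_mem_domain hu 2)
    simp only [comp_cell_apply, cellMap_zero_q₁, cellMap_zero_q₂] at k h
    rw [← one_mul (energy _ _)] at k
    have := sq_le_series k h (by simp) (res_nonneg _ _) (energy_cells_nonneg hu 0)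
      (energy_cells_nonneg hu 2)
    have e := energy_eq_cells hu hu
    have n1 := energy_cells_nonneg hu 1
    have n3 := energy_cells_nonneg hu 3
    have := mul_le_mul_of_nonneg_left (show energy (u.comp (cell 0)) (u.comp (cell 0)) +
      energy (u.comp (cell 2)) (u.comp (cell 2)) ≤ energy u u / 2 by linarith)
      (show 0 ≤ 1 + res q₁ x by linarith [res_nonneg q₁ x])
    linarith
  · have c := const_mem_domain
    have hs : 1 ≤ 2 * res q₁ (cellMap 2 x) := by
      have h : Matches (affine 0 (-1) g₂) (.const K 0) (.const K (-1)) (.const K 0) := by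
        simp [Matches]
      have := le_res (x := q₁) (y := cellMap 2 x)
        (glue_mem_domain h (affine_mem_domain _ _ g₂_mem_domain) (c _) (c _) (c _)) (e := 2)
        (by rw [energy_glue_self h (affine_mem_domain _ _ g₂_mem_domain) (c _) (c _) (c _),
              energy_affine_self _ _ g₂_mem_domain, energy_g₂]; simp) (by norm_num)
        (by rw [glue_q₁ h, glue_two h]; simp)
      linarith
    have := le_two_mul_sub (x := q₁) (y := x) one_pos hs fun u hu t => by
      have h : Matches (affine 0 (-1) g₂) (.const K 0) (affine (-1 - t * u q₁) t u) (.const K 0) := by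
        simp [Matches]
      have m1 := affine_mem_domain 0 (-1) g₂_mem_domain
      have m2 := affine_mem_domain (-1 - t * u q₁) t hu
      refine ⟨_, glue_mem_domain h m1 (c _) m2 (c _), ?_, ?_⟩
      · rw [glue_q₁ h, glue_two h]; simp; ring
      · rw [energy_glue_self h m1 (c _) m2 (c _), energy_affine_self _ _ g₂_mem_domain,
          energy_affine_self _ _ hu, energy_g₂]
        simp
    linarith

lemma res_q₁_three (x : K) : res q₁ (cellMap 3 x) = 1 / 2 + res q₁ x / 2 := by
  refine le_antisymm (res_le (by linarith [res_nonneg q₁ x]) fun u hu => ?_) ?_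
  · have k := sq_sub_q₃_le (comp_mem_domain hu 1)
    have h := sq_sub_le_res q₁ x (comp_mem_domain hu 3)
    simp only [comp_cell_apply, cellMap_one_q₁, cellMap_one_q₃] at k h
    rw [← one_mul (energy _ _)] at k
    have := sq_le_series k h (by simp) (res_nonneg _ _) (energy_cells_nonneg hu 1)
      (energy_cells_nonneg hu 3)
    have e := energy_eq_cells hu hu
    have n0 := energy_cells_nonneg hu 0
    have n2 := energy_cells_nonneg hu 2
    have := mul_le_mul_of_nonneg_left (show energy (u.comp (cell 1)) (u.comp (cell 1)) +
      energy (u.comp (cell 3)) (u.comp (cell 3)) ≤ energy u u / 2 by linarith)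
      (show 0 ≤ 1 + res q₁ x by linarith [res_nonneg q₁ x])
    linarith
  · have c := const_mem_domain
    have hs : 1 ≤ 2 * res q₁ (cellMap 3 x) := by
      have h : Matches (.const K 0) (affine 0 (-1) g₃) (.const K 0) (.const K (-1)) := by
        simp [Matches]
      have := le_res (x := q₁) (y := cellMap 3 x)
        (glue_mem_domain h (c _) (affine_mem_domain _ _ g₃_mem_domain) (c _) (c _)) (e := 2)
        (by rw [energy_glue_self h (c _) (affine_mem_domain _ _ g₃_mem_domain) (c _) (c _),
              energy_affine_self _ _ g₃_mem_domain, energy_g₃]; simp) (by norm_num)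
        (by rw [glue_q₁ h, glue_three h]; simp)
      linarith
    have := le_two_mul_sub (x := q₁) (y := x) one_pos hs fun u hu t => by
      have h : Matches (.const K 0) (affine 0 (-1) g₃) (.const K 0) (affine (-1 - t * u q₁) t u) := by
        simp [Matches]
      have m1 := affine_mem_domain 0 (-1) g₃_mem_domain
      have m2 := affine_mem_domain (-1 - t * u q₁) t hu
      refine ⟨_, glue_mem_domain h (c _) m1 (c _) m2, ?_, ?_⟩
      · rw [glue_q₁ h, glue_three h]; simp; ring
      · rw [energy_glue_self h (c _) m1 (c _) m2, energy_affine_self _ _ g₃_mem_domain,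
          energy_affine_self _ _ hu, energy_g₃]
        simp
    linarith

lemma res_q₁_lower {i : Fin 4} (hi : i = 2 ∨ i = 3) (x : K) :
    res q₁ (cellMap i x) = 1 / 2 + res q₁ x / 2 := by
  rcases hi with rfl | rfl
  · exact res_q₁_two x
  · exact res_q₁_three x

lemma res_q₁_upper {i : Fin 4} (hi : i = 0 ∨ i = 1) (x : K) :
    res q₁ (cellMap i x) = res q₁ x / 2 := by
  rcases hi with rfl | rfl
  · conv_lhs => rw [← cellMap_zero_q₁]
    exact res_cell 0 q₁ x
  · conv_lhs => rw [← cellMap_one_q₁]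
    exact res_cell 1 q₁ x

lemma res_q₂_two (x : K) : res q₂ (cellMap 2 x) = res q₂ x / 2 := by
  conv_lhs => rw [← cellMap_two_q₂]
  exact res_cell 2 q₂ x

/-- Resistances from `q₂` add up along the path through `F₀ q₂`. -/
lemma res_q₂_zero (x : K) : res q₂ (cellMap 0 x) = 1 / 2 + res q₂ x / 2 := by
  refine le_antisymm (res_le (by linarith [res_nonneg q₂ x]) fun u hu => ?_) ?_
  · have k := sq_sub_q₂_le (comp_mem_domain hu 2)
    have h := sq_sub_le_res q₂ x (comp_mem_domain hu 0)
    simp only [comp_cell_apply, cellMap_two_q₂, cellMap_zero_q₂] at k h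
    rw [sub_sq_comm, ← one_mul (energy _ _)] at k
    have := sq_le_series k h (by simp) (res_nonneg _ _) (energy_cells_nonneg hu 2)
      (energy_cells_nonneg hu 0)
    have e := energy_eq_cells hu hu
    have n1 := energy_cells_nonneg hu 1
    have n3 := energy_cells_nonneg hu 3
    have := mul_le_mul_of_nonneg_left (show energy (u.comp (cell 2)) (u.comp (cell 2)) +
      energy (u.comp (cell 0)) (u.comp (cell 0)) ≤ energy u u / 2 by linarith)
      (show 0 ≤ 1 + res q₂ x by linarith [res_nonneg q₂ x])
    linarith
  · have c := const_mem_domain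
    have m1 := affine_mem_domain 0 1 g₂_mem_domain
    have hs : 1 ≤ 2 * res q₂ (cellMap 0 x) := by
      have h : Matches (.const K 0) (.const K 0) (affine 0 1 g₂) (.const K 0) := by
        simp [Matches]
      have := le_res (x := q₂) (y := cellMap 0 x)
        (glue_mem_domain h (c _) (c _) m1 (c _)) (e := 2)
        (by rw [energy_glue_self h (c _) (c _) m1 (c _),
              energy_affine_self _ _ g₂_mem_domain, energy_g₂]; simp) (by norm_num)
        (by rw [glue_q₂ h, glue_zero h]; simp)
      linarith
    have := le_two_mul_sub (x := q₂) (y := x) one_pos hs fun u hu t => by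
      have h : Matches (affine (-(t * u q₂)) t u) (.const K (-(t * u q₂) + t * u q₁))
          (affine 0 1 g₂) (.const K (-(t * u q₂) + t * u q₁)) := by
        simp [Matches]
      have m2 := affine_mem_domain (-(t * u q₂)) t hu
      refine ⟨_, glue_mem_domain h m2 (c _) m1 (c _), ?_, ?_⟩
      · rw [glue_q₂ h, glue_zero h]; simp; ring
      · rw [energy_glue_self h m2 (c _) m1 (c _), energy_affine_self _ _ g₂_mem_domain,
          energy_affine_self _ _ hu, energy_g₂]
        simp; ring
    linarith

lemma one_le_res_q₂ {i : Fin 4} (hi : i = 1 ∨ i = 3) (x : K) : 1 ≤ res q₂ (cellMap i x) := by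
  have := le_res (x := q₂) (y := cellMap i x) g₂_mem_domain (e := 1) (by simp [energy_g₂]) one_pos
    (by rcases hi with rfl | rfl <;> simp)
  simpa using this

lemma half_le_res_q₀ {i : Fin 4} (hi : i = 1 ∨ i = 3) (x : K) : 1 / 2 ≤ res q₀ (cellMap i x) := by
  have c := const_mem_domain
  have h : Matches g₂ (.const K 0) (.const K 1) (.const K 0) := by simp [Matches]
  refine le_res (x := q₀) (y := cellMap i x)
    (glue_mem_domain h g₂_mem_domain (c _) (c _) (c _)) (e := 2)
    (by rw [energy_glue_self h g₂_mem_domain (c _) (c _) (c _), energy_g₂]; simp) (by norm_num) ?_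
  rw [q₀, glue_two h]
  rcases hi with rfl | rfl
  · rw [glue_one h]; simp
  · rw [glue_three h]; simp

lemma res_q₂_one_le (x : K) : res q₂ (cellMap 1 x) ≤ 1 + res q₁ x / 2 := by
  refine res_le (by linarith [res_nonneg q₁ x]) fun u hu => ?_
  have k := sq_sub_q₂_le (comp_mem_domain hu 2)
  have l := sq_sub_q₂_le (comp_mem_domain hu 0)
  have h := sq_sub_le_res q₁ x (comp_mem_domain hu 1)
  simp only [comp_cell_apply, cellMap_two_q₂, cellMap_zero_q₂, cellMap_zero_q₁,
    cellMap_one_q₁] at k l h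
  rw [sub_sq_comm, ← one_mul (energy _ _)] at k l
  have n0 := energy_cells_nonneg hu 0
  have n1 := energy_cells_nonneg hu 1
  have n2 := energy_cells_nonneg hu 2
  have n3 := energy_cells_nonneg hu 3
  have s1 := sq_le_series k l (by simp) (by simp) n2 n0
  have s2 := sq_le_series s1 h (by norm_num) (res_nonneg _ _) (by linarith) n1
  have e := energy_eq_cells hu hu
  refine s2.trans ?_
  have := mul_le_mul_of_nonneg_left (show energy (u.comp (cell 2)) (u.comp (cell 2)) +
    energy (u.comp (cell 0)) (u.comp (cell 0)) + energy (u.comp (cell 1)) (u.comp (cell 1)) ≤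
    energy u u / 2 by linarith) (show 0 ≤ 1 + 1 + res q₁ x by linarith [res_nonneg q₁ x])
  linarith

/-- Resistances from `q₂` to the far lower cell add up along the path. -/
lemma res_q₂_three (x : K) : res q₂ (cellMap 3 x) = 3 / 2 + res q₁ x / 2 := by
  refine le_antisymm (res_le (by linarith [res_nonneg q₁ x]) fun u hu => ?_) ?_
  · have k := sq_sub_q₂_le (comp_mem_domain hu 2)
    have l := sq_sub_q₂_le (comp_mem_domain hu 0)
    have m := sq_sub_q₃_le (comp_mem_domain hu 1)
    have h := sq_sub_le_res q₁ x (comp_mem_domain hu 3)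
    simp only [comp_cell_apply, cellMap_two_q₂, cellMap_zero_q₂, cellMap_zero_q₁,
      cellMap_one_q₁, cellMap_one_q₃] at k l m h
    rw [sub_sq_comm, ← one_mul (energy _ _)] at k l
    rw [← one_mul (energy _ _)] at m
    have n0 := energy_cells_nonneg hu 0
    have n1 := energy_cells_nonneg hu 1
    have n2 := energy_cells_nonneg hu 2
    have n3 := energy_cells_nonneg hu 3
    have s1 := sq_le_series k l (by simp) (by simp) n2 n0
    have s2 := sq_le_series s1 m (by norm_num) (by norm_num) (by linarith) n1
    have s3 := sq_le_series s2 h (by norm_num) (res_nonneg _ _) (by linarith) n3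
    have e := energy_eq_cells hu hu
    refine s3.trans (le_of_eq ?_)
    rw [e]; ring
  · have c := const_mem_domain
    have m0 := affine_mem_domain 0 1 g₂_mem_domain
    have m2 := affine_mem_domain 1 1 g₂_mem_domain
    have m1 := affine_mem_domain 0 (-1) g₃_mem_domain
    have key : ∀ u ∈ domain, ∀ t : ℝ, ∃ v ∈ domain,
        (v q₂ - v (cellMap 3 x)) ^ 2 = (3 + t * (u q₁ - u x)) ^ 2 ∧
          energy v v = 2 * (3 + t ^ 2 * energy u u) := by
      intro u hu t
      have h : Matches (affine 0 1 g₂) (affine 0 (-1) g₃) (affine 1 1 g₂)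
          (affine (-1 - t * u q₁) t u) := by
        simp [Matches]
      have m3 := affine_mem_domain (-1 - t * u q₁) t hu
      refine ⟨_, glue_mem_domain h m0 m1 m2 m3, ?_, ?_⟩
      · rw [glue_q₂ h, glue_three h]; simp; ring
      · rw [energy_glue_self h m0 m1 m2 m3, energy_affine_self _ _ g₂_mem_domain,
          energy_affine_self _ _ g₂_mem_domain, energy_affine_self _ _ g₃_mem_domain,
          energy_affine_self _ _ hu, energy_g₂, energy_g₃]
        simp; ring
    have hs : 3 ≤ 2 * res q₂ (cellMap 3 x) := by
      obtain ⟨v, hv, h1, h2⟩ := key 0 zero_mem_domain 0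
      have := sq_sub_le_res q₂ (cellMap 3 x) hv
      rw [h1, h2] at this
      norm_num at this
      linarith
    have := le_two_mul_sub (x := q₁) (y := x) (by norm_num) hs key
    linarith

lemma res_q₂_le (x : K) : res q₂ x ≤ 5 / 2 := by
  have h4 : ∀ x, res q₂ x ≤ 4 := fun x => res_le (by norm_num) fun u hu => by
    have h1 := sq_sub_q₁_le hu x
    have h2 := sq_sub_q₁_le hu q₂
    nlinarith [sq_nonneg (u q₁ - u x + (u q₁ - u q₂))]
  refine forall_cell (P := fun x => res q₂ x ≤ 5 / 2) (fun i x => ?_) x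
  have := res_q₁_le x
  have := h4 x
  rcases eq_zero_or_one_or i with (rfl | rfl) | (rfl | rfl)
  · rw [res_q₂_zero]; linarith
  · linarith [res_q₂_one_le x]
  · rw [res_q₂_two]; linarith
  · rw [res_q₂_three]; linarith

/-! ### The equilibrium potential between `q₁` and the Cantor set -/

lemma exists_cantorPotential : ∃ f : C(K, ℝ), f q₁ = 0 ∧ f q₂ = 1 ∧ f q₃ = 1 ∧
    (∀ x, 0 ≤ f x ∧ f x ≤ 1) ∧
    ∀ i x, f (cellMap i x) = (![0, 0, 1 / 4, 1 / 4] : Fin 4 → ℝ) i * f x +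
      (![affine 0 (3 / 4) g₂, affine 0 (3 / 4) g₃, .const K (3 / 4), .const K (3 / 4)] :
        Fin 4 → C(K, ℝ)) i x := by
  refine exists_selfSimilar _ _ _ _ _ (fun i => ?_) (fun i x t h0 h1 => ?_) (by simp) (by simp)
    (by simp) (by simp) (by simp) ?_ ?_ ?_ ?_
  · fin_cases i <;> norm_num [abs_le]
  · have := g₂_mem x
    have := g₃_mem x
    fin_cases i <;> simp <;> constructor <;> linarith
  · change (1 / 4 * 1 + 3 / 4 : ℝ) = 1
    norm_num
  · change (1 / 4 * 1 + 3 / 4 : ℝ) = 1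
    norm_num
  · change 0 * 1 + (0 + 3 / 4 * g₂ q₂) = 1 / 4 * 0 + 3 / 4
    norm_num
  · change 0 * 1 + (0 + 3 / 4 * g₃ q₃) = 1 / 4 * 0 + 3 / 4
    norm_num

/-- The equilibrium potential with value `0` at `q₁` and `1` on the Cantor set. The weights `3/4`
and `1/4` balance the currents at the junctions. -/
def H : C(K, ℝ) := exists_cantorPotential.choose

@[simp] lemma H_q₁ : H q₁ = 0 := exists_cantorPotential.choose_spec.1

@[simp] lemma H_q₂ : H q₂ = 1 := exists_cantorPotential.choose_spec.2.1

@[simp] lemma H_q₃ : H q₃ = 1 := exists_cantorPotential.choose_spec.2.2.1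

lemma H_mem (x : K) : 0 ≤ H x ∧ H x ≤ 1 := exists_cantorPotential.choose_spec.2.2.2.1 x

lemma H_zero (x : K) : H (cellMap 0 x) = 3 / 4 * g₂ x := by
  have := exists_cantorPotential.choose_spec.2.2.2.2 0 x
  change H _ = 0 * H x + (0 + 3 / 4 * g₂ x) at this
  linarith

lemma H_one (x : K) : H (cellMap 1 x) = 3 / 4 * g₃ x := by
  have := exists_cantorPotential.choose_spec.2.2.2.2 1 x
  change H _ = 0 * H x + (0 + 3 / 4 * g₃ x) at this
  linarith

lemma H_lower {i : Fin 4} (hi : i = 2 ∨ i = 3) (x : K) :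
    H (cellMap i x) = 3 / 4 + 1 / 4 * H x := by
  have := exists_cantorPotential.choose_spec.2.2.2.2 i x
  rcases hi with rfl | rfl <;>
  · change H _ = 1 / 4 * H x + 3 / 4 at this
    linarith

lemma E_const_add_smul_self (n : ℕ) (c t : ℝ) (u : K → ℝ) :
    E n ((fun _ => c) + t • u) ((fun _ => c) + t • u) = t ^ 2 * E n u u := by
  rw [E_add_smul_self, E_const_left, E_const_left]
  ring

lemma H_mem_domain : H ∈ domain := by
  refine mem_domain_of_le (M := 3) fun n => ?_
  induction n with
  | zero => simp [E]; norm_num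
  | succ n ih =>
    have e0 : H ∘ cellMap 0 = (fun _ => 0) + (3 / 4 : ℝ) • ⇑g₂ := by ext x; simp [H_zero]
    have e1 : H ∘ cellMap 1 = (fun _ => 0) + (3 / 4 : ℝ) • ⇑g₃ := by ext x; simp [H_one]
    have e : ∀ i, i = 2 ∨ i = 3 → H ∘ cellMap i = (fun _ => (3 / 4 : ℝ)) + (1 / 4 : ℝ) • ⇑H := by
      intro i hi; ext x; simp [H_lower hi]
    rw [E_succ, e0, e1, e 2 (by simp), e 3 (by simp)]
    simp only [E_const_add_smul_self]
    rw [E_g₂, E_g₃]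
    norm_num
    linarith

lemma H_comp_zero : H.comp (cell 0) = affine 0 (3 / 4) g₂ :=
  ContinuousMap.ext fun x => (H_zero x).trans (zero_add _).symm

lemma H_comp_one : H.comp (cell 1) = affine 0 (3 / 4) g₃ :=
  ContinuousMap.ext fun x => (H_one x).trans (zero_add _).symm

lemma H_comp_lower {i : Fin 4} (hi : i = 2 ∨ i = 3) : H.comp (cell i) = affine (3 / 4) (1 / 4) H :=
  ContinuousMap.ext (H_lower hi)

/-- A functional dominated by the energy whose bound improves by a factor vanishes. -/
lemma eq_zero_of_contraction {S : Set C(K, ℝ)} {D : C(K, ℝ) → ℝ} {c : ℝ} (hc : 0 ≤ c)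
    (h : ∀ v ∈ S, D v ^ 2 ≤ c * energy v v)
    (hD : ∀ b, 0 ≤ b → (∀ v ∈ S, D v ^ 2 ≤ b * energy v v) →
      ∀ v ∈ S, D v ^ 2 ≤ b / 2 * energy v v) {v : C(K, ℝ)} (hv : v ∈ S) : D v = 0 := by
  have key : ∀ m : ℕ, ∀ v ∈ S, D v ^ 2 ≤ c * (1 / 2) ^ m * energy v v := by
    intro m
    induction m with
    | zero => simpa using h
    | succ m ih =>
      have := hD _ (by positivity) ih
      intro v hv
      refine (this v hv).trans (le_of_eq ?_)
      rw [pow_succ]; ring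
  have hlim : Tendsto (fun m : ℕ => c * (1 / 2 : ℝ) ^ m * energy v v) atTop (𝓝 0) := by
    simpa using ((tendsto_pow_atTop_nhds_zero_of_lt_one (r := (1 / 2 : ℝ)) (by norm_num)
      (by norm_num)).const_mul c).mul_const (energy v v)
  have : D v ^ 2 ≤ 0 := ge_of_tendsto' hlim fun m => key m v hv
  exact pow_eq_zero_iff two_ne_zero |>.1 (le_antisymm this (sq_nonneg _))

/-- `H` is harmonic off `q₁` and the Cantor set, with total current `3`. -/
lemma energy_H {v : C(K, ℝ)} (hv : v ∈ domain) (h0 : ∀ x ∈ cantor, v x = 0) :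
    energy H v = -3 * v q₁ := by
  have := eq_zero_of_contraction (S := {v | v ∈ domain ∧ ∀ x ∈ cantor, v x = 0})
    (D := fun v => energy H v + 3 * v q₁) (c := 2 * energy H H + 18)
    (by linarith [energy_nonneg H_mem_domain]) ?_ ?_ (show v ∈ _ from ⟨hv, h0⟩)
  · linarith
  · rintro v ⟨hv, h0⟩
    have h1 := energy_sq_le H_mem_domain hv
    have h2 := sq_sub_q₂_le hv
    rw [h0 q₂ q₂_mem_cantor, sub_zero] at h2
    have h3 := sq_nonneg (energy H v - 3 * v q₁)
    nlinarith
  · rintro b hb ih v ⟨hv, h0⟩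
    have s : ∀ i, i = 2 ∨ i = 3 → v.comp (cell i) ∈ {v | v ∈ domain ∧ ∀ x ∈ cantor, v x = 0} :=
      fun i hi => ⟨comp_mem_domain hv i,
        fun x hx => h0 _ ((mem_cantor_lower (not_upper hi) x).2 hx)⟩
    have i2 := ih _ (s 2 (by simp))
    have i3 := ih _ (s 3 (by simp))
    have e : energy H v + 3 * v q₁ = ((energy H (v.comp (cell 2)) + 3 * v.comp (cell 2) q₁) +
        (energy H (v.comp (cell 3)) + 3 * v.comp (cell 3) q₁)) / 2 := by
      rw [energy_eq_cells H_mem_domain hv, H_comp_zero, H_comp_one, H_comp_lower (i := 2) (by simp),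
        H_comp_lower (i := 3) (by simp), energy_affine_left _ _ g₂_mem_domain (comp_mem_domain hv _),
        energy_affine_left _ _ g₃_mem_domain (comp_mem_domain hv _),
        energy_affine_left _ _ H_mem_domain (comp_mem_domain hv _),
        energy_affine_left _ _ H_mem_domain (comp_mem_domain hv _), energy_g₂, energy_g₃]
      simp only [comp_cell_apply, cellMap_zero_q₁, cellMap_zero_q₂, cellMap_one_q₁, cellMap_one_q₃]
      ring
    rw [e]
    have hE := energy_eq_cells hv hv
    have n0 := energy_cells_nonneg hv 0
    have n1 := energy_cells_nonneg hv 1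
    have n2 := energy_cells_nonneg hv 2
    have n3 := energy_cells_nonneg hv 3
    generalize energy H (v.comp (cell 2)) + 3 * v.comp (cell 2) q₁ = p at i2 ⊢
    generalize energy H (v.comp (cell 3)) + 3 * v.comp (cell 3) q₁ = q at i3 ⊢
    have hb2 := mul_le_mul_of_nonneg_left (show energy (v.comp (cell 2)) (v.comp (cell 2)) +
      energy (v.comp (cell 3)) (v.comp (cell 3)) ≤ energy v v / 2 by linarith) hb
    have := sq_nonneg (p - q)
    nlinarith

/-- A function with values in `[0, 1]` whose distance to `1` contracts in the lower cells equals `1`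
on the Cantor set. -/
lemma eq_one_of_cantor {f : K → ℝ} {c : ℝ} (hc : 0 ≤ c) (hc1 : c < 1) (h1 : ∀ x, f x ≤ 1)
    (h0 : ∀ x, 0 ≤ f x) (hf : ∀ i, i = 2 ∨ i = 3 → ∀ x, f (cellMap i x) = 1 - c + c * f x) {x : K}
    (hx : x ∈ cantor) : f x = 1 := by
  have key : ∀ m : ℕ, ∀ x ∈ cantor, 1 - f x ≤ c ^ m := by
    intro m
    induction m with
    | zero => intro x _; linarith [h0 x, pow_zero c]
    | succ m ih =>
      intro x
      refine forall_cell (P := fun x => x ∈ cantor → 1 - f x ≤ c ^ (m + 1)) (fun i x hx => ?_) x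
      rcases eq_zero_or_one_or i with hi | hi
      · exact (not_mem_cantor_upper hi x hx).elim
      · have := ih x ((mem_cantor_lower (not_upper hi) x).1 hx)
        rw [hf i hi, pow_succ]
        nlinarith
  have : 1 - f x ≤ 0 :=
    ge_of_tendsto' (tendsto_pow_atTop_nhds_zero_of_lt_one hc hc1) fun m => key m x hx
  linarith [h1 x]

lemma H_lt_one_iff (x : K) : H x < 1 ↔ x ∉ cantor := by
  refine ⟨fun h hx => h.ne (eq_one_of_cantor (c := 1 / 4) (by norm_num) (by norm_num)
    (fun x => (H_mem x).2) (fun x => (H_mem x).1) (fun i hi x => ?_) hx), ?_⟩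
  · rw [H_lower hi]; norm_num
  · refine cantor_induction (P := fun x => x ∉ cantor → H x < 1) (fun x hx h => (h hx).elim)
      (fun i hi x _ => ?_) (fun i hi x ih h => ?_) x
    · have := g₂_mem x
      have := g₃_mem x
      rcases hi with rfl | rfl
      · rw [H_zero]; linarith
      · rw [H_one]; linarith
    · have := ih fun hx => h ((mem_cantor_lower (not_upper hi) x).2 hx)
      rw [H_lower hi]
      linarith

lemma res_q₁_lt_one_iff (x : K) : res q₁ x < 1 ↔ x ∉ cantor := by
  refine ⟨fun h hx => h.ne (eq_one_of_cantor (c := 1 / 2) (by norm_num) (by norm_num)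
    res_q₁_le (res_nonneg q₁) (fun i hi x => ?_) hx), ?_⟩
  · rw [res_q₁_lower hi]; ring
  · refine cantor_induction (P := fun x => x ∉ cantor → res q₁ x < 1) (fun x hx h => (h hx).elim)
      (fun i hi x _ => ?_) (fun i hi x ih h => ?_) x
    · have := res_q₁_le x
      rw [res_q₁_upper hi]
      linarith
    · have := ih fun hx => h ((mem_cantor_lower (not_upper hi) x).2 hx)
      rw [res_q₁_lower hi]
      linarith

lemma res_q₁_q₂ : res q₁ q₂ = 1 := by
  have h : ¬ res q₁ q₂ < 1 := fun h => (res_q₁_lt_one_iff q₂).1 h q₂_mem_cantor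
  exact le_antisymm (res_q₁_le _) (not_lt.1 h)

/-- `g₂` grows at most like the resistance: it is the projection to the left edge. -/
lemma g₂_le_res (x : K) : g₂ x ≤ res q₁ x := by
  have key : ∀ m : ℕ, ∀ x, g₂ x - res q₁ x ≤ (1 / 2) ^ m := by
    intro m
    induction m with
    | zero => intro x; rw [pow_zero]; linarith [(g₂_mem x).2, res_nonneg q₁ x]
    | succ m ih =>
      refine forall_cell fun i x => ?_
      have h := ih x
      have hp : (0 : ℝ) < (1 / 2) ^ (m + 1) := by positivity
      have hr := res_nonneg q₁ (cellMap i x)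
      rw [pow_succ] at hp ⊢
      rcases eq_zero_or_one_or i with (rfl | rfl) | (rfl | rfl)
      · rw [res_q₁_upper (by simp), g₂_zero]; linarith
      · rw [g₂_one]; linarith
      · rw [res_q₁_two, g₂_two]; linarith
      · rw [g₂_three]; linarith
  have := ge_of_tendsto' (tendsto_pow_atTop_nhds_zero_of_lt_one (r := (1 / 2 : ℝ)) (by norm_num)
    (by norm_num)) fun m => key m x
  linarith

/-! ### The equilibrium potential of the unit ball around `q₂` -/

/-- The restriction to `F₂(K)` of the equilibrium potential `W`: harmonic with values `1/4` and `1`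
at `q₁, q₂` and `0` on `F₃` of the Cantor set. -/
def J : C(K, ℝ) :=
  glue (affine (1 / 4) (3 / 8) g₂) (affine (1 / 4) (-3 / 16) g₃) (affine (5 / 8) (3 / 8) g₂)
    (affine (1 / 16) (-1 / 16) H)

lemma J_matches : Matches (affine (1 / 4) (3 / 8) g₂) (affine (1 / 4) (-3 / 16) g₃)
    (affine (5 / 8) (3 / 8) g₂) (affine (1 / 16) (-1 / 16) H) := by
  simp only [Matches, affine_apply, g₂_q₁, g₂_q₂, g₃_q₁, g₃_q₃, H_q₁]
  norm_num

lemma J_zero (x : K) : J (cellMap 0 x) = 1 / 4 + 3 / 8 * g₂ x := glue_zero J_matches x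

lemma J_one (x : K) : J (cellMap 1 x) = 1 / 4 + -3 / 16 * g₃ x := glue_one J_matches x

lemma J_two (x : K) : J (cellMap 2 x) = 5 / 8 + 3 / 8 * g₂ x := glue_two J_matches x

lemma J_three (x : K) : J (cellMap 3 x) = 1 / 16 + -1 / 16 * H x := glue_three J_matches x

@[simp] lemma J_q₁ : J q₁ = 1 / 4 := by
  rw [J, glue_q₁ J_matches]; simp

@[simp] lemma J_q₂ : J q₂ = 1 := by
  rw [J, glue_q₂ J_matches]; simp; norm_num

lemma J_mem : ∀ x, 0 ≤ J x ∧ J x ≤ 1 := by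
  refine forall_cell fun i x => ?_
  have := g₂_mem x
  have := g₃_mem x
  have := H_mem x
  rcases eq_zero_or_one_or i with (rfl | rfl) | (rfl | rfl)
  · rw [J_zero]; constructor <;> linarith
  · rw [J_one]; constructor <;> linarith
  · rw [J_two]; constructor <;> linarith
  · rw [J_three]; constructor <;> linarith

lemma J_mem_domain : J ∈ domain :=
  glue_mem_domain J_matches (affine_mem_domain _ _ g₂_mem_domain)
    (affine_mem_domain _ _ g₃_mem_domain) (affine_mem_domain _ _ g₂_mem_domain)
    (affine_mem_domain _ _ H_mem_domain)

lemma J_pos_iff (x : K) : res q₂ x < 2 ↔ 0 < J x := by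
  refine forall_cell (P := fun x => res q₂ x < 2 ↔ 0 < J x) (fun i x => ?_) x
  have := g₂_mem x
  have := g₃_mem x
  have := res_q₂_le x
  have := res_q₁_le x
  rcases eq_zero_or_one_or i with (rfl | rfl) | (rfl | rfl)
  · rw [J_zero, res_q₂_zero]; constructor <;> intro <;> linarith
  · have := res_q₂_one_le x
    rw [J_one]; constructor <;> intro <;> linarith
  · rw [J_two, res_q₂_two]; constructor <;> intro <;> linarith
  · rw [J_three, res_q₂_three]
    have h : res q₁ x < 1 ↔ H x < 1 := (res_q₁_lt_one_iff x).trans (H_lt_one_iff x).symm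
    constructor
    · intro k
      have := h.1 (by linarith)
      linarith
    · intro k
      have := h.2 (by linarith)
      linarith

/-- The current of `J` at `q₁` and `q₂`, when tested against functions vanishing where `J` does. -/
lemma energy_J {v : C(K, ℝ)} (hv : v ∈ domain) (h0 : ∀ x, J x = 0 → v x = 0) :
    energy J v = 3 / 4 * v q₂ - 3 / 8 * v q₁ := by
  have h3 : ∀ x ∈ cantor, v.comp (cell 3) x = 0 := by
    intro x hx
    refine h0 _ ?_
    have h1 : ¬ H x < 1 := fun h => (H_lt_one_iff x).1 h hx
    rw [show J (cell 3 x) = _ from J_three x]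
    linarith [(H_mem x).2]
  rw [J, energy_glue_left J_matches (affine_mem_domain _ _ g₂_mem_domain)
    (affine_mem_domain _ _ g₃_mem_domain) (affine_mem_domain _ _ g₂_mem_domain)
    (affine_mem_domain _ _ H_mem_domain) hv,
    energy_affine_left _ _ g₂_mem_domain (comp_mem_domain hv _),
    energy_affine_left _ _ g₃_mem_domain (comp_mem_domain hv _),
    energy_affine_left _ _ g₂_mem_domain (comp_mem_domain hv _),
    energy_affine_left _ _ H_mem_domain (comp_mem_domain hv _), energy_g₂, energy_g₂, energy_g₃,
    energy_H (comp_mem_domain hv _) h3]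
  simp only [comp_cell_apply, cellMap_zero_q₁, cellMap_zero_q₂, cellMap_one_q₁, cellMap_one_q₃,
    cellMap_two_q₂]
  ring

lemma exists_ballPotential : ∃ f : C(K, ℝ), f q₁ = 0 ∧ f q₂ = 1 ∧ f q₃ = 0 ∧
    (∀ x, 0 ≤ f x ∧ f x ≤ 1) ∧
    ∀ i x, f (cellMap i x) = (![1 / 4, 0, 0, 0] : Fin 4 → ℝ) i * f x +
      (![0, 0, J, 0] : Fin 4 → C(K, ℝ)) i x := by
  refine exists_selfSimilar _ _ _ _ _ (fun i => ?_) (fun i x t h0 h1 => ?_) (by simp) (by simp)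
    (by simp) (by simp) (by simp) ?_ (by simp) ?_ (by simp)
  · fin_cases i <;> norm_num [abs_le]
  · have := J_mem x
    fin_cases i <;> simp <;> constructor <;> linarith
  · change 0 * 1 + J q₂ = 1
    simp
  · change 1 / 4 * 1 + 0 = 0 * 0 + J q₁
    simp

/-- The equilibrium potential of `q₂` in the ball `B(q₂, 1)`: harmonic there off `q₂`, with value
`1` at `q₂` and `0` off the ball. -/
def W : C(K, ℝ) := exists_ballPotential.choose

@[simp] lemma W_q₁ : W q₁ = 0 := exists_ballPotential.choose_spec.1

@[simp] lemma W_q₂ : W q₂ = 1 := exists_ballPotential.choose_spec.2.1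

lemma W_mem (x : K) : 0 ≤ W x ∧ W x ≤ 1 := exists_ballPotential.choose_spec.2.2.2.1 x

lemma W_zero (x : K) : W (cellMap 0 x) = 1 / 4 * W x := by
  have := exists_ballPotential.choose_spec.2.2.2.2 0 x
  change W _ = 1 / 4 * W x + 0 at this
  linarith

lemma W_two (x : K) : W (cellMap 2 x) = J x := by
  have := exists_ballPotential.choose_spec.2.2.2.2 2 x
  change W _ = 0 * W x + J x at this
  linarith

lemma W_right {i : Fin 4} (hi : i = 1 ∨ i = 3) (x : K) : W (cellMap i x) = 0 := by
  have := exists_ballPotential.choose_spec.2.2.2.2 i x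
  rcases hi with rfl | rfl <;>
  · change W _ = 0 * W x + 0 at this
    linarith

lemma W_mem_domain : W ∈ domain := by
  refine mem_domain_of_le (M := 1 + 4 * energy J J) fun n => ?_
  have hJ := energy_nonneg J_mem_domain
  induction n with
  | zero => simp only [E, W_q₁, W_q₂, show W q₃ = 0 from exists_ballPotential.choose_spec.2.2.1]
            linarith
  | succ n ih =>
    have e0 : W ∘ cellMap 0 = (fun _ => 0) + (1 / 4 : ℝ) • ⇑W := by ext x; simp [W_zero]
    have e : ∀ i, i = 1 ∨ i = 3 → W ∘ cellMap i = fun _ => 0 := by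
      intro i hi; ext x; simp [W_right hi]
    have e2 : W ∘ cellMap 2 = J := by ext x; simp [W_two]
    rw [E_succ, e0, e2, e 1 (by simp), e 3 (by simp), E_const_left, E_const_add_smul_self]
    have := E_le_energy J_mem_domain n
    linarith

/-- The ball `B(q₂, 1)` is the set where its equilibrium potential is positive. -/
lemma res_q₂_lt_one_iff (x : K) : res q₂ x < 1 ↔ 0 < W x := by
  refine q₁_induction (P := fun x => res q₂ x < 1 ↔ 0 < W x) ?_ (fun i hi x => ?_)
    (fun x ih => ?_) x
  · simp [res_comm q₂, res_q₁_q₂]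
  · rcases eq_zero_or_one_or i with (rfl | rfl) | (rfl | rfl)
    · exact (hi rfl).elim
    · simp [W_right, not_lt.2 (one_le_res_q₂ (i := 1) (by simp) x)]
    · rw [res_q₂_two, W_two, ← J_pos_iff]
      constructor <;> intro <;> linarith
    · simp [W_right, not_lt.2 (one_le_res_q₂ (i := 3) (by simp) x)]
  · rw [res_q₂_zero, W_zero]
    constructor
    · intro h
      have := ih.1 (by linarith)
      linarith
    · intro h
      have := ih.2 (by linarith)
      linarith

/-- `W` is harmonic in `B(q₂, 1)` off `q₂`, with total current `3/2`. -/
lemma energy_W {v : C(K, ℝ)} (hv : v ∈ domain) (h0 : ∀ x, W x = 0 → v x = 0) :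
    energy W v = 3 / 2 * v q₂ := by
  have := eq_zero_of_contraction (S := {v | v ∈ domain ∧ ∀ x, W x = 0 → v x = 0})
    (D := fun v => energy W v - 3 / 2 * v q₂) (c := 2 * energy W W + 18)
    (by linarith [energy_nonneg W_mem_domain]) ?_ ?_ (show v ∈ _ from ⟨hv, h0⟩)
  · linarith
  · rintro v ⟨hv, h0⟩
    have h1 := energy_sq_le W_mem_domain hv
    have h2 := sq_sub_q₂_le hv
    rw [h0 q₁ W_q₁, zero_sub, neg_sq] at h2
    have h3 := sq_nonneg (energy W v + 3 / 2 * v q₂)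
    nlinarith [energy_nonneg hv]
  · rintro b hb ih v ⟨hv, h0⟩
    have i0 := ih (v.comp (cell 0)) ⟨comp_mem_domain hv 0,
      fun x hx => h0 _ ((W_zero x).trans (by simp [hx]))⟩
    have e0 : W.comp (cell 0) = affine 0 (1 / 4) W :=
      ContinuousMap.ext fun x => (W_zero x).trans (zero_add _).symm
    have e2 : W.comp (cell 2) = J := ContinuousMap.ext W_two
    have e1 : ∀ i, i = 1 ∨ i = 3 → W.comp (cell i) = 0 := fun i hi => ContinuousMap.ext (W_right hi)
    have e : energy W v - 3 / 2 * v q₂ =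
        (energy W (v.comp (cell 0)) - 3 / 2 * v.comp (cell 0) q₂) / 2 := by
      rw [energy_eq_cells W_mem_domain hv, e0, e2, e1 1 (by simp), e1 3 (by simp),
        energy_affine_left _ _ W_mem_domain (comp_mem_domain hv _), energy_zero_left,
        energy_zero_left, energy_J (comp_mem_domain hv _) fun x hx => h0 _ ((W_two x).trans hx)]
      simp only [comp_cell_apply, cellMap_zero_q₂, cellMap_two_q₂]
      ring
    rw [e]
    have hE := mul_le_mul_of_nonneg_left (energy_comp_le hv 0) hb
    have := energy_nonneg hv
    generalize energy W (v.comp (cell 0)) - 3 / 2 * v.comp (cell 0) q₂ = p at i0 ⊢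
    nlinarith

/-! ### The equilibrium potentials of small balls -/

/-- The equilibrium potential of `q₁` in the ball `B(q₁, 2⁻ᵐ)`. -/
def lowPot : ℕ → C(K, ℝ)
  | 0 => affine 1 (-1) H
  | m + 1 => glue (lowPot m) (lowPot m) 0 0

lemma lowPot_tips (m : ℕ) : lowPot m q₂ = 0 ∧ lowPot m q₃ = 0 := by
  induction m with
  | zero => simp [lowPot]
  | succ m ih =>
    have h : Matches (lowPot m) (lowPot m) 0 0 := by simp [Matches, ih]
    simp only [lowPot, glue_q₂ h, glue_q₃ h, ContinuousMap.zero_apply, and_self]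

lemma lowPot_matches (m : ℕ) : Matches (lowPot m) (lowPot m) 0 0 := by
  simp [Matches, lowPot_tips m]

lemma lowPot_upper {i : Fin 4} (hi : i = 0 ∨ i = 1) (m : ℕ) (x : K) :
    lowPot (m + 1) (cellMap i x) = lowPot m x := by
  rcases hi with rfl | rfl
  · exact glue_zero (lowPot_matches m) x
  · exact glue_one (lowPot_matches m) x

lemma lowPot_lower {i : Fin 4} (hi : i = 2 ∨ i = 3) (m : ℕ) (x : K) :
    lowPot (m + 1) (cellMap i x) = 0 := by
  rcases hi with rfl | rfl
  · exact glue_two (lowPot_matches m) x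
  · exact glue_three (lowPot_matches m) x

@[simp] lemma lowPot_q₁ (m : ℕ) : lowPot m q₁ = 1 := by
  induction m with
  | zero => simp [lowPot]
  | succ m ih => exact (glue_q₁ (lowPot_matches m)).trans ih

lemma lowPot_mem (m : ℕ) (x : K) : 0 ≤ lowPot m x ∧ lowPot m x ≤ 1 := by
  induction m generalizing x with
  | zero =>
    have := H_mem x
    simp only [lowPot, affine_apply]
    constructor <;> linarith
  | succ m ih =>
    refine forall_cell (P := fun x => 0 ≤ lowPot (m + 1) x ∧ lowPot (m + 1) x ≤ 1) (fun i x => ?_) x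
    rcases eq_zero_or_one_or i with hi | hi
    · rw [lowPot_upper hi]; exact ih x
    · rw [lowPot_lower hi]; norm_num

lemma lowPot_mem_domain (m : ℕ) : lowPot m ∈ domain := by
  induction m with
  | zero => exact affine_mem_domain _ _ H_mem_domain
  | succ m ih => exact glue_mem_domain (lowPot_matches m) ih ih zero_mem_domain zero_mem_domain

lemma lowPot_zero_eq_zero_iff (x : K) : lowPot 0 x = 0 ↔ x ∈ cantor := by
  have h := H_lt_one_iff x
  have := H_mem x
  simp only [lowPot, affine_apply]
  constructor
  · intro h0
    by_contra hx
    linarith [h.2 hx]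
  · intro hx
    have : ¬ H x < 1 := fun hlt => h.1 hlt hx
    linarith

/-- The total current at `q₁` is that of `2ᵐ` cells, each of conductance `3 · 2ᵐ`. -/
lemma energy_lowPot (m : ℕ) {v : C(K, ℝ)} (hv : v ∈ domain) (h0 : ∀ x, lowPot m x = 0 → v x = 0) :
    energy (lowPot m) v = 3 * 4 ^ m * v q₁ := by
  induction m generalizing v with
  | zero =>
    rw [lowPot, energy_affine_left _ _ H_mem_domain hv,
      energy_H hv fun x hx => h0 x ((lowPot_zero_eq_zero_iff x).2 hx)]
    ring
  | succ m ih =>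
    rw [lowPot, energy_glue_left (lowPot_matches m) (lowPot_mem_domain m) (lowPot_mem_domain m)
      zero_mem_domain zero_mem_domain hv, energy_zero_left, energy_zero_left,
      ih (comp_mem_domain hv 0) fun x hx => h0 _ ((lowPot_upper (by simp) m x).trans hx),
      ih (comp_mem_domain hv 1) fun x hx => h0 _ ((lowPot_upper (by simp) m x).trans hx)]
    simp only [comp_cell_apply, cellMap_zero_q₁, cellMap_one_q₁]
    ring

lemma res_q₁_lt_iff (m : ℕ) (x : K) : res q₁ x < (1 / 2) ^ m ↔ 0 < lowPot m x := by
  induction m generalizing x with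
  | zero =>
    rw [pow_zero, res_q₁_lt_one_iff, ← lowPot_zero_eq_zero_iff]
    exact ⟨fun h => lt_of_le_of_ne (lowPot_mem 0 x).1 (Ne.symm h), fun h => h.ne'⟩
  | succ m ih =>
    refine forall_cell (P := fun x => res q₁ x < (1 / 2) ^ (m + 1) ↔ 0 < lowPot (m + 1) x)
      (fun i x => ?_) x
    rcases eq_zero_or_one_or i with hi | hi
    · rw [lowPot_upper hi, res_q₁_upper hi, ← ih, pow_succ]
      constructor <;> intro <;> linarith
    · have : ((1 : ℝ) / 2) ^ (m + 1) ≤ 1 / 2 := by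
        have : ((1 : ℝ) / 2) ^ m ≤ 1 := pow_le_one₀ (by norm_num) (by norm_num)
        rw [pow_succ]; linarith
      have := res_nonneg q₁ x
      rw [lowPot_lower hi, res_q₁_lower hi]
      constructor <;> intro <;> linarith

lemma quarter_le_lowPot (m : ℕ) (x : K) (h : 0 < lowPot (m + 1) x) : 1 / 4 ≤ lowPot m x := by
  induction m generalizing x with
  | zero =>
    refine forall_cell (P := fun x => 0 < lowPot 1 x → 1 / 4 ≤ lowPot 0 x) (fun i x h => ?_) x h
    simp only [lowPot, affine_apply]
    have := g₂_mem x
    have := g₃_mem x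
    rcases eq_zero_or_one_or i with (rfl | rfl) | hi
    · rw [H_zero]; linarith
    · rw [H_one]; linarith
    · rw [lowPot_lower hi] at h; exact (lt_irrefl _ h).elim
  | succ m ih =>
    refine forall_cell (P := fun x => 0 < lowPot (m + 2) x → 1 / 4 ≤ lowPot (m + 1) x)
      (fun i x h => ?_) x h
    rcases eq_zero_or_one_or i with hi | hi
    · rw [lowPot_upper hi] at h ⊢; exact ih x h
    · rw [lowPot_lower hi] at h; exact (lt_irrefl _ h).elim

/-- The equilibrium potential of `q₂` in the ball `B(q₂, 2⁻ᵐ)`. -/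
def upPot : ℕ → C(K, ℝ)
  | 0 => W
  | m + 1 => glue 0 0 (upPot m) 0

@[simp] lemma upPot_q₁ (m : ℕ) : upPot m q₁ = 0 := by
  induction m with
  | zero => exact W_q₁
  | succ m ih =>
    have h : Matches 0 0 (upPot m) 0 := by simp [Matches, ih]
    exact glue_q₁ h

lemma upPot_matches (m : ℕ) : Matches 0 0 (upPot m) 0 := by simp [Matches]

@[simp] lemma upPot_q₂ (m : ℕ) : upPot m q₂ = 1 := by
  induction m with
  | zero => exact W_q₂
  | succ m ih => exact (glue_q₂ (upPot_matches m)).trans ih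

lemma upPot_two (m : ℕ) (x : K) : upPot (m + 1) (cellMap 2 x) = upPot m x :=
  glue_two (upPot_matches m) x

lemma upPot_ne_two {i : Fin 4} (hi : i ≠ 2) (m : ℕ) (x : K) : upPot (m + 1) (cellMap i x) = 0 := by
  rcases eq_zero_or_one_or i with (rfl | rfl) | (rfl | rfl)
  · exact glue_zero (upPot_matches m) x
  · exact glue_one (upPot_matches m) x
  · exact (hi rfl).elim
  · exact glue_three (upPot_matches m) x

lemma upPot_mem (m : ℕ) (x : K) : 0 ≤ upPot m x ∧ upPot m x ≤ 1 := by
  induction m generalizing x with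
  | zero => exact W_mem x
  | succ m ih =>
    refine forall_cell (P := fun x => 0 ≤ upPot (m + 1) x ∧ upPot (m + 1) x ≤ 1) (fun i x => ?_) x
    by_cases hi : i = 2
    · subst hi; rw [upPot_two]; exact ih x
    · rw [upPot_ne_two hi]; norm_num

lemma upPot_mem_domain (m : ℕ) : upPot m ∈ domain := by
  induction m with
  | zero => exact W_mem_domain
  | succ m ih =>
    exact glue_mem_domain (upPot_matches m) zero_mem_domain zero_mem_domain ih zero_mem_domain

/-- The current at `q₂` doubles with each halving of the radius. -/
lemma energy_upPot (m : ℕ) {v : C(K, ℝ)} (hv : v ∈ domain) (h0 : ∀ x, upPot m x = 0 → v x = 0) :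
    energy (upPot m) v = 3 / 2 * 2 ^ m * v q₂ := by
  induction m generalizing v with
  | zero => rw [upPot, energy_W hv h0]; ring
  | succ m ih =>
    rw [upPot, energy_glue_left (upPot_matches m) zero_mem_domain zero_mem_domain
      (upPot_mem_domain m) zero_mem_domain hv, energy_zero_left, energy_zero_left,
      energy_zero_left, ih (comp_mem_domain hv 2) fun x hx => h0 _ ((upPot_two m x).trans hx)]
    simp only [comp_cell_apply, cellMap_two_q₂]
    ring

lemma res_q₂_lt_iff (m : ℕ) (x : K) : res q₂ x < (1 / 2) ^ m ↔ 0 < upPot m x := by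
  induction m generalizing x with
  | zero => rw [pow_zero]; exact res_q₂_lt_one_iff x
  | succ m ih =>
    refine forall_cell (P := fun x => res q₂ x < (1 / 2) ^ (m + 1) ↔ 0 < upPot (m + 1) x)
      (fun i x => ?_) x
    by_cases hi : i = 2
    · subst hi
      rw [upPot_two, res_q₂_two, ← ih, pow_succ]
      constructor <;> intro <;> linarith
    · have h1 : ((1 : ℝ) / 2) ^ (m + 1) ≤ 1 / 2 := by
        have : ((1 : ℝ) / 2) ^ m ≤ 1 := pow_le_one₀ (by norm_num) (by norm_num)
        rw [pow_succ]; linarith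
      have h2 : 1 / 2 ≤ res q₂ (cellMap i x) := by
        rcases eq_zero_or_one_or i with (rfl | rfl) | (rfl | rfl)
        · rw [res_q₂_zero]; linarith [res_nonneg q₂ x]
        · linarith [one_le_res_q₂ (i := 1) (by simp) x]
        · exact (hi rfl).elim
        · linarith [one_le_res_q₂ (i := 3) (by simp) x]
      rw [upPot_ne_two hi]
      constructor <;> intro <;> linarith

lemma quarter_le_upPot (m : ℕ) (x : K) (h : 0 < upPot (m + 1) x) : 1 / 4 ≤ upPot m x := by
  induction m generalizing x with
  | zero =>
    refine forall_cell (P := fun x => 0 < upPot 1 x → 1 / 4 ≤ upPot 0 x) (fun i x h => ?_) x h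
    by_cases hi : i = 2
    · subst hi
      rw [upPot_two] at h
      change 0 < W x at h
      change 1 / 4 ≤ W (cellMap 2 x)
      rw [W_two]
      refine forall_cell (P := fun x => 0 < W x → 1 / 4 ≤ J x) (fun i x h => ?_) x h
      have := g₂_mem x
      rcases eq_zero_or_one_or i with (rfl | rfl) | (rfl | rfl)
      · rw [J_zero]; linarith
      · rw [W_right (by simp)] at h; exact (lt_irrefl _ h).elim
      · rw [J_two]; linarith
      · rw [W_right (by simp)] at h; exact (lt_irrefl _ h).elim
    · rw [upPot_ne_two hi] at h; exact (lt_irrefl _ h).elim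
  | succ m ih =>
    refine forall_cell (P := fun x => 0 < upPot (m + 2) x → 1 / 4 ≤ upPot (m + 1) x)
      (fun i x h => ?_) x h
    by_cases hi : i = 2
    · subst hi; rw [upPot_two] at h ⊢; exact ih x h
    · rw [upPot_ne_two hi] at h; exact (lt_irrefl _ h).elim

/-- The equilibrium potential of `q₀` in the ball `B(q₀, 2⁻⁽ᵐ⁺¹⁾)`. -/
def ballPot (m : ℕ) : C(K, ℝ) := glue (upPot m) 0 (lowPot m) 0

lemma ballPot_matches (m : ℕ) : Matches (upPot m) 0 (lowPot m) 0 := by simp [Matches]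

lemma ballPot_zero (m : ℕ) (x : K) : ballPot m (cellMap 0 x) = upPot m x :=
  glue_zero (ballPot_matches m) x

lemma ballPot_two (m : ℕ) (x : K) : ballPot m (cellMap 2 x) = lowPot m x :=
  glue_two (ballPot_matches m) x

lemma ballPot_right {i : Fin 4} (hi : i = 1 ∨ i = 3) (m : ℕ) (x : K) :
    ballPot m (cellMap i x) = 0 := by
  rcases hi with rfl | rfl
  · exact glue_one (ballPot_matches m) x
  · exact glue_three (ballPot_matches m) x

@[simp] lemma ballPot_q₀ (m : ℕ) : ballPot m q₀ = 1 := (ballPot_two m q₁).trans (lowPot_q₁ m)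

lemma ballPot_mem (m : ℕ) : ∀ x, 0 ≤ ballPot m x ∧ ballPot m x ≤ 1 := by
  refine forall_cell fun i x => ?_
  rcases eq_zero_or_one_or i with (rfl | rfl) | (rfl | rfl)
  · rw [ballPot_zero]; exact upPot_mem m x
  · rw [ballPot_right (by simp)]; norm_num
  · rw [ballPot_two]; exact lowPot_mem m x
  · rw [ballPot_right (by simp)]; norm_num

lemma ballPot_mem_domain (m : ℕ) : ballPot m ∈ domain :=
  glue_mem_domain (ballPot_matches m) (upPot_mem_domain m) zero_mem_domain (lowPot_mem_domain m)
    zero_mem_domain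

lemma energy_ballPot (m : ℕ) {v : C(K, ℝ)} (hv : v ∈ domain)
    (h0 : ∀ x, ballPot m x = 0 → v x = 0) :
    energy (ballPot m) v = (3 * 2 ^ m + 6 * 4 ^ m) * v q₀ := by
  rw [ballPot, energy_glue_left (ballPot_matches m) (upPot_mem_domain m) zero_mem_domain
    (lowPot_mem_domain m) zero_mem_domain hv, energy_zero_left, energy_zero_left,
    energy_upPot m (comp_mem_domain hv 0) fun x hx => h0 _ ((ballPot_zero m x).trans hx),
    energy_lowPot m (comp_mem_domain hv 2) fun x hx => h0 _ ((ballPot_two m x).trans hx)]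
  simp only [comp_cell_apply, cellMap_zero_q₂, q₀]
  ring

lemma res_q₀_zero (x : K) : res q₀ (cellMap 0 x) = res q₂ x / 2 := by
  rw [q₀_eq, res_cell]

lemma res_q₀_two (x : K) : res q₀ (cellMap 2 x) = res q₁ x / 2 := by
  rw [q₀, res_cell]

/-- The ball `B(q₀, 2⁻⁽ᵐ⁺¹⁾)` is the set where its equilibrium potential is positive. -/
lemma res_q₀_lt_iff (m : ℕ) (x : K) : res q₀ x < (1 / 2) ^ (m + 1) ↔ 0 < ballPot m x := by
  have h1 : ((1 : ℝ) / 2) ^ (m + 1) ≤ 1 / 2 := by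
    have : ((1 : ℝ) / 2) ^ m ≤ 1 := pow_le_one₀ (by norm_num) (by norm_num)
    rw [pow_succ]; linarith
  refine forall_cell (P := fun x => res q₀ x < (1 / 2) ^ (m + 1) ↔ 0 < ballPot m x)
    (fun i x => ?_) x
  rcases eq_zero_or_one_or i with (rfl | rfl) | (rfl | rfl)
  · rw [ballPot_zero, res_q₀_zero, ← res_q₂_lt_iff, pow_succ]
    constructor <;> intro <;> linarith
  · have := half_le_res_q₀ (i := 1) (by simp) x
    rw [ballPot_right (by simp)]
    constructor <;> intro <;> linarith
  · rw [ballPot_two, res_q₀_two, ← res_q₁_lt_iff, pow_succ]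
    constructor <;> intro <;> linarith
  · have := half_le_res_q₀ (i := 3) (by simp) x
    rw [ballPot_right (by simp)]
    constructor <;> intro <;> linarith

/-- The equilibrium potential is bounded below on the ball of half the radius. -/
lemma quarter_le_ballPot (m : ℕ) (x : K) (h : 0 < ballPot (m + 1) x) : 1 / 4 ≤ ballPot m x := by
  refine forall_cell (P := fun x => 0 < ballPot (m + 1) x → 1 / 4 ≤ ballPot m x)
    (fun i x h => ?_) x h
  rcases eq_zero_or_one_or i with (rfl | rfl) | (rfl | rfl)
  · rw [ballPot_zero] at h ⊢; exact quarter_le_upPot m x h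
  · rw [ballPot_right (by simp)] at h; exact (lt_irrefl _ h).elim
  · rw [ballPot_two] at h ⊢; exact quarter_le_lowPot m x h
  · rw [ballPot_right (by simp)] at h; exact (lt_irrefl _ h).elim

lemma dilatedB_one (m : ℕ) : dilatedB 1 (m + 1) = {x | 0 < ballPot m x} := by
  ext x
  rw [dilatedB, mem_ball_iff, one_mul]
  exact res_q₀_lt_iff m x

lemma isOpen_dilatedB_one (m : ℕ) : IsOpen (dilatedB 1 (m + 1)) := by
  rw [dilatedB_one]
  exact isOpen_lt continuous_const (ballPot m).continuous

/-! ### Potentials with boundary value one on a small piece of the Cantor set -/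

/-- The function vanishing at `q₁`, harmonic off `q₁` and the Cantor set, and equal to the indicator
function of `F_{2ᵏ}(cantor)` on the Cantor set. Passing from `k` to `k + 1` halves its current at
`q₁`. -/
def branchPot : ℕ → C(K, ℝ)
  | 0 => H
  | k + 1 => glue (affine 0 (3 / 4 * (1 / 2) ^ k) g₂) 0
      (affine (3 / 4 * (1 / 2) ^ k) (-(3 / 4 * (1 / 2) ^ k)) H + branchPot k) 0

@[simp] lemma branchPot_q₁ (k : ℕ) : branchPot k q₁ = 0 := by
  induction k with
  | zero => exact H_q₁
  | succ k ih =>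
    have h : Matches (affine 0 (3 / 4 * (1 / 2) ^ k) g₂) 0
        (affine (3 / 4 * (1 / 2) ^ k) (-(3 / 4 * (1 / 2) ^ k)) H + branchPot k) 0 := by
      simp [Matches, ih]
    exact (glue_q₁ h).trans (by simp)

lemma branchPot_matches (k : ℕ) : Matches (affine 0 (3 / 4 * (1 / 2) ^ k) g₂) 0
    (affine (3 / 4 * (1 / 2) ^ k) (-(3 / 4 * (1 / 2) ^ k)) H + branchPot k) 0 := by
  simp [Matches]

lemma branchPot_zero (k : ℕ) (x : K) :
    branchPot (k + 1) (cellMap 0 x) = 3 / 4 * (1 / 2) ^ k * g₂ x :=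
  (glue_zero (branchPot_matches k) x).trans (zero_add _)

lemma branchPot_two (k : ℕ) (x : K) : branchPot (k + 1) (cellMap 2 x) =
    3 / 4 * (1 / 2) ^ k * (1 - H x) + branchPot k x := by
  refine (glue_two (branchPot_matches k) x).trans ?_
  rw [ContinuousMap.add_apply, affine_apply]
  ring

lemma branchPot_right {i : Fin 4} (hi : i = 1 ∨ i = 3) (k : ℕ) (x : K) :
    branchPot (k + 1) (cellMap i x) = 0 := by
  rcases hi with rfl | rfl
  · exact glue_one (branchPot_matches k) x
  · exact glue_three (branchPot_matches k) x

lemma branchPot_nonneg (k : ℕ) (x : K) : 0 ≤ branchPot k x := by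
  induction k generalizing x with
  | zero => exact (H_mem x).1
  | succ k ih =>
    refine forall_cell (P := fun x => 0 ≤ branchPot (k + 1) x) (fun i x => ?_) x
    have := g₂_mem x
    have := H_mem x
    rcases eq_zero_or_one_or i with (rfl | rfl) | (rfl | rfl)
    · rw [branchPot_zero]
      exact mul_nonneg (by positivity) (by linarith)
    · rw [branchPot_right (by simp)]
    · rw [branchPot_two]
      exact add_nonneg (mul_nonneg (by positivity) (by linarith)) (ih x)
    · rw [branchPot_right (by simp)]

lemma branchPot_mem_domain (k : ℕ) : branchPot k ∈ domain := by
  induction k with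
  | zero => exact H_mem_domain
  | succ k ih =>
    exact glue_mem_domain (branchPot_matches k) (affine_mem_domain _ _ g₂_mem_domain)
      zero_mem_domain (add_mem_domain (affine_mem_domain _ _ H_mem_domain) ih) zero_mem_domain

/-- The current at `q₁` is `3 · 2⁻ᵏ`; the weight `3/4 · 2⁻ᵏ` in `branchPot` is the value at `q₀`
for which the currents there cancel. -/
lemma energy_branchPot (k : ℕ) {v : C(K, ℝ)} (hv : v ∈ domain) (h0 : ∀ x ∈ cantor, v x = 0) :
    energy (branchPot k) v = -(3 * (1 / 2) ^ k) * v q₁ := by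
  induction k generalizing v with
  | zero => rw [branchPot, energy_H hv h0]; ring
  | succ k ih =>
    have h2 : ∀ x ∈ cantor, v.comp (cell 2) x = 0 := fun x hx =>
      h0 _ ((mem_cantor_lower (by decide) x).2 hx)
    have hv2 := comp_mem_domain hv 2
    rw [branchPot, energy_glue_left (branchPot_matches k) (affine_mem_domain _ _ g₂_mem_domain)
      zero_mem_domain (add_mem_domain (affine_mem_domain _ _ H_mem_domain) (branchPot_mem_domain k))
      zero_mem_domain hv, energy_zero_left, energy_zero_left,
      energy_affine_left _ _ g₂_mem_domain (comp_mem_domain hv 0),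
      energy_add_left (affine_mem_domain _ _ H_mem_domain) (branchPot_mem_domain k) hv2,
      energy_affine_left _ _ H_mem_domain hv2, energy_g₂, energy_H hv2 h2, ih hv2 h2]
    simp only [comp_cell_apply, cellMap_zero_q₁, cellMap_zero_q₂]
    ring

lemma image_wordMap_cons (i : Fin 4) (w : List (Fin 4)) (S : Set K) :
    wordMap (i :: w) '' S = cellMap i '' (wordMap w '' S) := by
  rw [wordMap, image_comp]

lemma indicator_cell (i : Fin 4) (S : Set K) (x : K) :
    (cellMap i '' S).indicator (1 : K → ℝ) (cellMap i x) = S.indicator 1 x := by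
  classical
  simp only [indicator_apply, (cellMap_injective i).mem_set_image, Pi.one_apply]

lemma branchPot_of_mem_cantor (k : ℕ) {x : K} (hx : x ∈ cantor) :
    branchPot k x = (wordMap (List.replicate k 2) '' cantor).indicator 1 x := by
  induction k generalizing x with
  | zero =>
    have h1 : ¬ H x < 1 := fun h => (H_lt_one_iff x).1 h hx
    have h2 : H x = 1 := le_antisymm (H_mem x).2 (not_lt.1 h1)
    simp [branchPot, wordMap, hx, h2]
  | succ k ih =>
    refine forall_cell (P := fun x => x ∈ cantor → branchPot (k + 1) x =
      (wordMap (List.replicate (k + 1) 2) '' cantor).indicator 1 x) (fun i x hx => ?_) x hx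
    rw [List.replicate_succ, image_wordMap_cons]
    rcases eq_zero_or_one_or i with hi | (rfl | rfl)
    · exact (not_mem_cantor_upper hi x hx).elim
    · have hx' := (mem_cantor_lower (by decide) x).1 hx
      have h1 : ¬ H x < 1 := fun h => (H_lt_one_iff x).1 h hx'
      have h2 : H x = 1 := le_antisymm (H_mem x).2 (not_lt.1 h1)
      rw [branchPot_two, indicator_cell, ← ih hx', h2]
      ring
    · rw [branchPot_right (by simp), indicator_of_notMem]
      rintro ⟨y, -, hy⟩
      exact cell_two_three hy

/-- The extension of `f`, with `f(q₁) = 0`, from the cell `F_ω(K)` with `ω ∈ {0,1}ⁿ` to `K` by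
constants on the complementary components. -/
def lift : List (Fin 4) → C(K, ℝ) → C(K, ℝ)
  | [], f => f
  | i :: w, f => if i = 0 then glue (lift w f) 0 (.const K (lift w f q₂)) 0
      else glue 0 (lift w f) 0 (.const K (lift w f q₃))

section Lift

variable {f : C(K, ℝ)} (hf : f q₁ = 0)

include hf

lemma lift_q₁ (w : List (Fin 4)) : lift w f q₁ = 0 := by
  induction w with
  | nil => exact hf
  | cons i w ih =>
    have h0 : Matches (lift w f) 0 (.const K (lift w f q₂)) 0 := by simp [Matches, ih]
    have h1 : Matches 0 (lift w f) 0 (.const K (lift w f q₃)) := by simp [Matches, ih]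
    rw [lift]
    split_ifs
    · rw [glue_q₁ h0, ih]
    · exact glue_q₁ h1

lemma lift_matches_zero (w : List (Fin 4)) :
    Matches (lift w f) 0 (.const K (lift w f q₂)) 0 := by
  simp [Matches, lift_q₁ hf w]

lemma lift_matches_one (w : List (Fin 4)) :
    Matches 0 (lift w f) 0 (.const K (lift w f q₃)) := by
  simp [Matches, lift_q₁ hf w]

lemma lift_cons_self {i : Fin 4} (hi : i = 0 ∨ i = 1) (w : List (Fin 4)) (x : K) :
    lift (i :: w) f (cellMap i x) = lift w f x := by
  rcases hi with rfl | rfl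
  · exact glue_zero (lift_matches_zero hf w) x
  · exact glue_one (lift_matches_one hf w) x

lemma lift_cons_other {i j : Fin 4} (hi : i = 0 ∨ i = 1) (hj : j = 0 ∨ j = 1) (hij : i ≠ j)
    (w : List (Fin 4)) (x : K) : lift (i :: w) f (cellMap j x) = 0 := by
  rcases hi with rfl | rfl <;> rcases hj with rfl | rfl
  · exact (hij rfl).elim
  · exact glue_one (lift_matches_zero hf w) x
  · exact glue_zero (lift_matches_one hf w) x
  · exact (hij rfl).elim

lemma lift_nonneg (h : ∀ x, 0 ≤ f x) (w : List (Fin 4)) (x : K) : 0 ≤ lift w f x := by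
  induction w generalizing x with
  | nil => exact h x
  | cons i w ih =>
    refine forall_cell (P := fun x => 0 ≤ lift (i :: w) f x) (fun j x => ?_) x
    have h0 := lift_matches_zero hf w
    have h1 := lift_matches_one hf w
    rw [lift]
    split_ifs <;> rcases eq_zero_or_one_or j with (rfl | rfl) | (rfl | rfl)
    · rw [glue_zero h0]; exact ih x
    · exact (glue_one h0 x).ge
    · rw [glue_two h0]; exact ih q₂
    · exact (glue_three h0 x).ge
    · exact (glue_zero h1 x).ge
    · rw [glue_one h1]; exact ih x
    · exact (glue_two h1 x).ge
    · rw [glue_three h1]; exact ih q₃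

lemma lift_mem_domain (h : f ∈ domain) (w : List (Fin 4)) : lift w f ∈ domain := by
  induction w with
  | nil => exact h
  | cons i w ih =>
    rw [lift]
    split_ifs
    · exact glue_mem_domain (lift_matches_zero hf w) ih zero_mem_domain (const_mem_domain _)
        zero_mem_domain
    · exact glue_mem_domain (lift_matches_one hf w) zero_mem_domain ih zero_mem_domain
        (const_mem_domain _)

/-- Each of the letters of `w` doubles the current. -/
lemma energy_lift (h : f ∈ domain) {d : ℝ}
    (hd : ∀ v ∈ domain, (∀ x ∈ cantor, v x = 0) → energy f v = -d * v q₁) {w : List (Fin 4)}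
    (hw : ∀ i ∈ w, i = 0 ∨ i = 1) {v : C(K, ℝ)} (hv : v ∈ domain)
    (h0 : ∀ x, lowPot w.length x = 0 → v x = 0) :
    energy (lift w f) v = -(2 ^ w.length * d) * v q₁ := by
  induction w generalizing v with
  | nil =>
    rw [lift, hd v hv fun x hx => h0 x ((lowPot_zero_eq_zero_iff x).2 hx)]
    simp
  | cons i w ih =>
    have hi := hw i (by simp)
    have e := ih (fun j hj => hw j (by simp [hj])) (comp_mem_domain hv i)
      fun x hx => h0 _ ((lowPot_upper hi w.length x).trans hx)
    have z := zero_mem_domain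
    have c := const_mem_domain
    have l := lift_mem_domain hf h w
    rw [lift]
    rcases hi with rfl | rfl
    · rw [if_pos rfl, energy_glue_left (lift_matches_zero hf w) l z (c _) z hv, e]
      simp only [energy_zero_left, energy_const_left, comp_cell_apply, cellMap_zero_q₁,
        List.length_cons]
      ring
    · rw [if_neg (by decide), energy_glue_left (lift_matches_one hf w) z l z (c _) hv, e]
      simp only [energy_zero_left, energy_const_left, comp_cell_apply, cellMap_one_q₁,
        List.length_cons]
      ring

end Lift

/-- The union of the cells `F_ω(K)` over the words `ω ∈ {0,1}ᵐ`. -/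
def topCells : ℕ → Set K
  | 0 => univ
  | m + 1 => cellMap 0 '' topCells m ∪ cellMap 1 '' topCells m

lemma isCompact_topCells (m : ℕ) : IsCompact (topCells m) := by
  have : CompactSpace K := isCompact_iff_compactSpace.1 treeSet_compact
  induction m with
  | zero => exact isCompact_univ
  | succ m ih => exact (ih.image (cellMap_continuous 0)).union (ih.image (cellMap_continuous 1))

lemma mem_topCells (m : ℕ) (x : K) (h : 0 < lowPot m x) : x ∈ topCells m := by
  induction m generalizing x with
  | zero => exact mem_univ x
  | succ m ih =>
    refine forall_cell (P := fun x => 0 < lowPot (m + 1) x → x ∈ topCells (m + 1))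
      (fun i x h => ?_) x h
    rcases eq_zero_or_one_or i with hi | hi
    · rw [lowPot_upper hi] at h
      rcases hi with rfl | rfl
      · exact Or.inl ⟨x, ih x h, rfl⟩
      · exact Or.inr ⟨x, ih x h, rfl⟩
    · rw [lowPot_lower hi] at h; exact (lt_irrefl _ h).elim

/-- On the boundary of the ball around `q₁` the lifted potential is the required indicator. -/
lemma lift_branchPot_eq (k : ℕ) {w : List (Fin 4)} (hw : ∀ i ∈ w, i = 0 ∨ i = 1) {x : K}
    (hx : x ∈ topCells w.length) (h0 : lowPot w.length x = 0) :
    lift w (branchPot k) x = (wordMap (w ++ List.replicate k 2) '' cantor).indicator 1 x := by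
  induction w generalizing x with
  | nil => exact branchPot_of_mem_cantor k ((lowPot_zero_eq_zero_iff x).1 h0)
  | cons i w ih =>
    have hi := hw i (by simp)
    have key : ∀ j, j = 0 ∨ j = 1 → ∀ y ∈ topCells w.length, cellMap j y = x →
        lift (i :: w) (branchPot k) x =
          (wordMap (i :: w ++ List.replicate k 2) '' cantor).indicator 1 x := by
      rintro j hj y hy rfl
      rw [List.length_cons, lowPot_upper hj] at h0
      rw [List.cons_append, image_wordMap_cons]
      by_cases hij : i = j
      · subst hij
        rw [lift_cons_self (branchPot_q₁ k) hi, indicator_cell,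
          ih (fun j hj => hw j (by simp [hj])) hy h0]
      · rw [lift_cons_other (branchPot_q₁ k) hi hj hij, indicator_of_notMem]
        rintro ⟨z, -, hz⟩
        have hy1 : y = q₁ := by
          rcases hi with rfl | rfl <;> rcases hj with rfl | rfl
          · exact (hij rfl).elim
          · exact (cell_zero_one hz).2
          · exact (cell_zero_one hz.symm).1
          · exact (hij rfl).elim
        rw [hy1, lowPot_q₁] at h0
        exact one_ne_zero h0
    rcases hx with ⟨y, hy, h⟩ | ⟨y, hy, h⟩
    · exact key 0 (by simp) y hy h
    · exact key 1 (by simp) y hy h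

/-- Near the centre the lifted potential is controlled linearly by the resistance. -/
lemma lift_branchPot_le (k : ℕ) {w : List (Fin 4)} (hw : ∀ i ∈ w, i = 0 ∨ i = 1) {x : K}
    (hx : 0 < lowPot (w.length + 1) x) :
    lift w (branchPot (k + 1)) x ≤ 2 ^ w.length * (3 / 2 * (1 / 2) ^ k) * res q₁ x := by
  induction w generalizing x with
  | nil =>
    refine forall_cell (P := fun x => 0 < lowPot 1 x → branchPot (k + 1) x ≤
      2 ^ 0 * (3 / 2 * (1 / 2) ^ k) * res q₁ x) (fun i x h => ?_) x hx
    rcases eq_zero_or_one_or i with (rfl | rfl) | hi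
    · rw [branchPot_zero, res_q₁_upper (by simp)]
      have := mul_le_mul_of_nonneg_left (g₂_le_res x)
        (show (0 : ℝ) ≤ 3 / 4 * (1 / 2) ^ k by positivity)
      linarith
    · rw [branchPot_right (by simp)]
      have := res_nonneg q₁ (cellMap 1 x)
      positivity
    · rw [lowPot_lower hi] at h; exact (lt_irrefl _ h).elim
  | cons i w ih =>
    have hi := hw i (by simp)
    refine forall_cell (P := fun x => 0 < lowPot (w.length + 2) x →
      lift (i :: w) (branchPot (k + 1)) x ≤
        2 ^ (w.length + 1) * (3 / 2 * (1 / 2) ^ k) * res q₁ x) (fun j x h => ?_) x hx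
    rcases eq_zero_or_one_or j with hj | hj
    · by_cases hij : i = j
      · subst hij
        rw [lowPot_upper hi] at h
        rw [lift_cons_self (branchPot_q₁ _) hi, res_q₁_upper hi]
        have := ih (fun j hj => hw j (by simp [hj])) h
        refine this.trans (le_of_eq ?_)
        ring
      · rw [lift_cons_other (branchPot_q₁ _) hi hj hij]
        have := res_nonneg q₁ (cellMap j x)
        positivity
    · rw [lowPot_lower hj] at h; exact (lt_irrefl _ h).elim

lemma lift_wordMap {f : C(K, ℝ)} (hf : f q₁ = 0) {w : List (Fin 4)}
    (hw : ∀ i ∈ w, i = 0 ∨ i = 1) (x : K) : lift w f (wordMap w x) = f x := by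
  induction w with
  | nil => rfl
  | cons i w ih =>
    change lift (i :: w) f (cellMap i (wordMap w x)) = f x
    rw [lift_cons_self hf (hw i (by simp)), ih fun j hj => hw j (by simp [hj])]

lemma res_q₁_wordMap {w : List (Fin 4)} (hw : ∀ i ∈ w, i = 0 ∨ i = 1) (x : K) :
    res q₁ (wordMap w x) = (1 / 2) ^ w.length * res q₁ x := by
  induction w with
  | nil => simp [wordMap]
  | cons i w ih =>
    change res q₁ (cellMap i (wordMap w x)) = _
    rw [res_q₁_upper (hw i (by simp)), ih fun j hj => hw j (by simp [hj]), List.length_cons]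
    ring

/-! ### The harmonic functions with a small boundary value set -/

/-- The explicit harmonic function in `B(q₀, 2⁻⁽ᵐ⁺¹⁾)` whose boundary value is the indicator of
`F_{2w2ᵏ}(cantor)`: the lifted potential in the cell `F_{2w}(K)`, plus the multiple of the
equilibrium potential which restores the current balance at `q₀`. -/
def phi (m : ℕ) (w : List (Fin 4)) (k : ℕ) : C(K, ℝ) :=
  (2 * (1 / 2) ^ k / (2 ^ (m + 1) + 1) : ℝ) • ballPot m + glue 0 0 (lift w (branchPot k)) 0

lemma bump_matches (w : List (Fin 4)) (k : ℕ) : Matches 0 0 (lift w (branchPot k)) 0 := by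
  simp [Matches, lift_q₁ (branchPot_q₁ k) w]

lemma phi_apply (m : ℕ) (w : List (Fin 4)) (k : ℕ) (x : K) : phi m w k x =
    2 * (1 / 2) ^ k / (2 ^ (m + 1) + 1) * ballPot m x + glue 0 0 (lift w (branchPot k)) 0 x := rfl

lemma bump_ne_two {i : Fin 4} (hi : i ≠ 2) (w : List (Fin 4)) (k : ℕ) (x : K) :
    glue 0 0 (lift w (branchPot k)) 0 (cellMap i x) = 0 := by
  rcases eq_zero_or_one_or i with (rfl | rfl) | (rfl | rfl)
  · exact glue_zero (bump_matches w k) x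
  · exact glue_one (bump_matches w k) x
  · exact (hi rfl).elim
  · exact glue_three (bump_matches w k) x

lemma bump_nonneg (w : List (Fin 4)) (k : ℕ) (x : K) :
    0 ≤ glue 0 0 (lift w (branchPot k)) 0 x := by
  refine forall_cell (P := fun x => 0 ≤ glue 0 0 (lift w (branchPot k)) 0 x) (fun i x => ?_) x
  by_cases hi : i = 2
  · subst hi
    rw [glue_two (bump_matches w k)]
    exact lift_nonneg (branchPot_q₁ k) (branchPot_nonneg k) w x
  · rw [bump_ne_two hi]

lemma phi_nonneg (m : ℕ) (w : List (Fin 4)) (k : ℕ) (x : K) : 0 ≤ phi m w k x := by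
  rw [phi_apply]
  exact add_nonneg (mul_nonneg (by positivity) (ballPot_mem m x).1) (bump_nonneg w k x)

section Word

variable {w : List (Fin 4)} (hw : ∀ i ∈ w, i = 0 ∨ i = 1)

include hw

/-- The coefficient of `ballPot` in `phi` makes the currents at `q₀` cancel. -/
lemma harmonic_phi (μ : Measure K) (k : ℕ) :
    Harmonic μ (dilatedB 1 (w.length + 1)) (phi w.length w k) := by
  have hb := ballPot_mem_domain w.length
  have hl := lift_mem_domain (branchPot_q₁ k) (branchPot_mem_domain k) w
  have z := zero_mem_domain
  have hg := glue_mem_domain (bump_matches w k) z z hl z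
  refine harmonic_of_forall μ (add_mem_domain (smul_mem_domain _ hb) hg) fun v hv h0 => ?_
  rw [dilatedB_one] at h0
  have h0' : ∀ x, ballPot w.length x = 0 → v x = 0 := fun x hx => h0 x (by simp [hx])
  rw [phi, energy_add_left (smul_mem_domain _ hb) hg hv, energy_smul_left _ hb hv,
    energy_ballPot _ hv h0', energy_glue_left (bump_matches w k) z z hl z hv,
    energy_lift (branchPot_q₁ k) (branchPot_mem_domain k) (fun v => energy_branchPot k) hw
      (comp_mem_domain hv 2) fun x hx => h0' _ ((ballPot_two _ x).trans hx)]
  simp only [energy_zero_left, comp_cell_apply]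
  change _ * (_ * v q₀) + 2 * (0 + 0 + _ * v q₀ + 0) = 0
  have h4 : (4 : ℝ) ^ w.length = 2 ^ w.length * 2 ^ w.length := by
    rw [← mul_pow]; norm_num
  rw [h4, pow_succ]
  have : (2 : ℝ) ^ w.length * 2 + 1 ≠ 0 := by positivity
  field_simp
  ring

/-- The closure of the ball lies in `F₀(K)` and the cells `F_{2v}(K)`, `v ∈ {0,1}ᵐ`, so only the
boundary values on these cells matter. -/
lemma phi_of_mem_frontier (k : ℕ) {x : K} (hx : x ∈ frontier (dilatedB 1 (w.length + 1))) :
    phi w.length w k x = (wordMap (2 :: (w ++ List.replicate k 2)) '' cantor).indicator 1 x := by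
  have : CompactSpace K := isCompact_iff_compactSpace.1 treeSet_compact
  have hB := isOpen_dilatedB_one w.length
  have hx0 : ballPot w.length x = 0 := by
    have : x ∉ dilatedB 1 (w.length + 1) := fun h => hx.2 (by rwa [hB.interior_eq])
    rw [dilatedB_one, mem_ofPred_eq, not_lt] at this
    exact le_antisymm this (ballPot_mem _ x).1
  have hcl : x ∈ cellMap 0 '' univ ∪ cellMap 2 '' topCells w.length := by
    refine closure_minimal ?_ ?_ hx.1
    · rw [dilatedB_one]
      refine fun y hy => forall_cell (P := fun y => 0 < ballPot w.length y →
        y ∈ cellMap 0 '' univ ∪ cellMap 2 '' topCells w.length) (fun i y h => ?_) y hy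
      rcases eq_zero_or_one_or i with (rfl | rfl) | (rfl | rfl)
      · exact Or.inl ⟨y, mem_univ y, rfl⟩
      · rw [ballPot_right (by simp)] at h; exact (lt_irrefl _ h).elim
      · rw [ballPot_two] at h
        exact Or.inr ⟨y, mem_topCells _ y h, rfl⟩
      · rw [ballPot_right (by simp)] at h; exact (lt_irrefl _ h).elim
    · exact ((isCompact_univ.image (cellMap_continuous 0)).union
        ((isCompact_topCells _).image (cellMap_continuous 2))).isClosed
  rw [phi_apply, hx0, mul_zero, zero_add, image_wordMap_cons]
  rcases hcl with ⟨y, -, rfl⟩ | ⟨y, hy, rfl⟩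
  · rw [bump_ne_two (by decide), indicator_of_notMem]
    rintro ⟨z, -, hz⟩
    -- the only common point of the two cells is `q₀`, the centre of the ball
    rw [ballPot_zero, (cell_zero_two hz.symm).1, upPot_q₂] at hx0
    exact one_ne_zero hx0
  · rw [ballPot_two] at hx0
    rw [glue_two (bump_matches w k), indicator_cell, lift_branchPot_eq k hw hy hx0]

lemma isPhi'_phi (μ : Measure K) (k : ℕ) : IsPhi' μ (w.length + 1) w k (phi w.length w k) :=
  ⟨harmonic_phi hw μ k, fun _ hx => phi_of_mem_frontier hw k hx⟩

lemma eqOn_phi (μ : Measure K) (k : ℕ) {ψ : C(K, ℝ)} (h : IsPhi' μ (w.length + 1) w k ψ) :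
    EqOn ψ (phi w.length w k) (dilatedB 1 (w.length + 1)) := by
  refine eqOn_of_harmonic μ (isOpen_dilatedB_one _) ⟨q₁, ?_⟩ h.1 (harmonic_phi hw μ k)
    fun x hx => ?_
  · rw [dilatedB_one, mem_compl_iff, mem_ofPred_eq, not_lt, ← cellMap_one_q₁,
      ballPot_right (by simp)]
  · rw [h.2 x hx, phi_of_mem_frontier hw k hx]

end Word

lemma g₂_replicate (j : ℕ) : g₂ (wordMap (List.replicate j 0) q₂) = (1 / 2) ^ j := by
  induction j with
  | zero => simp [wordMap]
  | succ j ih =>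
    rw [List.replicate_succ]
    change g₂ (cellMap 0 (wordMap (List.replicate j 0) q₂)) = _
    rw [g₂_zero, ih, pow_succ]
    ring

/-! ### The oscillation of these functions near the centre -/

lemma mem_dilatedB {ε : ℝ} {n : ℕ} {x : K} : x ∈ dilatedB ε n ↔ res q₀ x < ε * (1 / 2) ^ n :=
  mem_ball_iff

lemma ballPot_pos_of_mem {ε : ℝ} (hε : ε ≤ 1 / 2) {m : ℕ} {x : K} (hx : x ∈ dilatedB ε (m + 1)) :
    0 < ballPot (m + 1) x := by
  rw [mem_dilatedB] at hx
  rw [← res_q₀_lt_iff]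
  refine hx.trans_le ?_
  have : (0 : ℝ) ≤ (1 / 2) ^ (m + 1) := by positivity
  rw [pow_succ _ (m + 1)]
  nlinarith

lemma quarter_le_phi {ε : ℝ} (hε : ε ≤ 1 / 2) {m : ℕ} (w : List (Fin 4)) (k : ℕ) {x : K}
    (hx : x ∈ dilatedB ε (m + 1)) : 2 * (1 / 2) ^ k / (2 ^ (m + 1) + 1) / 4 ≤ phi m w k x := by
  have h1 := quarter_le_ballPot m x (ballPot_pos_of_mem hε hx)
  have h2 := bump_nonneg w k x
  have h3 : (0 : ℝ) ≤ 2 * (1 / 2) ^ k / (2 ^ (m + 1) + 1) := by positivity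
  rw [phi_apply]
  nlinarith

lemma phi_q₀ (m : ℕ) (w : List (Fin 4)) (k : ℕ) :
    phi m w k q₀ = 2 * (1 / 2) ^ k / (2 ^ (m + 1) + 1) := by
  have : glue 0 0 (lift w (branchPot k)) 0 q₀ = 0 :=
    (glue_two (bump_matches w k) q₁).trans (lift_q₁ (branchPot_q₁ k) w)
  rw [phi_apply, ballPot_q₀, this]
  ring

lemma phi_le {ε : ℝ} (h0 : 0 < ε) (hε : ε ≤ 1 / 2) {w : List (Fin 4)}
    (hw : ∀ i ∈ w, i = 0 ∨ i = 1) (k : ℕ) {x : K} (hx : x ∈ dilatedB ε (w.length + 1)) :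
    phi w.length w (k + 1) x ≤
      2 * (1 / 2) ^ (k + 1) / (2 ^ (w.length + 1) + 1) + 3 / 2 * (1 / 2) ^ k * ε := by
  have h1 := (ballPot_mem w.length x).2
  have h3 : (0 : ℝ) ≤ 2 * (1 / 2) ^ (k + 1) / (2 ^ (w.length + 1) + 1) := by positivity
  have key : glue 0 0 (lift w (branchPot (k + 1))) 0 x ≤ 3 / 2 * (1 / 2) ^ k * ε := by
    have hp := ballPot_pos_of_mem hε hx
    rw [mem_dilatedB] at hx
    obtain ⟨i, y, rfl⟩ := exists_cell x
    by_cases hi : i = 2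
    · subst hi
      rw [ballPot_two] at hp
      rw [res_q₀_two] at hx
      rw [glue_two (bump_matches w _)]
      refine (lift_branchPot_le k hw hp).trans ?_
      calc (2 : ℝ) ^ w.length * (3 / 2 * (1 / 2) ^ k) * res q₁ y
          ≤ 2 ^ w.length * (3 / 2 * (1 / 2) ^ k) * (2 * (ε * (1 / 2) ^ (w.length + 1))) := by
            gcongr; linarith
        _ = 3 / 2 * (1 / 2) ^ k * ε * (2 ^ w.length * (1 / 2) ^ w.length) := by ring
        _ = _ := by rw [← mul_pow]; norm_num
    · rw [bump_ne_two hi]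
      positivity
  rw [phi_apply]
  nlinarith

/-- The lower bound for the supremum comes from a point on the left edge of `F_{2w}(K)`. -/
lemma exists_le_phi {ε : ℝ} (h0 : 0 < ε) (hε : ε ≤ 1 / 2) {w : List (Fin 4)}
    (hw : ∀ i ∈ w, i = 0 ∨ i = 1) (k : ℕ) : ∃ x ∈ dilatedB ε (w.length + 1),
    3 / 4 * (1 / 2) ^ k * ε ≤ phi w.length w (k + 1) x := by
  obtain ⟨n, hn1, hn2⟩ := exists_nat_pow_near_of_lt_one (x := 2 * ε) (y := (1 / 2 : ℝ))
    (by linarith) (by linarith) (by norm_num) (by norm_num)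
  set z := wordMap (List.replicate (n + 1) 0) q₂ with hz
  have hrz : res q₁ z = (1 / 2) ^ (n + 1) := by
    rw [hz, res_q₁_wordMap (fun i hi => Or.inl (List.eq_of_mem_replicate hi)), res_q₁_q₂]
    simp
  refine ⟨cellMap 2 (wordMap w (cellMap 0 z)), ?_, ?_⟩
  · rw [mem_dilatedB, res_q₀_two, res_q₁_wordMap hw, res_q₁_upper (by simp), hrz,
      pow_succ _ w.length]
    have : (0 : ℝ) < (1 / 2) ^ w.length := by positivity
    nlinarith
  · rw [phi_apply, glue_two (bump_matches w _), lift_wordMap (branchPot_q₁ _) hw, branchPot_zero, hz,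
      g₂_replicate]
    have h1 := (ballPot_mem w.length (cellMap 2 (wordMap w (cellMap 0 z)))).1
    have h2 : (0 : ℝ) ≤ 2 * (1 / 2) ^ (k + 1) / (2 ^ (w.length + 1) + 1) := by positivity
    have h3 := mul_nonneg h2 h1
    have h4 : ε ≤ (1 / 2) ^ (n + 1) := by rw [pow_succ]; linarith
    have h5 := mul_le_mul_of_nonneg_left h4 (show (0 : ℝ) ≤ 3 / 4 * (1 / 2) ^ k by positivity)
    linarith

/-- The ratio of infimum and supremum over the concentric balls. -/
theorem ratio_bounds {ε : ℝ} (h0 : 0 < ε) (hε : ε ≤ 1 / 2) {w : List (Fin 4)}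
    (hw : ∀ i ∈ w, i = 0 ∨ i = 1) (k : ℕ) :
    (12 : ℝ)⁻¹ * (2 ^ (w.length + 1) * ε + 1)⁻¹ ≤
        sInf (phi w.length w (k + 1) '' dilatedB ε (w.length + 1)) /
          sSup (phi w.length w (k + 1) '' dilatedB ε (w.length + 1)) ∧
      sInf (phi w.length w (k + 1) '' dilatedB ε (w.length + 1)) /
          sSup (phi w.length w (k + 1) '' dilatedB ε (w.length + 1)) ≤
        12 * (2 ^ (w.length + 1) * ε + 1)⁻¹ := by
  set S := phi w.length w (k + 1) '' dilatedB ε (w.length + 1)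
  set N : ℝ := 2 ^ (w.length + 1) with hN
  set a : ℝ := 2 * (1 / 2) ^ (k + 1) / (N + 1) with ha
  have hN1 : 1 ≤ N := one_le_pow₀ (by norm_num)
  have ha0 : 0 < a := by positivity
  have hak : (1 / 2 : ℝ) ^ k = a * (N + 1) := by
    rw [ha, div_mul_cancel₀ _ (by positivity), pow_succ]; ring
  have hq : a ∈ S := by
    refine ⟨q₀, ?_, phi_q₀ _ _ _⟩
    rw [mem_dilatedB, res_self]
    positivity
  have hlow : ∀ y ∈ S, a / 4 ≤ y := by
    rintro _ ⟨x, hx, rfl⟩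
    exact quarter_le_phi hε w (k + 1) hx
  have hup : ∀ y ∈ S, y ≤ a + 3 / 2 * (1 / 2) ^ k * ε := by
    rintro _ ⟨x, hx, rfl⟩
    exact phi_le h0 hε hw k hx
  have hbb : BddBelow S := ⟨_, hlow⟩
  have hba : BddAbove S := ⟨_, hup⟩
  have i1 : a / 4 ≤ sInf S := le_csInf ⟨a, hq⟩ hlow
  have i2 : sInf S ≤ a := csInf_le hbb hq
  have s1 : a ≤ sSup S := le_csSup hba hq
  have s2 : sSup S ≤ a + 3 / 2 * (1 / 2) ^ k * ε := csSup_le ⟨a, hq⟩ hup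
  have s3 : 3 / 4 * (1 / 2) ^ k * ε ≤ sSup S := by
    obtain ⟨x, hx, h⟩ := exists_le_phi h0 hε hw k
    exact h.trans (le_csSup hba ⟨x, hx, rfl⟩)
  rw [hak] at s2 s3
  have hS : 0 < sSup S := by linarith
  have hp : 0 < N * ε + 1 := by positivity
  have haε : 0 < a * ε := by positivity
  have haN : a * ε ≤ a * ε * N := le_mul_of_one_le_right haε.le hN1
  constructor
  · rw [← mul_inv, inv_le_iff_one_le_mul₀ (by positivity), div_mul_eq_mul_div, le_div_iff₀ hS]
    have := mul_le_mul_of_nonneg_right i1 hp.le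
    linarith
  · rw [← div_eq_mul_inv, div_le_div_iff₀ hS hp]
    have := mul_le_mul_of_nonneg_right i2 hp.le
    linarith

/-! ### Failure of the Harnack inequality -/

lemma le_of_ae_le_of_isOpen {μ : Measure K} [μ.IsOpenPosMeasure] {O : Set K} (hO : IsOpen O)
    {u v : K → ℝ} (hu : Continuous u) (hv : Continuous v) (h : ∀ᵐ y ∂(μ.restrict O), u y ≤ v y)
    {y : K} (hy : y ∈ O) : u y ≤ v y := by
  rw [ae_restrict_iff' hO.measurableSet] at h
  by_contra! hlt
  have hopen : IsOpen (O ∩ {z | v z < u z}) := hO.inter (isOpen_lt hv hu)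
  have hzero : μ (O ∩ {z | v z < u z}) = 0 := by
    refine measure_mono_null (fun z hz => ?_) h
    exact fun hle => absurd (hle hz.1) (not_le.2 hz.2)
  have := (hopen.measure_eq_zero_iff μ).1 hzero
  exact (this ▸ (⟨hy, hlt⟩ : y ∈ O ∩ {z | v z < u z}) : y ∈ (∅ : Set K))

lemma le_essSup_of_isOpen {μ : Measure K} [μ.IsOpenPosMeasure] {O B : Set K} (hO : IsOpen O)
    (hOB : O ⊆ B) (u : C(K, ℝ)) {y : K} (hy : y ∈ O) : u y ≤ essSup u (μ.restrict B) := by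
  have : CompactSpace K := isCompact_iff_compactSpace.1 treeSet_compact
  obtain ⟨M, hM⟩ := (isCompact_range u.continuous).bddAbove
  have hb : IsBoundedUnder (· ≤ ·) (ae (μ.restrict B)) u :=
    isBoundedUnder_of ⟨M, fun x => hM ⟨x, rfl⟩⟩
  exact le_of_ae_le_of_isOpen hO u.continuous continuous_const
    (ae_restrict_of_ae_restrict_of_subset hOB (ae_le_essSup hb)) hy

lemma essInf_le_of_isOpen {μ : Measure K} [μ.IsOpenPosMeasure] {O B : Set K} (hO : IsOpen O)
    (hOB : O ⊆ B) (u : C(K, ℝ)) {y : K} (hy : y ∈ O) : essInf u (μ.restrict B) ≤ u y := by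
  have : CompactSpace K := isCompact_iff_compactSpace.1 treeSet_compact
  obtain ⟨M, hM⟩ := (isCompact_range u.continuous).bddBelow
  have hb : IsBoundedUnder (· ≥ ·) (ae (μ.restrict B)) u :=
    isBoundedUnder_of ⟨M, fun x => hM ⟨x, rfl⟩⟩
  exact le_of_ae_le_of_isOpen hO continuous_const u.continuous
    (ae_restrict_of_ae_restrict_of_subset hOB (ae_essInf_le hb)) hy

/-- (EHI) bounds the ratio of the infimum and the supremum of `φ'` over `δBₙ` from below uniformly
in `n`, whereas for fixed `δ` this ratio tends to `0`. Taking for `δ` a power of `1/2` makes `δBₙ`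
open. -/
theorem not_EHI (μ : Measure K) [μ.IsOpenPosMeasure] : ¬ EHI μ := by
  rintro ⟨ε, hε0, -, C, hC, h⟩
  obtain ⟨j₀, hj₀⟩ := exists_pow_lt_of_lt_one hε0 (by norm_num : (1 / 2 : ℝ) < 1)
  set j := j₀ + 1 with hj
  set δ : ℝ := (1 / 2) ^ j with hδ
  have hδ0 : 0 < δ := by positivity
  have hδ1 : δ ≤ 1 / 2 := by
    have : (1 / 2 : ℝ) ^ j₀ ≤ 1 := pow_le_one₀ (by norm_num) (by norm_num)
    rw [hδ, hj, pow_succ]; linarith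
  have hδε : δ ≤ ε := by
    have : (0 : ℝ) < (1 / 2) ^ j₀ := by positivity
    rw [hδ, hj, pow_succ]; linarith
  have key : ∀ m : ℕ, 2 ^ (m + 1) * δ + 1 ≤ 12 * C := by
    intro m
    set w : List (Fin 4) := List.replicate m 0 with hw'
    have hw : ∀ i ∈ w, i = 0 ∨ i = 1 := fun i hi => Or.inl (List.eq_of_mem_replicate hi)
    have hm : w.length = m := by simp [hw']
    obtain ⟨r1, r2⟩ := ratio_bounds hδ0 hδ1 hw 0
    have hharm := harmonic_phi hw μ (0 + 1)
    have hnn := phi_nonneg w.length w (0 + 1)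
    rw [hm] at r1 r2 hharm hnn
    generalize phi m w (0 + 1) = u at r1 r2 hharm hnn
    have hO : IsOpen (dilatedB δ (m + 1)) := by
      have : dilatedB δ (m + 1) = dilatedB 1 (m + j + 1) := by
        rw [dilatedB, dilatedB, hδ, ← pow_add, one_mul]
        congr 2; ring
      rw [this]
      exact isOpen_dilatedB_one _
    have hOB : dilatedB δ (m + 1) ⊆ ball q₀ (ε * (1 / 2) ^ (m + 1)) := fun x hx => by
      rw [mem_ball_iff]
      refine (mem_dilatedB.1 hx).trans_le ?_
      gcongr
    have hball : dilatedB 1 (m + 1) = ball q₀ ((1 / 2) ^ (m + 1)) := by rw [dilatedB, one_mul]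
    have hE := h q₀ ((1 / 2) ^ (m + 1)) (by positivity) u (hball ▸ hharm)
      (Eventually.of_forall hnn)
    set S := u '' dilatedB δ (m + 1)
    have hne : S.Nonempty := by
      refine ⟨_, q₀, ?_, rfl⟩
      rw [mem_dilatedB, res_self]
      positivity
    have h1 : sSup S ≤ essSup u (μ.restrict (ball q₀ (ε * (1 / 2) ^ (m + 1)))) :=
      csSup_le hne (by rintro _ ⟨y, hy, rfl⟩; exact le_essSup_of_isOpen hO hOB u hy)
    have h2 : essInf u (μ.restrict (ball q₀ (ε * (1 / 2) ^ (m + 1)))) ≤ sInf S :=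
      le_csInf hne (by rintro _ ⟨y, hy, rfl⟩; exact essInf_le_of_isOpen hO hOB u hy)
    have h3 : sSup S ≤ C * sInf S :=
      h1.trans (hE.trans (mul_le_mul_of_nonneg_left h2 (by linarith)))
    have hp : 0 < 2 ^ (m + 1) * δ + 1 := by positivity
    have hS : 0 < sSup S := by
      have hS0 : 0 ≤ sSup S := Real.sSup_nonneg (by rintro _ ⟨y, -, rfl⟩; exact hnn y)
      refine lt_of_le_of_ne hS0 fun h0 => ?_
      rw [← h0, div_zero] at r1
      have : (0 : ℝ) < 12⁻¹ * (2 ^ (m + 1) * δ + 1)⁻¹ := by positivity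
      linarith
    rw [← div_eq_mul_inv, div_le_div_iff₀ hS hp] at r2
    nlinarith
  obtain ⟨m, hm⟩ := pow_unbounded_of_one_lt (12 * C / δ) (by norm_num : (1 : ℝ) < 2)
  rw [div_lt_iff₀ hδ0] at hm
  have := key m
  rw [pow_succ] at this
  have : 0 < (2 : ℝ) ^ m * δ := by positivity
  linarith

end

end TreeFractal

theorem mainTheorem2 :
    (∀ (μ : Measure K) [IsFiniteMeasure μ] [μ.IsOpenPosMeasure], ¬ EHI μ) ∧
    ∃ C : ℝ, 1 ≤ C ∧
      ∀ (μ : Measure K) [IsFiniteMeasure μ] [μ.IsOpenPosMeasure],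
      ∀ n k : ℕ, 1 ≤ n → 1 ≤ k →
      ∀ ω : List (Fin 4), ω.length + 1 = n → (∀ i ∈ ω, i = 0 ∨ i = 1) →
        ∃ φ : C(K, ℝ), IsPhi' μ n ω k φ ∧ (∀ x, 0 ≤ φ x) ∧
          (∀ ψ : C(K, ℝ), IsPhi' μ n ω k ψ → EqOn ψ φ (dilatedB 1 n)) ∧
          ∀ ε : ℝ, 0 < ε → ε ≤ 1 / 2 →
            C⁻¹ * (2 ^ n * ε + 1)⁻¹ ≤
                sInf (φ '' dilatedB ε n) / sSup (φ '' dilatedB ε n) ∧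
              sInf (φ '' dilatedB ε n) / sSup (φ '' dilatedB ε n) ≤
                C * (2 ^ n * ε + 1)⁻¹ := by
  refine ⟨fun μ _ _ => not_EHI μ, 12, by norm_num, ?_⟩
  rintro μ _ _ n k - hk ω rfl hω
  obtain ⟨k, rfl⟩ := Nat.exists_eq_add_of_le' hk
  exact ⟨phi ω.length ω (k + 1), isPhi'_phi hω μ (k + 1), phi_nonneg _ _ _,
    fun ψ hψ => eqOn_phi hω μ (k + 1) hψ, fun ε h0 hε => ratio_bounds h0 hε hω k⟩
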